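/- Let $n\ge 0$ be an integer and let $\mathfrak g_N$ be $\mathfrak o_{2n+1}$, $\mathfrak{sp}_{2n}$ or $\mathfrak o_{2n}$ (types $B_n$, $C_n$, $D_n$), with $N=2n+1,2n,2n$ respectively. For $1\le i\le N$ put $i'=N+1-i$. Put $\varepsilon_i=1$ in the orthogonal case; in the symplectic case put $\varepsilon_i=1$ for $i\le n$ and $\varepsilon_i=-1$ for $i>n$. Let $e_{ij}$ be the matrix units, let $e_{ij}^{t}=\varepsilon_i\varepsilon_j e_{j'i'}$, and let $(\bar 1,\dots,\bar N)$ be $(n-\frac12,\dots,\frac12,0,-\frac12,\dots,-n+\frac12)$ in type $B$, $(n,\dots,1,-1,\dots,-n)$ in type $C$, $(n-1,\dots,1,0,0,-1,\dots,-n+1)$ in type $D$. Let $\kappa=\frac N2+1$ in the symplectic case and $\kappa=\frac N2-1$ in the orthogonal case, and $\xi=q^{-2\kappa}$. Define $$R^+(x,q)=q^{-1}(x-1)(x-\xi)R-(q^{-2}-1)(x-\xi)P+\xi(q^{-2}-1)(x-1)Q,$$ where $P=\sum_{i,j}e_{ij}\otimes e_{ji}$, $Q=\sum_{i,j}q^{\bar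 i-\bar j}\varepsilon_i\varepsilon_j\,e_{i'j'}\otimes e_{ij}$ and $$R=q\sum_{i\ne i'}e_{ii}\otimes e_{ii}+\sum_{i\ne j,j'}e_{ii}\otimes e_{jj}+q^{-1}\sum_{i\ne i'}e_{ii}\otimes e_{i'i'}+(q-q^{-1})\sum_{i<j}e_{ij}\otimes e_{ji}-(q-q^{-1})\sum_{i>j}q^{\bar i-\bar j}\varepsilon_i\varepsilon_j\,e_{i'j'}\otimes e_{ij}+\sum_{i=i'}e_{ii}\otimes e_{ii}.$$ There is a unique series $g(u,h)\in\mathbb C((u))[[h]]$ with $g(u,0)=(1-e^{-u})^{-2}$ and $$g(u,h)\,g(u+\kappa h,h)=\frac1{(1-e^{-u-h})(1-e^{-u+h})(1-e^{-u-\kappa h})(1-e^{-u+\kappa h})},$$ where $a(u+\kappa h,h)$ stands for the Taylor expansion in powers of $h$ and the right-hand side for the inverse in $\mathbb C((u))[[h]]$. With this $g$, put $$\widehat R(u)=e^{(1+2\kappa)h/2}\,g(u,h)\,R^+(e^{-u},e^{h/2})\in \mathrm{End}(\mathbb C^N)^{\otimes 2}((u))[[h]]$$ (where $q^{1/2}=e^{h/4}$).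 Let $A_{rs}$ denote $A\in\mathrm{End}(\mathbb C^N)^{\otimes 2}$ acting on the tensor factors $r$ and $s$ (its first factor on $r$, its second on $s$). Then: 1. (Yang–Baxter equation) $\widehat R_{12}(u)\widehat R_{13}(u+v)\widehat R_{23}(v)=\widehat R_{23}(v)\widehat R_{13}(u+v)\widehat R_{12}(u)$ in $\mathrm{End}(\mathbb C^N)^{\otimes 3}((u))((v))[[h]]$, where $\widehat R(u+v)$ is expanded in nonnegative powers of $v$. 2. (Crossing symmetry) $\widehat R(u)\,M_1\,\widehat R(u+\kappa h)^{t_1}M_1^{-1}=1$, where $M=\mathrm{diag}(e^{\bar 1h/2},\dots,e^{\bar Nh/2})$ and $M_1$, $t_1$ indicate that $M$ and the transposition $t$ are applied on the first tensor factor. 3. (Unitarity) $\widehat R_{12}(u)\widehat R_{21}(-u)=1$. -/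

import Mathlib

open scoped Kronecker

noncomputable section

namespace TrigR

/-! ### Combinatorial data of types `B`, `C`, `D` -/

/-- The three types: `o_{2n+1}`, `sp_{2n}`, `o_{2n}`. -/
inductive LieType
  | B
  | C
  | D

/-- The size `N` of the matrices in rank `n`. -/
def dim : LieType → ℕ → ℕ
  | .B, n => 2 * n + 1
  | .C, n => 2 * n
  | .D, n => 2 * n

/-- The sign `ε_i` (the index `i` runs through `0, …, N - 1`). -/
def eps : (X : LieType) → (n : ℕ) → Fin (dim X n) → ℤ
  | .B, _, _ => 1
  | .C, n, i => if i.val < n then 1 else -1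
  | .D, _, _ => 1

/-- Twice the entry of the `N`-tuple `(1̄, …, N̄)`; the index `i` runs through `0, …, N - 1`.
The tuples are `(n - 1/2, …, 1/2, 0, -1/2, …, -n + 1/2)`, `(n, …, 1, -1, …, -n)` and
`(n - 1, …, 1, 0, 0, -1, …, -n + 1)` in types `B`, `C`, `D`. -/
def twoBar : (X : LieType) → (n : ℕ) → Fin (dim X n) → ℤ
  | .B, n, i =>
      if i.val < n then 2 * n - 1 - 2 * i.val
      else if i.val = n then 0
      else 2 * n + 1 - 2 * i.val
  | .C, n, i => if i.val < n then 2 * n - 2 * i.val else 2 * n - 2 - 2 * i.val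
  | .D, n, i => if i.val < n then 2 * n - 2 - 2 * i.val else 2 * n - 2 * i.val

/-- The exponent of `q` in `ξ`: `2 - N` in the orthogonal case, `-2 - N` in the symplectic case. -/
def xiExp : LieType → ℕ → ℤ
  | .B, n => 2 - (dim .B n : ℤ)
  | .C, n => -2 - (dim .C n : ℤ)
  | .D, n => 2 - (dim .D n : ℤ)

/-- `κ = N/2 + 1` in the symplectic case and `κ = N/2 - 1` in the orthogonal case. -/
def kappa : LieType → ℕ → ℂ
  | .B, n => (dim .B n : ℂ) / 2 - 1
  | .C, n => (dim .C n : ℂ) / 2 + 1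
  | .D, n => (dim .D n : ℂ) / 2 - 1

/-! ### The R-matrix over a commutative ring, as a function of `x` and of a unit `t = q^{1/2}`

`End(ℂ^N)^{⊗ 2}` with coefficients in `S` is the ring of matrices over `S` whose rows and columns
are indexed by pairs, through the Kronecker product. -/

section Ring

variable {S : Type*} [CommRing S]

/-- The ring `End(ℂ^N) ⊗ End(ℂ^N) ⊗ S`. -/
abbrev End2 (N : ℕ) (S : Type*) := Matrix (Fin N × Fin N) (Fin N × Fin N) S

/-- `e_{ij} ⊗ e_{kl}`. -/
def unit2 (S : Type*) [CommRing S] {N : ℕ} (i j k l : Fin N) : End2 N S :=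
  Matrix.single i j (1 : S) ⊗ₖ Matrix.single k l (1 : S)

/-- `q = t ^ 2`. -/
def qOf (t : Sˣ) : Sˣ := t ^ 2

/-- `ξ` as a power of `q`. -/
def xi (X : LieType) (n : ℕ) (t : Sˣ) : Sˣ := qOf t ^ xiExp X n

/-- The coefficient `q^{ī - j̄} ε_i ε_j`. -/
def wt (X : LieType) (n : ℕ) (t : Sˣ) (i j : Fin (dim X n)) : S :=
  ((t ^ (twoBar X n i - twoBar X n j) : Sˣ) : S) * ((eps X n i * eps X n j : ℤ) : S)

/-- The permutation operator `P`. -/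
def opP (X : LieType) (n : ℕ) (S : Type*) [CommRing S] : End2 (dim X n) S :=
  ∑ i, ∑ j, unit2 S i j j i

/-- The operator `Q`; the index `i' = N + 1 - i` is `i.rev`. -/
def opQ (X : LieType) (n : ℕ) (t : Sˣ) : End2 (dim X n) S :=
  ∑ i, ∑ j, wt X n t i j • unit2 S i.rev j.rev i j

/-- The operator `R`. The last sum is over the indices with `i = i'`: it has one term, the middle
index, if `N` is odd, and it is empty if `N` is even. -/
def opR (X : LieType) (n : ℕ) (t : Sˣ) : End2 (dim X n) S :=
  let q : S := (qOf t : Sˣ)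
  let q' : S := ((qOf t)⁻¹ : Sˣ)
  (∑ i, if i ≠ i.rev then q • unit2 S i i i i else 0)
    + (∑ i, ∑ j, if i ≠ j ∧ i ≠ j.rev then unit2 S i i j j else 0)
    + (∑ i, if i ≠ i.rev then q' • unit2 S i i i.rev i.rev else 0)
    + (∑ i, ∑ j, if i < j then (q - q') • unit2 S i j j i else 0)
    - (∑ i, ∑ j, if j < i then ((q - q') * wt X n t i j) • unit2 S i.rev j.rev i j else 0)
    + (∑ i, if i = i.rev then unit2 S i i i i else 0)

/-- `R⁺(x, q) = q⁻¹ (x - 1)(x - ξ) R - (q⁻² - 1)(x - ξ) P + ξ (q⁻² - 1)(x - 1) Q`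
with `q = t ^ 2`. -/
def Rplus (X : LieType) (n : ℕ) (x : S) (t : Sˣ) : End2 (dim X n) S :=
  let q' : S := ((qOf t)⁻¹ : Sˣ)
  let ξ : S := (xi X n t : Sˣ)
  (q' * (x - 1) * (x - ξ)) • opR X n t
    - ((q' ^ 2 - 1) * (x - ξ)) • opP X n S
    + (ξ * (q' ^ 2 - 1) * (x - 1)) • opQ X n t

/-- `D₁ = D ⊗ 1` for the diagonal matrix `D = diag(q^{1̄}, …, q^{N̄})`. -/
def diagD1 (X : LieType) (n : ℕ) (t : Sˣ) : End2 (dim X n) S :=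
  Matrix.diagonal (fun i => ((t ^ twoBar X n i : Sˣ) : S)) ⊗ₖ
    (1 : Matrix (Fin (dim X n)) (Fin (dim X n)) S)

/-- The transposition `e_{ij} ↦ ε_i ε_j e_{j' i'}` applied to the first tensor factor, written in
terms of matrix entries. -/
def transpose1 (X : LieType) (n : ℕ) (A : End2 (dim X n) S) : End2 (dim X n) S :=
  Matrix.of fun a b =>
    ((eps X n a.1.rev * eps X n b.1.rev : ℤ) : S) * A (b.1.rev, a.2) (a.1.rev, b.2)

/-- The tensor notation `A_{rs}` in `End(ℂ^N)^{⊗ m}`, whose elements are matrices indexed by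
`m`-tuples: the first factor of `A` acts on position `r`, the second one on position `s`, and
the identity acts on all other positions. -/
def legs {N m : ℕ} (r s : Fin m) (A : End2 N S) : Matrix (Fin m → Fin N) (Fin m → Fin N) S :=
  Matrix.of fun a b =>
    if ∀ p, p ≠ r → p ≠ s → a p = b p then A (a r, a s) (b r, b s) else 0

end Ring

/-! ### The rings `ℂ((u))[[h]]` and `ℂ((u))((v))[[h]]` -/

/-- `ℂ((u))`. -/
abbrev Lu := LaurentSeries ℂ

/-- `ℂ((u))[[h]]`. -/
abbrev Luh := PowerSeries Lu

/-- `ℂ((u))((v))`. -/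
abbrev Luv := LaurentSeries Lu

/-- `ℂ((u))((v))[[h]]`. -/
abbrev Luvh := PowerSeries Luv

/-- `e^{-u}` in `ℂ((u))`. -/
def expNegU : Lu := HahnSeries.ofPowerSeries ℤ ℂ (PowerSeries.rescale (-1 : ℂ) (PowerSeries.exp ℂ))

/-- `e^{-u}` in `ℂ((u))[[h]]`. -/
def expNegU' : Luh := PowerSeries.C expNegU

/-- `e^{c h}` in `ℂ((u))[[h]]`. -/
def expH (c : ℂ) : Luh :=
  PowerSeries.map (HahnSeries.C : ℂ →+* Lu) (PowerSeries.rescale c (PowerSeries.exp ℂ))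

theorem expH_mul_expH_neg (c : ℂ) : expH c * expH (-c) = 1 := by
  unfold expH
  rw [← map_mul, PowerSeries.exp_mul_exp_eq_exp_add, add_neg_cancel, PowerSeries.rescale_zero]
  simp

/-- The unit `e^{h/4}`, which is substituted for `q^{1/2}`. -/
def expQuarter : Luhˣ where
  val := expH (1 / 4)
  inv := expH (-(1 / 4))
  val_inv := expH_mul_expH_neg _
  inv_val := by rw [mul_comm]; exact expH_mul_expH_neg _

/-- The substitution `u ↦ u + c h` in `ℂ((u))[[h]]`, by the formal Taylor theorem:
`∑ a_l(u) h^l ↦ ∑_k (∑_{m + l = k} (c^m / m!) (d/du)^m a_l(u)) h^k`. The Hasse derivative is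
`(1 / m!) (d/du)^m`. -/
def shiftH (c : ℂ) (a : Luh) : Luh :=
  PowerSeries.mk fun k =>
    ∑ p ∈ Finset.HasAntidiagonal.antidiagonal k,
      c ^ p.1 • LaurentSeries.hasseDeriv ℂ p.1 (PowerSeries.coeff p.2 a)

/-- Application of a map to all the coefficients of a power series in `h`. -/
def mapCoeff {A B : Type*} [Semiring A] [Semiring B] (φ : A → B) (a : PowerSeries A) :
    PowerSeries B :=
  PowerSeries.mk fun k => φ (PowerSeries.coeff k a)

/-- The substitution `u ↦ -u` in `ℂ((u))`. -/
def negU (f : Lu) : Lu where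
  coeff k := (-1 : ℂ) ^ k * f.coeff k
  isPWO_support' := f.isPWO_support.mono fun k hk => by
    simp only [Function.mem_support, HahnSeries.mem_support] at hk ⊢
    exact right_ne_zero_of_mul hk

/-- `f(u) ↦ f(u)`, as a map `ℂ((u)) → ℂ((u))((v))`. -/
def atU (f : Lu) : Luv := HahnSeries.C f

/-- `f(u) ↦ f(v)`, as a map `ℂ((u)) → ℂ((u))((v))`. -/
def atV (f : Lu) : Luv := HahnSeries.map f (HahnSeries.C : ℂ →+* Lu)

/-- `f(u) ↦ f(u + v)`, expanded in nonnegative powers of `v`, as a map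
`ℂ((u)) → ℂ((u))((v))`: `f(u + v) = ∑_m (1 / m!) f^{(m)}(u) v^m`. -/
def atUV (f : Lu) : Luv :=
  HahnSeries.ofPowerSeries ℤ Lu (PowerSeries.mk fun m => LaurentSeries.hasseDeriv ℂ m f)

/-! ### The normalizing series and the additive R-matrix -/

/-- `g(u, 0) = (1 - e^{-u})^{-2}` and `g(u, h) g(u + κ h, h)` is the inverse of
`(1 - e^{-u-h})(1 - e^{-u+h})(1 - e^{-u-κh})(1 - e^{-u+κh})`. The inverse in `ℂ((u))[[h]]` is a
true one: the constant term `(1 - e^{-u})^4` of this product is nonzero. -/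
def IsNormalizing (κ : ℂ) (g : Luh) : Prop :=
  PowerSeries.constantCoeff g = ((1 - expNegU) ^ 2)⁻¹ ∧
  g * shiftH κ g =
    ((1 - expNegU' * expH (-1)) * (1 - expNegU' * expH 1) *
      (1 - expNegU' * expH (-κ)) * (1 - expNegU' * expH κ))⁻¹

/-- `e^{(1 + 2κ)h/2} g(u, h) R⁺(e^{-u}, e^{h/2})`. -/
def Rhat (X : LieType) (n : ℕ) (g : Luh) : End2 (dim X n) Luh :=
  (expH ((1 + 2 * kappa X n) / 2) * g) • Rplus X n expNegU' expQuarter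

end TrigR

end

/-!
Entrywise, `R⁺(x)` is a combination of the identity, of the matrix units `e_{ab} ⊗ e_{ba}` and of
the matrix units supported on pairs of mirror indices. Unitarity and crossing symmetry of `R⁺` up to
a scalar factor follow from the formulas for the partial sums of `q^{2 ī}`.

Consider the difference of the two sides of the Yang–Baxter equation for `R⁺`. By unitarity, a
permutation of the tensor factors turns it into the same difference at other spectral parameters,
multiplied on both sides by R-matrices; by crossing symmetry, so does the transposition of the first
factor. Since `R⁺` is a scalar modulo `h`, multiplication by R-matrices rescales the leading power
of `h` in the difference. By induction on this power, for all generic spectral parameters at once,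
the vanishing of one entry of the difference thus implies that of the entries obtained by a
permutation of the factors or by the transposition. Every entry is so related to an entry whose
column has no two mirror indices, or to one in a few special families, and those are checked
directly.

The series `g` is determined coefficient by coefficient in `h`, because the leading term of
`g ↦ g(u, h) g(u + κ h, h)` is multiplication by `2 g(u, 0)`, which is invertible. The same argument
identifies `g(u, h) g(-u, h)`, which is what unitarity needs.
-/

noncomputable section

namespace TrigR

/-- The scalar `R⁺₁₂(x) R⁺₂₁(x')` when `x x' = 1`, with `q' = q⁻¹`. -/
def unitarityScalar {S : Type*} [CommRing S] (q' ξ x x' : S) : S :=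
  (x - q' ^ 2) * (x - ξ) * (x' - q' ^ 2) * (x' - ξ)

/-- Parameters of an R-matrix with `N` weights: `q` and `ξ`, the sign `ε` with which `i ↦ i.rev`
acts on the signs `ε_i`, the number `η = q^{-ε}`, and the weights `β i = q^{ī} ε_i`. The last four
fields are all that is used about the tuple `(1̄, …, N̄)`. -/
structure RMatrixData (F : Type*) [Field F] (N : ℕ) where
  q : F
  ξ : F
  ε : F
  η : F
  β : Fin N → F
  q_ne_zero : q ≠ 0
  ξ_ne_zero : ξ ≠ 0
  ε_eq : ε = 1 ∧ η = q⁻¹ ∨ ε = -1 ∧ η = q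
  β_ne_zero : ∀ i, β i ≠ 0
  β_rev : ∀ i, β i.rev = ε / β i
  middle : ∀ i, i = i.rev → β i = 1 ∧ ε = 1
  sum_Ioi_β_sq : ∀ i, (q - q⁻¹) * ∑ k ∈ Finset.Ioi i, β k ^ 2 =
    β i ^ 2 / q - ξ * η + (if i < i.rev then ε * (q - q⁻¹) else 0) +
      (if i = i.rev then 1 - q⁻¹ else 0)
  sum_β_sq : 0 < N → (q - q⁻¹) * ∑ k, β k ^ 2 = (ξ * η)⁻¹ - ξ * η + ε * (q - q⁻¹)

namespace RMatrixData

variable {F : Type*} [Field F] {N : ℕ} (d : RMatrixData F N)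

theorem ε_mul_self : d.ε * d.ε = 1 := by
  rcases d.ε_eq with ⟨h, -⟩ | ⟨h, -⟩ <;> simp [h]

theorem ε_ne_zero : d.ε ≠ 0 :=
  left_ne_zero_of_mul (d.ε_mul_self.trans_ne one_ne_zero)

/-- The coefficient of the identity in `R⁺(x)`. -/
def diagCoeff (x : F) : F := d.q⁻¹ * (x - 1) * (x - d.ξ)

/-- The coefficient of `e_{ab} ⊗ e_{ba}` in `R⁺(x)`. The one at `a = b` absorbs the coefficient `q`
of `e_{aa} ⊗ e_{aa}` in the constant matrix `R`. -/
def exchCoeff (x : F) (a b : Fin N) : F :=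
  (x - d.ξ) * if a = b ∧ a ≠ a.rev then (1 - d.q⁻¹) * (x + d.q⁻¹)
    else (1 - d.q⁻¹ ^ 2) * if a < b then x else 1

/-- Minus the coefficient of `e_{b'c'} ⊗ e_{bc}` in `R⁺(x)`. The one at `b = c` absorbs the
coefficient `q⁻¹` of `e_{b'b'} ⊗ e_{bb}` in the constant matrix `R`. -/
def annihCoeff (x : F) (b c : Fin N) : F :=
  (x - 1) * if b = c ∧ b ≠ b.rev then (1 - d.q⁻¹) * (d.ξ + d.q⁻¹ * x)
    else (1 - d.q⁻¹ ^ 2) * (d.β b / d.β c) * if c < b then x else d.ξ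

/-- The R-matrix `R⁺(x)` of the given parameters. -/
def R (x : F) : End2 N F :=
  Matrix.of fun a b =>
    (if a.1 = b.1 ∧ a.2 = b.2 then d.diagCoeff x else 0)
    + (if a.1 = b.2 ∧ a.2 = b.1 then d.exchCoeff x a.1 a.2 else 0)
    - (if a.2 = a.1.rev ∧ b.2 = b.1.rev then d.annihCoeff x a.2 b.2 else 0)

theorem R_apply (x : F) (a b c e : Fin N) : d.R x (a, b) (c, e) =
    (if a = c ∧ b = e then d.diagCoeff x else 0)
    + (if a = e ∧ b = c then d.exchCoeff x a b else 0)
    - (if b = a.rev ∧ e = c.rev then d.annihCoeff x b e else 0) := rfl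

theorem exchCoeff_rev_rev (x : F) (a b : Fin N) :
    d.exchCoeff x a.rev b.rev = d.exchCoeff x b a := by
  simp only [exchCoeff, Fin.rev_inj, Fin.rev_lt_rev, Fin.rev_rev]
  grind

theorem annihCoeff_rev_rev (x : F) (a b : Fin N) :
    d.annihCoeff x a.rev b.rev = d.annihCoeff x b a := by
  have ha := d.β_ne_zero a
  have hb := d.β_ne_zero b
  have hε := d.ε_ne_zero
  have hquot : d.ε / d.β a / (d.ε / d.β b) = d.β b / d.β a := by field_simp
  simp only [annihCoeff, Fin.rev_inj, Fin.rev_lt_rev, Fin.rev_rev, d.β_rev, hquot]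
  grind

theorem R_rev (x : F) (a b c e : Fin N) :
    d.R x (a.rev, b.rev) (c.rev, e.rev) = d.R x (c, e) (a, b) := by
  simp only [R_apply, Fin.rev_inj, exchCoeff_rev_rev, annihCoeff_rev_rev]
  grind [Fin.rev_rev]

theorem diagCoeff_crossing {x : F} (hx : x ≠ 0) :
    d.diagCoeff x = x ^ 2 / d.ξ * d.diagCoeff (d.ξ / x) := by
  have hq := d.q_ne_zero
  have hξ := d.ξ_ne_zero
  rw [diagCoeff, diagCoeff]
  field_simp
  ring

theorem annihCoeff_crossing {x : F} (hx : x ≠ 0) {a c : Fin N} (hac : a = c → a ≠ a.rev) :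
    d.β c / d.β a * d.annihCoeff x a c = -(x ^ 2 / d.ξ * d.exchCoeff (d.ξ / x) a c) := by
  have hq := d.q_ne_zero
  have hξ := d.ξ_ne_zero
  have ha := d.β_ne_zero a
  have hc := d.β_ne_zero c
  rw [annihCoeff, exchCoeff]
  rcases lt_trichotomy a c with h | rfl | h
  · simp only [h.ne, h, h.not_gt, false_and, if_true, if_false]
    field_simp
    ring
  · simp only [hac rfl, ne_eq, not_false_eq_true, and_self, if_true]
    field_simp
    ring
  · simp only [h.ne', h, h.not_gt, false_and, if_true, if_false]
    field_simp
    ring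

theorem exchCoeff_crossing {x : F} (hx : x ≠ 0) {a c : Fin N} (hac : a = c → a ≠ a.rev) :
    d.β a / d.β c * d.exchCoeff x a c = -(x ^ 2 / d.ξ * d.annihCoeff (d.ξ / x) a c) := by
  have hξ := d.ξ_ne_zero
  have ha := d.β_ne_zero a
  have hc := d.β_ne_zero c
  have hcross := d.annihCoeff_crossing (div_ne_zero hξ hx) hac
  rw [div_div_cancel₀ hξ] at hcross
  field_simp at hcross ⊢
  linear_combination hcross

theorem R_crossing_middle {x : F} (hx : x ≠ 0) {a : Fin N} (ha : a = a.rev) :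
    d.R x (a, a) (a, a) = x ^ 2 / d.ξ * d.R (d.ξ / x) (a, a) (a, a) := by
  have hq := d.q_ne_zero
  have hξ := d.ξ_ne_zero
  simp only [R_apply, diagCoeff, exchCoeff, annihCoeff, ← ha, (d.middle a ha).1, ne_eq,
    not_true_eq_false, and_false, lt_irrefl, and_self, if_true, if_false]
  field_simp
  ring

theorem R_crossing {x : F} (hx : x ≠ 0) (a b c e : Fin N) :
    d.β a / d.β c * d.R x (c.rev, b) (a.rev, e) = x ^ 2 / d.ξ * d.R (d.ξ / x) (b, a) (e, c) := by
  by_cases hmid : a = a.rev ∧ b = a ∧ c = a ∧ e = a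
  · obtain ⟨ha, rfl, rfl, rfl⟩ := hmid
    rw [← ha, d.R_crossing_middle hx ha, div_self (d.β_ne_zero e), one_mul]
  · have hdiag : d.β a / d.β c * (if c.rev = a.rev ∧ b = e then d.diagCoeff x else 0) =
        x ^ 2 / d.ξ * (if b = e ∧ a = c then d.diagCoeff (d.ξ / x) else 0) := by
      grind [d.β_ne_zero, d.diagCoeff_crossing hx, Fin.rev_inj]
    have hexch : d.β a / d.β c * (if c.rev = e ∧ b = a.rev then d.exchCoeff x c.rev b else 0) =
        -(x ^ 2 / d.ξ * (if a = b.rev ∧ c = e.rev then d.annihCoeff (d.ξ / x) a c else 0)) := by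
      by_cases h : c.rev = e ∧ b = a.rev
      · obtain ⟨rfl, rfl⟩ := h
        rw [if_pos ⟨rfl, rfl⟩, exchCoeff_rev_rev, d.exchCoeff_crossing hx (by grind),
          if_pos ⟨(Fin.rev_rev a).symm, (Fin.rev_rev c).symm⟩]
      · rw [if_neg h, if_neg (by grind [Fin.rev_rev]), mul_zero, mul_zero, neg_zero]
    have hannih : d.β a / d.β c *
        (if b = c.rev.rev ∧ e = a.rev.rev then d.annihCoeff x b e else 0) =
        -(x ^ 2 / d.ξ * (if b = c ∧ a = e then d.exchCoeff (d.ξ / x) b a else 0)) := by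
      by_cases h : b = c ∧ a = e
      · obtain ⟨rfl, rfl⟩ := h
        rw [Fin.rev_rev, Fin.rev_rev, if_pos ⟨rfl, rfl⟩, if_pos ⟨rfl, rfl⟩,
          d.annihCoeff_crossing hx (by grind)]
      · rw [if_neg h, if_neg (by grind [Fin.rev_rev]), mul_zero, mul_zero, neg_zero]
    rw [R_apply, R_apply]
    linear_combination hdiag + hexch - hannih

/-- The block of `R⁺(x)` on the span of the vectors `v_c ⊗ v_{c'}`. -/
def mirrorBlock (x : F) (a c : Fin N) : F := d.R x (a, a.rev) (c, c.rev)

theorem R_mirror_row (x : F) (a c e : Fin N) :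
    d.R x (a, a.rev) (c, e) = if e = c.rev then d.mirrorBlock x a c else 0 := by
  simp only [mirrorBlock, R_apply]
  grind [Fin.rev_rev]

theorem R_mirror_col (x : F) (a b c : Fin N) :
    d.R x (a, b) (c, c.rev) = if b = a.rev then d.mirrorBlock x a c else 0 := by
  simp only [mirrorBlock, R_apply]
  grind [Fin.rev_rev]

/-- The block of the constant matrix `R` on the span of the vectors `v_c ⊗ v_{c'}`. -/
def braidBlock (a c : Fin N) : F :=
  (if c = a then if a = a.rev then 1 else d.q⁻¹ else 0)
  + (if c = a.rev then if a < a.rev then d.q - d.q⁻¹ else 0 else 0)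
  - (d.q - d.q⁻¹) / d.β a * (if a < c then d.β c else 0)

theorem braidBlock_rev_rev (a c : Fin N) : d.braidBlock a.rev c.rev = d.braidBlock c a := by
  have ha := d.β_ne_zero a
  have hc := d.β_ne_zero c
  have hε := d.ε_ne_zero
  have hmid : (c.rev = a ∧ a.rev < a) ↔ (a = c.rev ∧ c < c.rev) := by grind [Fin.rev_rev]
  simp only [braidBlock, Fin.rev_rev, Fin.rev_inj, Fin.rev_lt_rev, d.β_rev, ← ite_and, hmid]
  congr 1
  · grind [Fin.rev_rev]
  · split_ifs
    · field_simp
    · simp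

theorem mirrorBlock_eq (x : F) (a c : Fin N) :
    d.mirrorBlock x a c = d.q⁻¹ * (x - 1) * (x - d.ξ) * d.braidBlock a c
      + (1 - d.q⁻¹ ^ 2) * (x - d.ξ) * (if c = a.rev then 1 else 0)
      - (1 - d.q⁻¹ ^ 2) * d.ξ * (x - 1) / d.β a * d.β c := by
  have hq := d.q_ne_zero
  have ha := d.β_ne_zero a
  have hc := d.β_ne_zero c
  rw [mirrorBlock, R_apply, annihCoeff_rev_rev, diagCoeff, exchCoeff, annihCoeff, braidBlock]
  rcases eq_or_ne a a.rev with hmid | hmid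
  · simp only [← hmid, lt_irrefl, ne_eq, not_true_eq_false]
    grind
  · have hflip : (a = c.rev ∧ a.rev = c) ↔ c = a.rev := by grind [Fin.rev_rev]
    rcases lt_trichotomy a c with hac | rfl | hac
    · simp only [hac, hac.ne, hac.ne', hmid, hflip, false_and, and_self, if_true, if_false]
      split_ifs <;> field_simp <;> ring
    · simp only [hmid, lt_irrefl, ne_eq, not_false_eq_true, false_and, and_self, if_true, if_false]
      field_simp
      ring
    · simp only [hac.ne, hac.ne', hac.not_gt, hmid, hflip, false_and, and_self, if_true, if_false]
      split_ifs <;> field_simp <;> ring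

theorem mirrorBlock_rev_rev (x : F) (a c : Fin N) :
    d.mirrorBlock x a.rev c.rev = d.mirrorBlock x c a :=
  d.R_rev x a a.rev c c.rev

theorem sum_mul_braidBlock (G : Fin N → F) (a : Fin N) :
    ∑ k, G k * d.braidBlock a k =
      (if a = a.rev then 1 else d.q⁻¹) * G a
      + (if a < a.rev then d.q - d.q⁻¹ else 0) * G a.rev
      - (d.q - d.q⁻¹) / d.β a * ∑ k ∈ Finset.Ioi a, G k * d.β k := by
  have htail : ∑ k ∈ Finset.Ioi a, G k * d.β k = ∑ k, G k * (if a < k then d.β k else 0) := by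
    simp only [mul_ite, mul_zero, ← Finset.sum_filter]
    congr 1
    ext k
    simp
  rw [htail, Finset.mul_sum]
  simp only [braidBlock, mul_sub, mul_add, mul_ite, mul_zero, Finset.sum_sub_distrib,
    Finset.sum_add_distrib, Finset.sum_ite_eq', Finset.mem_univ, if_true]
  congr 1
  · split_ifs <;> ring
  · exact Finset.sum_congr rfl fun k _ => by split_ifs <;> ring

theorem sum_β_mul_braidBlock (a : Fin N) :
    ∑ k, d.β k * d.braidBlock a k = d.ξ * d.η / d.β a := by
  have hq := d.q_ne_zero
  have ha := d.β_ne_zero a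
  have hsum := d.sum_Ioi_β_sq a
  simp only [pow_two] at hsum
  rw [sum_mul_braidBlock, div_mul_eq_mul_div, hsum, d.β_rev]
  by_cases hmid : a = a.rev
  · obtain ⟨hβ, -⟩ := d.middle a hmid
    simp only [← hmid, hβ, lt_irrefl, if_true, if_false]
    ring
  · simp only [hmid, if_false]
    split_ifs <;> field_simp <;> ring

theorem braidBlock_of_lt {a c : Fin N} (hac : a < c) :
    d.braidBlock a c =
      (if c = a.rev then d.q - d.q⁻¹ else 0) - (d.q - d.q⁻¹) / d.β a * d.β c := by
  simp only [braidBlock, hac.ne', hac, if_true, if_false, zero_add]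
  congr 1
  split_ifs with h h' <;> first | rfl | exact absurd (h ▸ hac) h'

theorem braidBlock_of_gt {a c : Fin N} (hca : c < a) : d.braidBlock a c = 0 := by
  simp only [braidBlock, hca.ne, hca.not_gt, if_false, mul_zero, sub_zero, zero_add]
  split_ifs with h h' <;> first | rfl | exact absurd (h ▸ hca) h'.not_gt

theorem braidBlock_self (a : Fin N) : d.braidBlock a a = if a = a.rev then 1 else d.q⁻¹ := by
  by_cases h : a = a.rev
  · simp [braidBlock, ← h]
  · simp [braidBlock, h]

theorem sum_Ioi_braidBlock_mul_β {a c : Fin N} (hac : a ≤ c) :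
    ∑ k ∈ Finset.Ioi c, d.braidBlock a k * d.β k =
      (if c < a.rev then (d.q - d.q⁻¹) * d.ε / d.β a else 0)
      - (d.β c ^ 2 / d.q - d.ξ * d.η + (if c < c.rev then d.ε * (d.q - d.q⁻¹) else 0) +
        (if c = c.rev then 1 - d.q⁻¹ else 0)) / d.β a := by
  have hentry : ∀ k ∈ Finset.Ioi c, d.braidBlock a k * d.β k =
      (if k = a.rev then (d.q - d.q⁻¹) * d.ε / d.β a else 0)
        - (d.q - d.q⁻¹) * d.β k ^ 2 / d.β a := by
    intro k hk
    rw [d.braidBlock_of_lt (hac.trans_lt (Finset.mem_Ioi.1 hk))]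
    split_ifs with h
    · rw [h, d.β_rev]
      ring
    · ring
  rw [Finset.sum_congr rfl hentry, Finset.sum_sub_distrib, ← Finset.sum_div, ← Finset.mul_sum,
    d.sum_Ioi_β_sq, Finset.sum_ite_eq']
  simp only [Finset.mem_Ioi]

theorem sum_braidBlock_mul_braidBlock_of_rev_lt {a c : Fin N} (hac : a ≤ c) (hc' : c.rev < c) :
    ∑ k, d.braidBlock a k * d.braidBlock c k = (if a = c then 1 else 0)
      + (d.q - d.q⁻¹) * (d.braidBlock a c.rev - d.ξ * d.η / (d.β a * d.β c)) := by
  have hq := d.q_ne_zero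
  have ha := d.β_ne_zero a
  have hc := d.β_ne_zero c
  rw [sum_mul_braidBlock, d.sum_Ioi_braidBlock_mul_β hac]
  simp only [hc'.not_gt, hc'.ne', if_false]
  rcases hac.eq_or_lt with rfl | hac
  · simp only [braidBlock_self, d.braidBlock_of_gt hc', hc'.not_gt, hc'.ne', if_true, if_false]
    field_simp
    ring
  · rcases lt_trichotomy c a.rev with hca | hca | hca
    · have hca' : a < c.rev := by rw [← Fin.rev_rev a]; exact Fin.rev_lt_rev.2 hca
      have hrev : c.rev ≠ a.rev := fun h => hac.ne' (Fin.rev_injective h)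
      simp only [d.braidBlock_of_lt hac, d.braidBlock_of_lt hca', hac.ne, hca, hca.ne, hrev,
        d.β_rev, if_true, if_false]
      field_simp
      ring
    · obtain rfl : a = c.rev := by rw [hca, Fin.rev_rev]
      simp only [d.braidBlock_of_lt hac, braidBlock_self, hac.ne, Fin.rev_rev, lt_irrefl, d.β_rev,
        if_true, if_false]
      field_simp
      ring
    · have hca' : c.rev < a := by rw [← Fin.rev_rev a]; exact Fin.rev_lt_rev.2 hca
      simp only [d.braidBlock_of_lt hac, d.braidBlock_of_gt hca', hac.ne, hca.not_gt, hca.ne',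
        if_false]
      field_simp
      ring

theorem sum_braidBlock_mul_braidBlock_of_le {a c : Fin N} (hac : a ≤ c) :
    ∑ k, d.braidBlock a k * d.braidBlock c k = (if a = c then 1 else 0)
      + (d.q - d.q⁻¹) * (d.braidBlock a c.rev - d.ξ * d.η / (d.β a * d.β c)) := by
  have hq := d.q_ne_zero
  have ha := d.β_ne_zero a
  have hc := d.β_ne_zero c
  rcases lt_trichotomy c c.rev with hc' | hc' | hc'
  · rw [sum_mul_braidBlock, d.sum_Ioi_braidBlock_mul_β hac]
    have hca : c < a.rev := hc'.trans_le (Fin.rev_le_rev.2 hac)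
    simp only [hc', hc'.ne, hca, if_true, if_false]
    rcases hac.eq_or_lt with rfl | hac
    · simp only [braidBlock_self, hc'.ne, if_true, if_false]
      field_simp
      ring
    · simp only [d.braidBlock_of_lt hac, hac.ne, hca.ne, if_false]
      field_simp
      ring
  · rw [sum_mul_braidBlock, d.sum_Ioi_braidBlock_mul_β hac]
    obtain ⟨hβ, hε⟩ := d.middle c hc'
    simp only [← hc', lt_irrefl, hβ, hε, if_true, if_false]
    rcases hac.eq_or_lt with rfl | hac
    · simp only [braidBlock_self, ← hc', lt_irrefl, hβ, if_true, if_false]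
      field_simp
      ring
    · have hca : c < a.rev := by rw [hc']; exact Fin.rev_lt_rev.2 hac
      simp only [d.braidBlock_of_lt hac, hac.ne, hca, hca.ne, hβ, if_true, if_false]
      field_simp
      ring
  · exact d.sum_braidBlock_mul_braidBlock_of_rev_lt hac hc'

theorem sum_braidBlock_mul_braidBlock (a c : Fin N) :
    ∑ k, d.braidBlock a k * d.braidBlock c k = (if a = c then 1 else 0)
      + (d.q - d.q⁻¹) * (d.braidBlock a c.rev - d.ξ * d.η / (d.β a * d.β c)) := by
  rcases le_total a c with hac | hca
  · exact d.sum_braidBlock_mul_braidBlock_of_le hac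
  · have hsymm : d.braidBlock a c.rev = d.braidBlock c a.rev := by
      rw [← braidBlock_rev_rev, Fin.rev_rev]
    simp only [mul_comm (d.braidBlock a _), d.sum_braidBlock_mul_braidBlock_of_le hca, hsymm,
      eq_comm (a := a), mul_comm (d.β a)]

theorem sum_braidBlock_add_mul_braidBlock_add (a c : Fin N) (α γ δ α' γ' δ' : F) :
    ∑ k, (α * d.braidBlock a k + γ * (if k = a.rev then 1 else 0) - δ * d.β k) *
      (α' * d.braidBlock c k + γ' * (if k = c.rev then 1 else 0) - δ' * d.β k) =
    α * α' * ∑ k, d.braidBlock a k * d.braidBlock c k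
    + (α * γ' + γ * α') * d.braidBlock a c.rev + γ * γ' * (if a = c then 1 else 0)
    - (α * δ' * (d.ξ * d.η / d.β a) + δ * α' * (d.ξ * d.η / d.β c))
    - (γ * δ' * d.β a.rev + δ * γ' * d.β c.rev) + δ * δ' * ∑ k, d.β k ^ 2 := by
  have hsymm : d.braidBlock a c.rev = d.braidBlock c a.rev := by
    rw [← d.braidBlock_rev_rev, Fin.rev_rev]
  have hprod : ∀ k, (α * d.braidBlock a k + γ * (if k = a.rev then 1 else 0) - δ * d.β k) *
      (α' * d.braidBlock c k + γ' * (if k = c.rev then 1 else 0) - δ' * d.β k) =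
      α * α' * (d.braidBlock a k * d.braidBlock c k)
      - α * δ' * (d.β k * d.braidBlock a k) - δ * α' * (d.β k * d.braidBlock c k)
      + δ * δ' * d.β k ^ 2
      + (if k = c.rev then γ' * (α * d.braidBlock a k - δ * d.β k) else 0)
      + (if k = a.rev then γ * (α' * d.braidBlock c k - δ' * d.β k
        + γ' * (if k = c.rev then 1 else 0)) else 0) := by
    intro k
    split_ifs <;> ring
  simp only [hprod, Finset.sum_add_distrib, Finset.sum_sub_distrib, ← Finset.mul_sum,
    sum_β_mul_braidBlock, Finset.sum_ite_eq', Finset.mem_univ, if_true, Fin.rev_inj, hsymm]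
  ring

theorem sum_mirrorBlock_mul_mirrorBlock {x : F} (hx : x ≠ 0) (a c : Fin N) :
    ∑ k, d.mirrorBlock x a k * d.mirrorBlock x⁻¹ c k =
      if a = c then unitarityScalar d.q⁻¹ d.ξ x x⁻¹ else 0 := by
  have hq := d.q_ne_zero
  have hξ := d.ξ_ne_zero
  have ha := d.β_ne_zero a
  have hc := d.β_ne_zero c
  have hsum : (1 - d.q⁻¹ ^ 2) * ∑ k, d.β k ^ 2 =
      d.q⁻¹ * ((d.ξ * d.η)⁻¹ - d.ξ * d.η + d.ε * (d.q - d.q⁻¹)) := by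
    rw [← d.sum_β_sq a.pos]
    field_simp
  simp only [mirrorBlock_eq, sum_braidBlock_add_mul_braidBlock_add, sum_braidBlock_mul_braidBlock,
    d.β_rev, unitarityScalar]
  generalize ∑ k, d.β k ^ 2 = S at hsum ⊢
  have hcorner : (1 - d.q⁻¹ ^ 2) * d.ξ * (x - 1) / d.β a *
      ((1 - d.q⁻¹ ^ 2) * d.ξ * (x⁻¹ - 1) / d.β c) * S =
      (1 - d.q⁻¹ ^ 2) * d.ξ ^ 2 * (x - 1) * (x⁻¹ - 1) / (d.β a * d.β c) *
        (d.q⁻¹ * ((d.ξ * d.η)⁻¹ - d.ξ * d.η + d.ε * (d.q - d.q⁻¹))) := by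
    rw [← hsum]
    field_simp
  rw [hcorner]
  rcases eq_or_ne a c with rfl | hac
  · simp only [if_true]
    rcases d.ε_eq with ⟨hε, hη⟩ | ⟨hε, hη⟩ <;> rw [hε, hη] <;> field_simp <;> ring
  · simp only [hac, if_false]
    rcases d.ε_eq with ⟨hε, hη⟩ | ⟨hε, hη⟩ <;> rw [hε, hη] <;> field_simp <;> ring

theorem R_row {a b : Fin N} (hab : b ≠ a.rev) (x : F) (c e : Fin N) :
    d.R x (a, b) (c, e) = (if a = c ∧ b = e then d.diagCoeff x else 0) +
      (if a = e ∧ b = c then d.exchCoeff x a b else 0) := by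
  rw [R_apply, if_neg (fun h => hab h.1 : ¬ (b = a.rev ∧ e = c.rev)), sub_zero]

theorem R_col {c e : Fin N} (hce : e ≠ c.rev) (x : F) (a b : Fin N) :
    d.R x (a, b) (c, e) = (if a = c ∧ b = e then d.diagCoeff x else 0) +
      (if a = e ∧ b = c then d.exchCoeff x e c else 0) := by
  rw [R_apply, if_neg (fun h => hce h.2 : ¬ (b = a.rev ∧ e = c.rev)), sub_zero]
  congr 1
  split_ifs with h
  · rw [h.1, h.2]
  · rfl

theorem sum_R_mul {a b : Fin N} (hab : b ≠ a.rev) (x : F) (G : Fin N → Fin N → F) :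
    ∑ k, ∑ l, d.R x (a, b) (k, l) * G k l =
      d.diagCoeff x * G a b + d.exchCoeff x a b * G b a := by
  simp only [d.R_row hab, ite_and, add_mul, ite_mul, zero_mul, Finset.sum_add_distrib,
    Finset.sum_ite_eq, Finset.sum_ite_irrel, Finset.sum_const_zero, Finset.mem_univ, if_true]

theorem sum_mul_R {c e : Fin N} (hce : e ≠ c.rev) (x : F) (G : Fin N → Fin N → F) :
    ∑ k, ∑ l, G k l * d.R x (k, l) (c, e) =
      G c e * d.diagCoeff x + G e c * d.exchCoeff x e c := by
  simp only [d.R_col hce, ite_and, mul_add, mul_ite, mul_zero, Finset.sum_add_distrib,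
    Finset.sum_ite_eq', Finset.sum_ite_irrel, Finset.sum_const_zero, Finset.mem_univ, if_true]

theorem diagCoeff_mul_exchCoeff_add {x : F} (hx : x ≠ 0) {a b : Fin N} (hab : a ≠ b) :
    d.diagCoeff x * d.exchCoeff x⁻¹ b a + d.exchCoeff x a b * d.diagCoeff x⁻¹ = 0 := by
  have hq := d.q_ne_zero
  simp only [diagCoeff, exchCoeff, hab, hab.symm, false_and, if_false]
  rcases lt_or_gt_of_ne hab with h | h <;> simp only [h, h.not_gt, if_true, if_false] <;>
    field_simp <;> ring

theorem exchCoeff_mul_exchCoeff_add {x : F} (hx : x ≠ 0) {a b : Fin N} (hab : a ≠ b) :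
    d.diagCoeff x * d.diagCoeff x⁻¹ + d.exchCoeff x a b * d.exchCoeff x⁻¹ a b =
      unitarityScalar d.q⁻¹ d.ξ x x⁻¹ := by
  have hq := d.q_ne_zero
  simp only [diagCoeff, exchCoeff, unitarityScalar, hab, false_and, if_false]
  rcases lt_or_gt_of_ne hab with h | h <;> simp only [h, h.not_gt, if_true, if_false] <;>
    field_simp <;> ring

theorem diagCoeff_add_exchCoeff_self (x : F) {a : Fin N} (ha : a ≠ a.rev) :
    d.diagCoeff x + d.exchCoeff x a a = (x - d.q⁻¹ ^ 2) * (x - d.ξ) := by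
  rw [diagCoeff, exchCoeff, if_pos ⟨rfl, ha⟩]
  ring

theorem sum_R_mirror_row_mul {x : F} (hx : x ≠ 0) (a c e : Fin N) :
    ∑ k, ∑ l, d.R x (a, a.rev) (k, l) * d.R x⁻¹ (l, k) (e, c) =
      if a = c ∧ a.rev = e then unitarityScalar d.q⁻¹ d.ξ x x⁻¹ else 0 := by
  have hrow (k : Fin N) : d.R x⁻¹ (k.rev, k) (e, c) =
      if e = c.rev then d.mirrorBlock x⁻¹ c k else 0 := by
    have h := d.R_mirror_row x⁻¹ k.rev e c
    rw [Fin.rev_rev] at h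
    rw [h]
    split_ifs with hc he he
    · rw [he, mirrorBlock_rev_rev]
    · exact absurd (by rw [hc, Fin.rev_rev]) he
    · exact absurd (by rw [he, Fin.rev_rev]) hc
    · rfl
  simp only [R_mirror_row, ite_mul, zero_mul, Finset.sum_ite_eq', Finset.mem_univ, hrow, mul_ite,
    mul_zero, Finset.sum_ite_irrel, Finset.sum_const_zero,
    d.sum_mirrorBlock_mul_mirrorBlock hx, ← ite_and]
  grind

theorem sum_R_row_mul {x : F} (hx : x ≠ 0) {a b : Fin N} (hab : b ≠ a.rev) (c e : Fin N) :
    ∑ k, ∑ l, d.R x (a, b) (k, l) * d.R x⁻¹ (l, k) (e, c) =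
      if a = c ∧ b = e then unitarityScalar d.q⁻¹ d.ξ x x⁻¹ else 0 := by
  have hba : a ≠ b.rev := fun h => hab (by rw [h, Fin.rev_rev])
  rw [d.sum_R_mul hab x fun k l => d.R x⁻¹ (l, k) (e, c), d.R_row hba, d.R_row hab]
  rcases eq_or_ne a b with rfl | hne
  · by_cases h : a = c ∧ a = e
    · obtain ⟨rfl, rfl⟩ := h
      simp only [and_self, if_true, ← add_mul, d.diagCoeff_add_exchCoeff_self _ hab,
        unitarityScalar]
      ring
    · have h' : ¬ (a = e ∧ a = c) := fun h' => h h'.symm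
      simp only [h, h', if_false]
      ring
  · have hfix := d.exchCoeff_mul_exchCoeff_add hx hne
    have hflip := d.diagCoeff_mul_exchCoeff_add hx hne
    grind

theorem R_mul_R_swap {x : F} (hx : x ≠ 0) :
    d.R x * (d.R x⁻¹).submatrix Prod.swap Prod.swap = unitarityScalar d.q⁻¹ d.ξ x x⁻¹ • 1 := by
  ext ⟨a, b⟩ ⟨c, e⟩
  simp only [Matrix.mul_apply, Fintype.sum_prod_type, Matrix.submatrix_apply, Prod.swap_prod_mk,
    Matrix.smul_apply, smul_eq_mul, Matrix.one_apply, Prod.mk.injEq, mul_ite, mul_one, mul_zero]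
  rcases eq_or_ne b a.rev with rfl | hab
  · exact d.sum_R_mirror_row_mul hx a c e
  · exact d.sum_R_row_mul hx hab c e

end RMatrixData

/-- The matrix entries of `A₁₂ B₁₃ C₂₃`, the left-hand side of the Yang–Baxter equation. -/
def ybLeft {S : Type*} [CommRing S] {N : ℕ} (A B C : End2 N S) (a b c d e f : Fin N) : S :=
  ∑ k, ∑ l, ∑ m, A (a, b) (k, l) * B (k, c) (d, m) * C (l, m) (e, f)

/-- The matrix entries of `C₂₃ B₁₃ A₁₂`, the right-hand side of the Yang–Baxter equation. -/
def ybRight {S : Type*} [CommRing S] {N : ℕ} (A B C : End2 N S) (a b c d e f : Fin N) : S :=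
  ∑ k, ∑ l, ∑ m, C (b, c) (l, m) * B (a, m) (k, f) * A (k, l) (d, e)

namespace RMatrixData

variable {F : Type*} [Field F] {N : ℕ} (d : RMatrixData F N)

theorem exchCoeff_of_lt (x : F) {a b : Fin N} (hab : a < b) :
    d.exchCoeff x a b = (x - d.ξ) * (1 - d.q⁻¹ ^ 2) * x := by
  simp only [exchCoeff, hab, hab.ne, false_and, if_true, if_false, mul_assoc]

theorem exchCoeff_of_gt (x : F) {a b : Fin N} (hba : b < a) :
    d.exchCoeff x a b = (x - d.ξ) * (1 - d.q⁻¹ ^ 2) := by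
  simp only [exchCoeff, hba.ne', hba.not_gt, false_and, if_false, mul_one]

theorem exchCoeff_self (x : F) {a : Fin N} (ha : a ≠ a.rev) :
    d.exchCoeff x a a = (x - d.ξ) * (1 - d.q⁻¹) * (x + d.q⁻¹) := by
  rw [exchCoeff, if_pos ⟨rfl, ha⟩, mul_assoc]

theorem R_col_eq_mul {c e : Fin N} (hce : e ≠ c.rev) (x : F) (a b : Fin N) :
    d.R x (a, b) (c, e) =
      (if a = c then 1 else 0) * (if b = e then 1 else 0) * d.diagCoeff x +
      (if a = e then 1 else 0) * (if b = c then 1 else 0) * d.exchCoeff x e c := by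
  simp only [d.R_col hce, ite_and, ite_mul, one_mul, zero_mul]

theorem sum_mul_R_left {c e : Fin N} (hce : e ≠ c.rev) (x : F) (b : Fin N) (G : Fin N → F) :
    ∑ k, G k * d.R x (k, b) (c, e) =
      (if b = e then 1 else 0) * G c * d.diagCoeff x +
      (if b = c then 1 else 0) * G e * d.exchCoeff x e c := by
  simp only [d.R_col hce, ite_and, mul_add, mul_ite, mul_zero, Finset.sum_add_distrib,
    Finset.sum_ite_eq', Finset.mem_univ, if_true, ite_mul, one_mul, zero_mul]

theorem sum_mul_R_right {c e : Fin N} (hce : e ≠ c.rev) (x : F) (a : Fin N) (G : Fin N → F) :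
    ∑ k, G k * d.R x (a, k) (c, e) =
      (if a = c then 1 else 0) * G e * d.diagCoeff x +
      (if a = e then 1 else 0) * G c * d.exchCoeff x e c := by
  simp only [d.R_col hce, ite_and, mul_add, mul_ite, mul_zero, Finset.sum_add_distrib,
    Finset.sum_ite_eq', Finset.sum_ite_irrel, Finset.sum_const_zero, Finset.mem_univ, if_true,
    ite_mul, one_mul, zero_mul]

theorem sum_mul_R_mirror_left (x : F) (b c : Fin N) (G : Fin N → F) :
    ∑ k, G k * d.R x (k, b) (c, c.rev) = G b.rev * d.mirrorBlock x b.rev c := by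
  have hrev (k : Fin N) : b = k.rev ↔ k = b.rev := by grind [Fin.rev_rev]
  simp only [R_mirror_col, hrev, mul_ite, mul_zero, Finset.sum_ite_eq', Finset.mem_univ, if_true]

theorem sum_mul_R_mirror_right (x : F) (a c : Fin N) (G : Fin N → F) :
    ∑ k, G k * d.R x (a, k) (c, c.rev) = G a.rev * d.mirrorBlock x a c := by
  simp only [R_mirror_col, mul_ite, mul_zero, Finset.sum_ite_eq', Finset.mem_univ, if_true]

theorem ybLeft_eq {s r : Fin N} (hsr : r ≠ s.rev) (x w y : F) (a b c p : Fin N) :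
    ybLeft (d.R x) (d.R w) (d.R y) a b c p s r =
      (∑ k, d.R x (a, b) (k, s) * d.R w (k, c) (p, r)) * d.diagCoeff y +
      (∑ k, d.R x (a, b) (k, r) * d.R w (k, c) (p, s)) * d.exchCoeff y r s := by
  simp only [ybLeft, Finset.sum_mul, ← Finset.sum_add_distrib]
  exact Finset.sum_congr rfl fun k _ =>
    d.sum_mul_R hsr y fun l m => d.R x (a, b) (k, l) * d.R w (k, c) (p, m)

theorem ybRight_eq {p s : Fin N} (hps : s ≠ p.rev) (x w y : F) (a b c r : Fin N) :
    ybRight (d.R x) (d.R w) (d.R y) a b c p s r =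
      (∑ m, d.R y (b, c) (s, m) * d.R w (a, m) (p, r)) * d.diagCoeff x +
      (∑ m, d.R y (b, c) (p, m) * d.R w (a, m) (s, r)) * d.exchCoeff x s p := by
  simp only [ybRight, Finset.sum_mul, ← Finset.sum_add_distrib]
  rw [Finset.sum_congr rfl fun k _ => Finset.sum_comm, Finset.sum_comm]
  exact Finset.sum_congr rfl fun m _ =>
    d.sum_mul_R hps x fun k l => d.R y (b, c) (l, m) * d.R w (a, m) (k, r)

theorem ybLeft_eq_ybRight_of_no_pair (x y : F) {p s r : Fin N} (hps : s ≠ p.rev) (hpr : r ≠ p.rev)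
    (hsr : r ≠ s.rev) (a b c : Fin N) :
    ybLeft (d.R x) (d.R (x * y)) (d.R y) a b c p s r =
      ybRight (d.R x) (d.R (x * y)) (d.R y) a b c p s r := by
  have hsp : p ≠ s.rev := fun h => hps (by rw [h, Fin.rev_rev])
  have hrs : s ≠ r.rev := fun h => hsr (by rw [h, Fin.rev_rev])
  rw [d.ybLeft_eq hsr, d.ybRight_eq hps, d.sum_mul_R_left hpr, d.sum_mul_R_left hps,
    d.sum_mul_R_right hpr, d.sum_mul_R_right hsr]
  simp only [d.R_col_eq_mul hps, d.R_col_eq_mul hpr, d.R_col_eq_mul hsr, d.R_col_eq_mul hsp,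
    d.R_col_eq_mul hrs]
  have tri_ps := lt_trichotomy p s
  have tri_sr := lt_trichotomy s r
  have tri_pr := lt_trichotomy p r
  rcases tri_ps with ps | rfl | ps <;> rcases tri_sr with sr | rfl | sr <;>
    rcases tri_pr with pr | pr | pr <;> (try subst pr) <;> first
    | order
    | (simp only [exchCoeff_of_lt, exchCoeff_of_gt, exchCoeff_self, diagCoeff, ne_eq,
        not_false_eq_true, *]
       generalize x - d.ξ = X, x * y - d.ξ = Z, y - d.ξ = Y
       ring)

theorem annihCoeff_of_gt (x : F) {b c : Fin N} (hcb : c < b) :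
    d.annihCoeff x b c = (x - 1) * (1 - d.q⁻¹ ^ 2) * (d.β b / d.β c) * x := by
  simp only [annihCoeff, hcb, hcb.ne', false_and, if_true, if_false, mul_assoc]

theorem annihCoeff_of_lt (x : F) {b c : Fin N} (hbc : b < c) :
    d.annihCoeff x b c = (x - 1) * (1 - d.q⁻¹ ^ 2) * (d.β b / d.β c) * d.ξ := by
  simp only [annihCoeff, hbc.ne, hbc.not_gt, false_and, if_false, mul_assoc]

theorem mirrorBlock_of_ne (x : F) {a c : Fin N} (hac : a ≠ c) (hac' : c ≠ a.rev) :
    d.mirrorBlock x a c = -d.annihCoeff x c a := by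
  rw [mirrorBlock, R_apply, annihCoeff_rev_rev, if_neg (fun h => hac h.1),
    if_neg (fun h => hac' h.2.symm), if_pos ⟨rfl, rfl⟩]
  ring

theorem mirrorBlock_rev_left (x : F) {a : Fin N} (ha : a ≠ a.rev) :
    d.mirrorBlock x a.rev a = d.exchCoeff x a.rev a - d.annihCoeff x a a.rev := by
  rw [mirrorBlock, R_apply, Fin.rev_rev, if_neg (fun h => ha h.2), if_pos ⟨rfl, rfl⟩,
    if_pos ⟨rfl, rfl⟩, zero_add]

theorem mirrorBlock_middle (x : F) {a : Fin N} (ha : a = a.rev) :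
    d.mirrorBlock x a a = d.diagCoeff x + (x - d.ξ) * (1 - d.q⁻¹ ^ 2)
      - (x - 1) * (1 - d.q⁻¹ ^ 2) * d.ξ := by
  simp only [mirrorBlock, R_apply, exchCoeff, annihCoeff, ← ha, (d.middle a ha).1, lt_irrefl,
    ne_eq, not_true_eq_false, and_false, and_self, if_true, if_false]
  ring

theorem ybLeft_eq_ybRight_flip_fix_flip (x y : F) {a b : Fin N} (hba : b ≠ a) (hba' : b ≠ a.rev) :
    ybLeft (d.R x) (d.R (x * y)) (d.R y) a.rev b a a b a.rev =
      ybRight (d.R x) (d.R (x * y)) (d.R y) a.rev b a a b a.rev := by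
  have hrev : a.rev ≠ b.rev := fun h => hba (Fin.rev_injective h.symm)
  have hab' : a ≠ b.rev := fun h => hba' (by rw [h, Fin.rev_rev])
  have hexch : d.exchCoeff x a.rev b * d.exchCoeff (x * y) b a * d.exchCoeff y a.rev b =
      d.exchCoeff y b a * d.exchCoeff (x * y) a.rev b * d.exchCoeff x b a := by
    rcases lt_or_gt_of_ne hba with h | h <;> rcases lt_or_gt_of_ne hba' with h' | h' <;>
      simp only [d.exchCoeff_of_lt _ h, d.exchCoeff_of_gt _ h, d.exchCoeff_of_lt _ h',
        d.exchCoeff_of_gt _ h'] <;> ring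
  rw [d.ybLeft_eq hrev, d.ybRight_eq hba', sum_mul_R_mirror_left, sum_mul_R_mirror_right,
    d.sum_mul_R_left hba', d.sum_mul_R_right hrev]
  simp only [d.R_row (by rwa [Fin.rev_rev] : b ≠ a.rev.rev), d.R_row hab', Fin.rev_rev, hba,
    hba.symm, hba', hba'.symm, if_true, if_false, and_self, false_and, and_false]
  linear_combination hexch

theorem mirrorBlock_mul_mirrorBlock_add (x y : F) {a b : Fin N} (hba : b ≠ a) (hba' : b ≠ a.rev) :
    d.mirrorBlock x b a * d.mirrorBlock (x * y) b.rev a * d.diagCoeff y +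
      d.mirrorBlock x a.rev a * d.diagCoeff (x * y) * d.exchCoeff y a.rev b =
    d.exchCoeff y a b * d.mirrorBlock (x * y) a.rev a * d.diagCoeff x +
      d.diagCoeff y * d.exchCoeff (x * y) a.rev b * d.exchCoeff x b a := by
  have hq := d.q_ne_zero
  have hb := d.β_ne_zero b
  have hwb : d.mirrorBlock (x * y) b.rev a = -d.annihCoeff (x * y) b a.rev := by
    rw [← d.mirrorBlock_of_ne _ hba'.symm (by rwa [Fin.rev_rev]), ← mirrorBlock_rev_rev,
      Fin.rev_rev]
  rw [hwb, d.mirrorBlock_of_ne x hba (fun h => hba' (by rw [h, Fin.rev_rev]))]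
  by_cases hmid : a = a.rev
  · have hβ := (d.middle a hmid).1
    rw [← hmid, d.mirrorBlock_middle _ hmid, d.mirrorBlock_middle _ hmid]
    rcases lt_or_gt_of_ne hba with h | h <;>
      simp only [d.exchCoeff_of_lt _ h, d.exchCoeff_of_gt _ h, d.annihCoeff_of_lt _ h,
        d.annihCoeff_of_gt _ h, hβ, diagCoeff] <;> field_simp <;> ring
  · rw [d.mirrorBlock_rev_left _ hmid, d.mirrorBlock_rev_left _ hmid]
    rcases lt_or_gt_of_ne hmid with h | h <;> rcases lt_or_gt_of_ne hba with h' | h' <;>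
      rcases lt_or_gt_of_ne hba' with h'' | h'' <;> first
    | order
    | (simp only [exchCoeff_of_lt, exchCoeff_of_gt, annihCoeff_of_lt, annihCoeff_of_gt, d.β_rev,
          diagCoeff, *]
       rcases d.ε_eq with ⟨hε, -⟩ | ⟨hε, -⟩ <;> rw [hε] <;> field_simp <;> ring)

theorem ybLeft_eq_ybRight_flip_rotate (x y : F) {a b : Fin N} (hba : b ≠ a) (hba' : b ≠ a.rev) :
    ybLeft (d.R x) (d.R (x * y)) (d.R y) a.rev a b a b a.rev =
      ybRight (d.R x) (d.R (x * y)) (d.R y) a.rev a b a b a.rev := by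
  have hrev : a.rev ≠ b.rev := fun h => hba (Fin.rev_injective h.symm)
  have hflip : d.R x (a.rev, a) (b.rev, b) = d.mirrorBlock x b a := by
    rw [← mirrorBlock_rev_rev, mirrorBlock, Fin.rev_rev, Fin.rev_rev]
  rw [d.ybLeft_eq hrev, d.ybRight_eq hba', sum_mul_R_mirror_left, sum_mul_R_mirror_right,
    d.sum_mul_R_left hba', d.sum_mul_R_right hrev, Fin.rev_rev]
  have hdiag : d.R x (a.rev, a) (a, a.rev) = d.mirrorBlock x a.rev a := by
    rw [mirrorBlock, Fin.rev_rev]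
  simp only [hflip, hdiag, d.R_row hba', hba, hba.symm, hba'.symm, if_true, if_false, and_self,
    and_false]
  linear_combination d.mirrorBlock_mul_mirrorBlock_add x y hba hba'

theorem ybRight_eq_ybLeft_rev (x w y : F) (a b c p s r : Fin N) :
    ybRight (d.R x) (d.R w) (d.R y) a b c p s r =
      ybLeft (d.R x) (d.R w) (d.R y) p.rev s.rev r.rev a.rev b.rev c.rev := by
  have hR (z : F) (i j k l : Fin N) :
      d.R z (i, j) (k.rev, l.rev) = d.R z (k, l) (i.rev, j.rev) := by
    rw [← R_rev, Fin.rev_rev, Fin.rev_rev]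
  simp only [ybRight, ybLeft]
  refine Fintype.sum_equiv Fin.revPerm _ _ fun k => Fintype.sum_equiv Fin.revPerm _ _ fun l =>
    Fintype.sum_equiv Fin.revPerm _ _ fun m => ?_
  simp only [Fin.revPerm_apply, hR, Fin.rev_rev]
  ring

end RMatrixData

theorem sum_eq_sub_add_sub_add_sum {ι M : Type*} [Fintype ι] [AddCommGroup M] {b c : ι}
    (hbc : b ≠ c) {f g : ι → M} (hfg : ∀ k, k ≠ b → k ≠ c → f k = g k) :
    ∑ k, f k = (f b - g b) + (f c - g c) + ∑ k, g k := by
  rw [← Fintype.sum_eq_add (f := fun k => f k - g k) b c hbc fun k hk =>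
    sub_eq_zero.2 (hfg k hk.1 hk.2), Finset.sum_sub_distrib, sub_add_cancel]

namespace RMatrixData

variable {F : Type*} [Field F] {N : ℕ} (d : RMatrixData F N)

theorem sum_β_sq_mul_step (b c : Fin N) (s t u v : F) :
    ∑ k, d.β k ^ 2 * ((if b < k then s else t) * if c < k then u else v) =
      t * v * ∑ k, d.β k ^ 2 + (s - t) * v * ∑ k ∈ Finset.Ioi b, d.β k ^ 2
      + t * (u - v) * ∑ k ∈ Finset.Ioi c, d.β k ^ 2
      + (s - t) * (u - v) * ∑ k ∈ Finset.Ioi (max b c), d.β k ^ 2 := by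
  have hIoi (i : Fin N) : ∑ k ∈ Finset.Ioi i, d.β k ^ 2 = ∑ k, if i < k then d.β k ^ 2 else 0 := by
    rw [← Finset.sum_filter, Finset.filter_lt_eq_Ioi]
  simp only [hIoi, Finset.mul_sum, ← Finset.sum_add_distrib, max_lt_iff, ite_and]
  refine Finset.sum_congr rfl fun k _ => ?_
  split_ifs <;> ring

theorem ybRight_mirror (x w y : F) (b : Fin N) :
    ybRight (d.R x) (d.R w) (d.R y) b b b.rev b.rev b b =
      ∑ k, d.mirrorBlock y b k * d.mirrorBlock x b k * d.R w (b, k.rev) (k.rev, b) := by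
  have hcol (k l : Fin N) :
      d.R x (k, l) (b.rev, b) = if l = k.rev then d.mirrorBlock x b k.rev else 0 := by
    have h := d.R_mirror_col x k l b.rev
    rwa [Fin.rev_rev, ← mirrorBlock_rev_rev, Fin.rev_rev] at h
  rw [ybRight, ← Equiv.sum_comp Fin.revPerm]
  refine Finset.sum_congr rfl fun k _ => ?_
  simp only [Fin.revPerm_apply, R_mirror_row, hcol, Fin.rev_rev, mul_ite, mul_zero, ite_mul,
    zero_mul, Finset.sum_ite_irrel, Finset.sum_const_zero, Finset.sum_ite_eq', Finset.mem_univ,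
    if_true]
  ring

theorem mirrorBlock_self (x : F) {a : Fin N} (ha : a ≠ a.rev) :
    d.mirrorBlock x a a = d.diagCoeff x - (x - 1) * (1 - d.q⁻¹) * (d.ξ + d.q⁻¹ * x) := by
  rw [mirrorBlock, R_apply, annihCoeff_rev_rev, annihCoeff, if_pos ⟨rfl, rfl⟩,
    if_neg (fun h => ha h.1), if_pos ⟨rfl, rfl⟩, if_pos ⟨rfl, ha⟩]
  ring

theorem mirrorBlock_rev_right (x : F) {a : Fin N} (ha : a ≠ a.rev) :
    d.mirrorBlock x a a.rev = d.exchCoeff x a a.rev - d.annihCoeff x a.rev a := by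
  have h := d.mirrorBlock_rev_left x (by rwa [Fin.rev_rev, ne_comm] : a.rev ≠ a.rev.rev)
  rwa [Fin.rev_rev] at h

theorem mirrorBlock_mul_mirrorBlock_mul_R (x y : F) {b k : Fin N} (hkb : k ≠ b)
    (hkb' : k ≠ b.rev) :
    d.mirrorBlock y b k * d.mirrorBlock x b k * d.R (x * y) (b, k.rev) (k.rev, b) =
      (1 - d.q⁻¹ ^ 2) ^ 3 * (x - 1) * (y - 1) * (x * y - d.ξ) / d.β b ^ 2 *
        (d.β k ^ 2 * ((if b < k then x * y else d.ξ ^ 2) * if b.rev < k then 1 else x * y)) := by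
  have hb := d.β_ne_zero b
  have hlt : b < k.rev ↔ ¬ b.rev < k := by
    rw [← Fin.rev_lt_rev, Fin.rev_rev, not_lt, le_iff_lt_or_eq, or_iff_left hkb']
  have hne : b ≠ k.rev := fun h => hkb' (by rw [h, Fin.rev_rev])
  rw [d.R_row (fun h => hkb (Fin.rev_injective h)), d.mirrorBlock_of_ne _ hkb.symm hkb',
    d.mirrorBlock_of_ne _ hkb.symm hkb', if_neg (fun h => hne h.1), if_pos ⟨rfl, rfl⟩]
  simp only [annihCoeff, exchCoeff, hkb, hne, hlt, false_and, if_false]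
  split_ifs <;> field_simp <;> ring

theorem sum_mirrorBlock_mul_mirrorBlock_mul_R (x y : F) {b : Fin N} (hb : b ≠ b.rev) :
    ∑ k, d.mirrorBlock y b k * d.mirrorBlock x b k * d.R (x * y) (b, k.rev) (k.rev, b) =
      (x - d.q⁻¹ ^ 2) * (x - d.ξ) * (y - d.q⁻¹ ^ 2) * (y - d.ξ) *
        d.mirrorBlock (x * y) b b.rev := by
  have hq := d.q_ne_zero
  have hβ := d.β_ne_zero b
  have hsum := d.sum_β_sq_mul_step b b.rev (x * y) (d.ξ ^ 2) 1 (x * y)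
  replace hsum := congrArg ((d.q - d.q⁻¹) * ·) hsum
  simp only [mul_add, mul_left_comm (d.q - d.q⁻¹), d.sum_β_sq b.pos, d.sum_Ioi_β_sq] at hsum
  have hscale (T : F) :
      (1 - d.q⁻¹ ^ 2) ^ 3 * (x - 1) * (y - 1) * (x * y - d.ξ) / d.β b ^ 2 * T =
      d.q⁻¹ * (1 - d.q⁻¹ ^ 2) ^ 2 * (x - 1) * (y - 1) * (x * y - d.ξ) / d.β b ^ 2 *
        ((d.q - d.q⁻¹) * T) := by
    field_simp
  rw [sum_eq_sub_add_sub_add_sum hb fun k => d.mirrorBlock_mul_mirrorBlock_mul_R x y,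
    ← Finset.mul_sum, hscale (∑ _, _), hsum]
  clear hsum hscale
  have hcorner : d.R (x * y) (b, b) (b, b) = (x * y - d.q⁻¹ ^ 2) * (x * y - d.ξ) := by
    rw [d.R_row hb, if_pos ⟨rfl, rfl⟩, if_pos ⟨rfl, rfl⟩, d.diagCoeff_add_exchCoeff_self _ hb]
  have hmirror : d.R (x * y) (b, b.rev) (b.rev, b) = d.mirrorBlock (x * y) b b.rev := by
    rw [mirrorBlock, Fin.rev_rev]
  rw [Fin.rev_rev, hcorner, hmirror]
  simp only [d.mirrorBlock_self _ hb, d.mirrorBlock_rev_right _ hb]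
  rcases lt_or_gt_of_ne hb with h | h
  · simp only [max_eq_right h.le, d.exchCoeff_of_lt _ h, d.annihCoeff_of_gt _ h, h, h.ne, h.ne',
      h.not_gt, lt_irrefl, Fin.rev_rev, d.β_rev, diagCoeff, if_true, if_false]
    rcases d.ε_eq with ⟨hε, hη⟩ | ⟨hε, hη⟩ <;> rw [hε, hη] <;> field_simp <;> ring
  · simp only [max_eq_left h.le, d.exchCoeff_of_gt _ h, d.annihCoeff_of_lt _ h, h, h.ne, h.ne',
      h.not_gt, lt_irrefl, d.β_rev, diagCoeff, if_true, if_false]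
    rcases d.ε_eq with ⟨hε, hη⟩ | ⟨hε, hη⟩ <;> rw [hε, hη] <;> field_simp <;> ring

theorem ybLeft_eq_ybRight_flip_fix_flip_self (x y : F) {b : Fin N} (hb : b ≠ b.rev) :
    ybLeft (d.R x) (d.R (x * y)) (d.R y) b b b.rev b.rev b b =
      ybRight (d.R x) (d.R (x * y)) (d.R y) b b b.rev b.rev b b := by
  have hmirror := d.sum_mul_R_mirror_left (x * y) b.rev b.rev fun k => d.R x (b, b) (k, b)
  rw [Fin.rev_rev] at hmirror
  rw [ybRight_mirror, d.sum_mirrorBlock_mul_mirrorBlock_mul_R x y hb, d.ybLeft_eq hb, hmirror,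
    d.R_row hb, if_pos ⟨rfl, rfl⟩, if_pos ⟨rfl, rfl⟩]
  linear_combination (d.diagCoeff y + d.exchCoeff y b b) * d.mirrorBlock (x * y) b b.rev *
      d.diagCoeff_add_exchCoeff_self x hb +
    (x - d.q⁻¹ ^ 2) * (x - d.ξ) * d.mirrorBlock (x * y) b b.rev *
      d.diagCoeff_add_exchCoeff_self y hb

end RMatrixData

section Entries

variable {S : Type*} [CommRing S] {N : ℕ}

theorem unit2_apply (i j k l a b c e : Fin N) :
    unit2 S i j k l (a, b) (c, e) = if (i = a ∧ j = c) ∧ k = b ∧ l = e then 1 else 0 := by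
  simp only [unit2, Matrix.kroneckerMap_apply, Matrix.single_apply]
  grind

theorem sum_smul_unit2_diag_apply (g : Fin N → Fin N → S) (a b c e : Fin N) :
    (∑ i, ∑ j, g i j • unit2 S i i j j) (a, b) (c, e) = if a = c ∧ b = e then g a b else 0 := by
  simp only [Matrix.sum_apply, Matrix.smul_apply, unit2_apply, smul_eq_mul]
  rw [Finset.sum_eq_single a, Finset.sum_eq_single b] <;> simp +contextual

theorem sum_smul_unit2_exch_apply (g : Fin N → Fin N → S) (a b c e : Fin N) :
    (∑ i, ∑ j, g i j • unit2 S i j j i) (a, b) (c, e) = if a = e ∧ b = c then g a b else 0 := by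
  simp only [Matrix.sum_apply, Matrix.smul_apply, unit2_apply, smul_eq_mul]
  rw [Finset.sum_eq_single a, Finset.sum_eq_single b] <;> simp +contextual [and_comm]

theorem sum_smul_unit2_annih_apply (g : Fin N → Fin N → S) (a b c e : Fin N) :
    (∑ i, ∑ j, g i j • unit2 S i.rev j.rev i j) (a, b) (c, e) =
      if b = a.rev ∧ e = c.rev then g b e else 0 := by
  have h : (b.rev = a ∧ e.rev = c) ↔ (b = a.rev ∧ e = c.rev) := by grind [Fin.rev_rev]
  simp only [Matrix.sum_apply, Matrix.smul_apply, unit2_apply, smul_eq_mul]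
  rw [Finset.sum_eq_single b, Finset.sum_eq_single e] <;> simp +contextual [h]

theorem sum_smul_unit2_equal_apply (g : Fin N → S) (a b c e : Fin N) :
    (∑ i, g i • unit2 S i i i i) (a, b) (c, e) =
      if a = c ∧ b = e then (if a = b then g a else 0) else 0 := by
  simp only [Matrix.sum_apply, Matrix.smul_apply, unit2_apply, smul_eq_mul]
  rw [Finset.sum_eq_single a] <;> grind

theorem sum_smul_unit2_mirror_apply (g : Fin N → S) (a b c e : Fin N) :
    (∑ i, g i • unit2 S i i i.rev i.rev) (a, b) (c, e) =
      if a = c ∧ b = e then (if b = a.rev then g a else 0) else 0 := by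
  simp only [Matrix.sum_apply, Matrix.smul_apply, unit2_apply, smul_eq_mul]
  rw [Finset.sum_eq_single a] <;> grind

variable (X : LieType) (n : ℕ)

theorem opP_apply (a b c e : Fin (dim X n)) :
    opP X n S (a, b) (c, e) = if a = e ∧ b = c then 1 else 0 := by
  simpa only [opP, one_smul] using sum_smul_unit2_exch_apply (fun _ _ => (1 : S)) a b c e

theorem opQ_apply (t : Sˣ) (a b c e : Fin (dim X n)) :
    opQ X n t (a, b) (c, e) = if b = a.rev ∧ e = c.rev then wt X n t b e else 0 :=
  sum_smul_unit2_annih_apply _ a b c e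

theorem opR_apply (t : Sˣ) (a b c e : Fin (dim X n)) :
    opR X n t (a, b) (c, e) =
      (if a = c ∧ b = e then
        (if a = b then (if a = a.rev then 1 else ((qOf t : Sˣ) : S)) else
          if b = a.rev then ((qOf t)⁻¹ : Sˣ) else 1) else 0)
      + (if a = e ∧ b = c then
          (if a < b then ((qOf t : Sˣ) : S) - ((qOf t)⁻¹ : Sˣ) else 0) else 0)
      - (if b = a.rev ∧ e = c.rev then
          (if e < b then (((qOf t : Sˣ) : S) - ((qOf t)⁻¹ : Sˣ)) * wt X n t b e else 0)
        else 0) := by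
  have ite_smul_zero (p : Prop) [Decidable p] (r : S) (M : End2 (dim X n) S) :
      (if p then r • M else 0) = (if p then r else 0) • M := by split_ifs <;> simp
  have ite_zero (p : Prop) [Decidable p] (M : End2 (dim X n) S) :
      (if p then M else 0) = (if p then (1 : S) else 0) • M := by split_ifs <;> simp
  simp only [opR, ite_smul_zero, ite_zero, Matrix.add_apply, Matrix.sub_apply,
    sum_smul_unit2_diag_apply, sum_smul_unit2_exch_apply, sum_smul_unit2_annih_apply,
    sum_smul_unit2_equal_apply, sum_smul_unit2_mirror_apply]
  have ha : a.rev.rev = a := Fin.rev_rev a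
  grind

theorem Rplus_apply (x : S) (t : Sˣ) (a b c e : Fin (dim X n)) :
    Rplus X n x t (a, b) (c, e) =
      (((qOf t)⁻¹ : Sˣ) : S) * (x - 1) * (x - (xi X n t : Sˣ)) * opR X n t (a, b) (c, e)
      - ((((qOf t)⁻¹ : Sˣ) : S) ^ 2 - 1) * (x - (xi X n t : Sˣ)) * opP X n S (a, b) (c, e)
      + (xi X n t : Sˣ) * ((((qOf t)⁻¹ : Sˣ) : S) ^ 2 - 1) * (x - 1) * opQ X n t (a, b) (c, e) :=
  rfl

/-- The matrix entry `((a, b), (c, e))` belongs to one of the three patterns `e_{aa} ⊗ e_{bb}`,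
`e_{ab} ⊗ e_{ba}` and `e_{b'e'} ⊗ e_{be}` that occur in `R⁺`. -/
def IsPaired {N : ℕ} (a b c e : Fin N) : Prop :=
  a = c ∧ b = e ∨ a = e ∧ b = c ∨ b = a.rev ∧ e = c.rev

theorem Rplus_apply_eq_zero (x : S) (t : Sˣ) {a b c e : Fin (dim X n)}
    (h : ¬ IsPaired a b c e) : Rplus X n x t (a, b) (c, e) = 0 := by
  simp only [IsPaired, not_or] at h
  simp [Rplus_apply, opR_apply, opP_apply, opQ_apply, h]

end Entries

section Parameters

/-- The sign `ε_i ε_{i'}`, which does not depend on `i`. -/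
def revSign : LieType → ℤ
  | .B => 1
  | .C => -1
  | .D => 1

variable (X : LieType) (n : ℕ)

theorem eps_rev (i : Fin (dim X n)) : eps X n i.rev = revSign X * eps X n i := by
  have := i.isLt
  cases X <;> simp only [dim] at this <;> simp only [eps, revSign, one_mul]
  simp only [Fin.val_rev]
  simp only [dim]
  split_ifs <;> omega

theorem eps_mul_self (i : Fin (dim X n)) : eps X n i * eps X n i = 1 := by
  cases X <;> simp only [eps, one_mul]
  split_ifs <;> rfl

theorem twoBar_rev (i : Fin (dim X n)) : twoBar X n i.rev = -twoBar X n i := by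
  have := i.isLt
  cases X <;> simp only [twoBar, Fin.val_rev] <;> simp only [dim] at this ⊢ <;>
    split_ifs <;> omega

theorem middle_index {i : Fin (dim X n)} (h : i = i.rev) :
    revSign X = 1 ∧ eps X n i = 1 ∧ twoBar X n i = 0 := by
  have hi := i.isLt
  have ht := twoBar_rev X n i
  rw [← h] at ht
  rw [Fin.ext_iff, Fin.val_rev] at h
  refine ⟨?_, ?_, by omega⟩ <;> cases X <;> simp only [dim] at h hi <;> first | rfl | omega

variable {F : Type*} [Field F]

/-- The part of the closed form of `(q - q⁻¹) ∑_{k > i} q^{2 k̄}` that accounts for the irregular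
step of the tuple `(1̄, …, N̄)` at its middle. -/
def middleJump (q : F) (i : Fin (dim X n)) : F :=
  (if i < i.rev then revSign X * (q - q⁻¹) else 0) + if i = i.rev then 1 - q⁻¹ else 0

theorem zpow_twoBar_add_middleJump (q : F) {i j : Fin (dim X n)}
    (hij : i.val + 1 = j) :
    q ^ (twoBar X n i - 1) + middleJump X n q i =
      q ^ (twoBar X n j + 1) + middleJump X n q j := by
  have hj := j.isLt
  have h0 := zpow_zero q
  have h1 := zpow_one q
  have h_neg := zpow_neg_one q
  simp only [middleJump, Fin.lt_def, Fin.ext_iff, Fin.val_rev, ← hij]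
  cases X <;> simp only [twoBar, revSign, ← hij] <;> rw [← hij] at hj <;>
    generalize i.val = k at hj ⊢ <;> simp only [dim] at hj ⊢
  · obtain h | rfl | rfl | h : k + 1 < n ∨ n = k + 1 ∨ n = k ∨ n < k := by omega
    · have : 2 * (n : ℤ) - 1 - 2 * k - 1 = 2 * n - 1 - 2 * (k + 1 : ℕ) + 1 := by omega
      grind
    · have : 2 * ((k + 1 : ℕ) : ℤ) - 1 - 2 * k - 1 = 0 := by omega
      grind
    · have : 2 * (n : ℤ) + 1 - 2 * (n + 1 : ℕ) + 1 = 0 := by omega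
      grind
    · have : 2 * (n : ℤ) + 1 - 2 * k - 1 = 2 * n + 1 - 2 * (k + 1 : ℕ) + 1 := by omega
      grind
  · obtain h | rfl | h : k + 1 < n ∨ n = k + 1 ∨ n ≤ k := by omega
    · have : 2 * (n : ℤ) - 2 * k - 1 = 2 * n - 2 * (k + 1 : ℕ) + 1 := by omega
      grind
    · have : 2 * ((k + 1 : ℕ) : ℤ) - 2 * k - 1 = 1 := by omega
      have : 2 * ((k + 1 : ℕ) : ℤ) - 2 - 2 * (k + 1 : ℕ) + 1 = -1 := by omega
      grind
    · have : 2 * (n : ℤ) - 2 - 2 * k - 1 = 2 * n - 2 - 2 * (k + 1 : ℕ) + 1 := by omega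
      grind
  · obtain h | rfl | h : k + 1 < n ∨ n = k + 1 ∨ n ≤ k := by omega
    · have : 2 * (n : ℤ) - 2 - 2 * k - 1 = 2 * n - 2 - 2 * (k + 1 : ℕ) + 1 := by omega
      grind
    · have : 2 * ((k + 1 : ℕ) : ℤ) - 2 - 2 * k - 1 = -1 := by omega
      have : 2 * ((k + 1 : ℕ) : ℤ) - 2 * (k + 1 : ℕ) + 1 = 1 := by omega
      grind
    · have : 2 * (n : ℤ) - 2 * k - 1 = 2 * n - 2 * (k + 1 : ℕ) + 1 := by omega
      grind

theorem zpow_twoBar_add_middleJump_last (q : F) {i : Fin (dim X n)} (hi : i.val + 1 = dim X n) :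
    q ^ (twoBar X n i - 1) + middleJump X n q i = q ^ (xiExp X n - revSign X) := by
  have h0 := zpow_zero q
  have h_neg := zpow_neg_one q
  simp only [middleJump, Fin.lt_def, Fin.ext_iff, Fin.val_rev]
  cases X <;> simp only [twoBar, xiExp, revSign] <;> generalize i.val = k at hi ⊢ <;>
    simp only [dim] at hi ⊢
  · obtain ⟨rfl, rfl⟩ | h : n = 0 ∧ k = 0 ∨ 0 < n := by omega
    · have : 2 - ((2 * 0 + 1 : ℕ) : ℤ) - 1 = 0 := by omega
      grind
    · have : 2 * (n : ℤ) + 1 - 2 * k - 1 = 2 - (2 * n + 1 : ℕ) - 1 := by omega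
      grind
  · have : 2 * (n : ℤ) - 2 - 2 * k - 1 = -2 - (2 * n : ℕ) - -1 := by omega
    grind
  · have : 2 * (n : ℤ) - 2 * k - 1 = 2 - (2 * n : ℕ) - 1 := by omega
    grind

theorem zpow_twoBar_add_middleJump_first (q : F) {i : Fin (dim X n)} (hi : i.val = 0) :
    q ^ (twoBar X n i + 1) + middleJump X n q i =
      q ^ (-(xiExp X n - revSign X)) + revSign X * (q - q⁻¹) := by
  have hN := i.isLt
  have h0 := zpow_zero q
  have h1 := zpow_one q
  simp only [middleJump, Fin.lt_def, Fin.ext_iff, Fin.val_rev, hi]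
  rw [hi] at hN
  cases X <;> simp only [twoBar, xiExp, revSign, hi] <;> simp only [dim] at hN ⊢
  · obtain rfl | h := Nat.eq_zero_or_pos n
    · norm_num
      ring
    · have : 2 * (n : ℤ) - 1 - 2 * (0 : ℕ) + 1 = -(2 - (2 * n + 1 : ℕ) - 1) := by omega
      grind
  · have : 2 * (n : ℤ) - 2 * (0 : ℕ) + 1 = -(-2 - (2 * n : ℕ) - -1) := by omega
    grind
  · have : 2 * (n : ℤ) - 2 - 2 * (0 : ℕ) + 1 = -(2 - (2 * n : ℕ) - 1) := by omega
    grind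

theorem mul_sum_Ioi_zpow_twoBar {q : F} (hq : q ≠ 0) (i : Fin (dim X n)) :
    (q - q⁻¹) * ∑ k ∈ Finset.Ioi i, q ^ twoBar X n k =
      q ^ (twoBar X n i - 1) - q ^ (xiExp X n - revSign X) + middleJump X n q i := by
  induction hm : dim X n - (i.val + 1) generalizing i with
  | zero =>
    have hi : i.val + 1 = dim X n := by omega
    have hIoi : Finset.Ioi i = ∅ := by
      ext k
      simp only [Finset.mem_Ioi, Fin.lt_def, Finset.notMem_empty, iff_false]
      omega
    rw [hIoi, Finset.sum_empty, ← zpow_twoBar_add_middleJump_last X n q hi]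
    ring
  | succ m ih =>
    have hi : i.val + 1 < dim X n := by omega
    have hIoi : Finset.Ioi i = Finset.Ici ⟨i.val + 1, hi⟩ := by
      ext k
      simp only [Finset.mem_Ioi, Finset.mem_Ici, Fin.lt_def, Fin.le_def, Nat.succ_le_iff]
    have hstep := zpow_twoBar_add_middleJump X n q (i := i) (j := ⟨i.val + 1, hi⟩) rfl
    rw [hIoi, ← Finset.add_sum_Ioi_eq_sum_Ici, mul_add, ih _ (by simp only; omega)]
    rw [zpow_add_one₀ hq] at hstep
    rw [zpow_sub_one₀ hq (twoBar X n ⟨i.val + 1, hi⟩)]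
    linear_combination -hstep

theorem mul_sum_zpow_twoBar {q : F} (hq : q ≠ 0) (hN : 0 < dim X n) :
    (q - q⁻¹) * ∑ k, q ^ twoBar X n k =
      q ^ (-(xiExp X n - revSign X)) - q ^ (xiExp X n - revSign X) + revSign X * (q - q⁻¹) := by
  have hIci : (Finset.univ : Finset (Fin (dim X n))) = Finset.Ici ⟨0, hN⟩ := by
    ext k
    simp [Fin.le_def]
  have hfirst := zpow_twoBar_add_middleJump_first X n q (i := ⟨0, hN⟩) rfl
  rw [hIci, ← Finset.add_sum_Ioi_eq_sum_Ici, mul_add, mul_sum_Ioi_zpow_twoBar X n hq]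
  rw [zpow_add_one₀ hq] at hfirst
  rw [zpow_sub_one₀ hq (twoBar X n ⟨0, hN⟩)]
  linear_combination hfirst

theorem cast_eps_mul_self (S : Type*) [CommRing S] (i : Fin (dim X n)) :
    (eps X n i : S) * eps X n i = 1 := by
  rw [← Int.cast_mul, eps_mul_self, Int.cast_one]

theorem β_sq (t : Fˣ) (i : Fin (dim X n)) :
    (((t ^ twoBar X n i : Fˣ) : F) * (eps X n i : F)) ^ 2 = ((qOf t : Fˣ) : F) ^ twoBar X n i := by
  rw [mul_pow, pow_two (eps X n i : F), cast_eps_mul_self, mul_one, qOf, ← Units.val_pow_eq_pow_val,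
    ← Units.val_zpow_eq_zpow_val, ← zpow_natCast, ← zpow_natCast, ← zpow_mul, zpow_mul']

/-- The parameters of `R⁺` in types `B`, `C`, `D`. -/
def rMatrixData (t : Fˣ) : RMatrixData F (dim X n) where
  q := (qOf t : Fˣ)
  ξ := (xi X n t : Fˣ)
  ε := (revSign X : F)
  η := ((qOf t : Fˣ) : F) ^ (-revSign X)
  β i := ((t ^ twoBar X n i : Fˣ) : F) * (eps X n i : F)
  q_ne_zero := Units.ne_zero _
  ξ_ne_zero := Units.ne_zero _
  ε_eq := by cases X <;> simp [revSign]
  β_ne_zero i :=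
    mul_ne_zero (Units.ne_zero _) (left_ne_zero_of_mul_eq_one (cast_eps_mul_self X n F i))
  β_rev i := by
    have hi := cast_eps_mul_self X n F i
    have hne : (eps X n i : F) ≠ 0 := left_ne_zero_of_mul_eq_one hi
    rw [twoBar_rev, eps_rev, zpow_neg, Units.val_inv_eq_inv_val]
    push_cast
    field_simp
    linear_combination (revSign X : F) * hi
  middle i hi := by
    obtain ⟨h1, h2, h3⟩ := middle_index X n hi
    simp [h1, h2, h3]
  sum_Ioi_β_sq i := by
    have hq : ((qOf t : Fˣ) : F) ≠ 0 := Units.ne_zero _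
    simp only [β_sq]
    simp only [xi, Units.val_zpow_eq_zpow_val, div_eq_mul_inv]
    rw [mul_sum_Ioi_zpow_twoBar X n hq, ← zpow_add₀ hq, ← zpow_sub_one₀ hq, ← sub_eq_add_neg,
      middleJump, add_assoc]
  sum_β_sq hN := by
    have hq : ((qOf t : Fˣ) : F) ≠ 0 := Units.ne_zero _
    simp only [β_sq]
    simp only [xi, Units.val_zpow_eq_zpow_val]
    rw [mul_sum_zpow_twoBar X n hq hN, ← zpow_add₀ hq, ← sub_eq_add_neg, zpow_neg]

theorem wt_eq_div (t : Fˣ) (b e : Fin (dim X n)) :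
    wt X n t b e = (rMatrixData X n t).β b / (rMatrixData X n t).β e := by
  have he := cast_eps_mul_self X n F e
  have hne : (eps X n e : F) ≠ 0 := left_ne_zero_of_mul_eq_one he
  simp only [rMatrixData]
  rw [wt, zpow_sub, Units.val_mul, Units.val_inv_eq_inv_val]
  push_cast
  field_simp
  linear_combination (eps X n b : F) * he

theorem Rplus_apply_diag (x : F) (t : Fˣ) (a b : Fin (dim X n)) :
    Rplus X n x t (a, b) (a, b) = (rMatrixData X n t).R x (a, b) (a, b) := by
  have hq : (rMatrixData X n t).q ≠ 0 := (rMatrixData X n t).q_ne_zero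
  have hq_eq : ((qOf t : Fˣ) : F) = (rMatrixData X n t).q := rfl
  have hξ_eq : ((xi X n t : Fˣ) : F) = (rMatrixData X n t).ξ := rfl
  simp only [Rplus_apply, opR_apply, opP_apply, opQ_apply, wt_eq_div, Units.val_inv_eq_inv_val,
    hq_eq, hξ_eq, RMatrixData.R_apply, RMatrixData.diagCoeff, RMatrixData.exchCoeff,
    RMatrixData.annihCoeff,
    div_self ((rMatrixData X n t).β_ne_zero b)]
  generalize (rMatrixData X n t).ξ = ξ
  generalize (rMatrixData X n t).q = q at *
  by_cases hab : a = b
  · subst hab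
    by_cases hmid : a = a.rev
    · simp only [← hmid, and_self, if_true, lt_irrefl, if_false, not_true, ne_eq, and_false]
      field_simp
      ring
    · simp only [hmid, and_self, if_true, lt_irrefl, if_false, ne_eq, not_false_eq_true]
      field_simp
      ring
  · by_cases hmid : b = a.rev
    · have hbb : b ≠ b.rev := by grind
      have hba : b ≠ a := fun h => hab h.symm
      simp only [hab, ← hmid, hbb, hba, and_self, if_true, lt_irrefl, if_false, ne_eq,
        not_false_eq_true, false_and]
      field_simp
      ring
    · grind

theorem Rplus_apply_offDiag (x : F) (t : Fˣ) {a b c e : Fin (dim X n)}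
    (hdiag : ¬(a = c ∧ b = e)) :
    Rplus X n x t (a, b) (c, e) = (rMatrixData X n t).R x (a, b) (c, e) := by
  have hq : (rMatrixData X n t).q ≠ 0 := (rMatrixData X n t).q_ne_zero
  have hq_eq : ((qOf t : Fˣ) : F) = (rMatrixData X n t).q := rfl
  have hξ_eq : ((xi X n t : Fˣ) : F) = (rMatrixData X n t).ξ := rfl
  simp only [Rplus_apply, opR_apply, opP_apply, opQ_apply, wt_eq_div, Units.val_inv_eq_inv_val,
    hq_eq, hξ_eq, RMatrixData.R_apply, RMatrixData.diagCoeff, RMatrixData.exchCoeff,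
    RMatrixData.annihCoeff]
  generalize (rMatrixData X n t).β b / (rMatrixData X n t).β e = w
  generalize (rMatrixData X n t).ξ = ξ
  generalize (rMatrixData X n t).q = q at *
  have hexch : (a = e ∧ b = c) → ¬(a = b ∧ a ≠ a.rev) := by grind
  have hannih : (b = a.rev ∧ e = c.rev) → ¬(b = e ∧ b ≠ b.rev) := by grind
  have exch_coeff : q⁻¹ * (x - 1) * (x - ξ) * (if a < b then q - q⁻¹ else 0) -
      (q⁻¹ ^ 2 - 1) * (x - ξ) = (x - ξ) * ((1 - q⁻¹ ^ 2) * if a < b then x else 1) := by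
    split_ifs <;> field_simp <;> ring
  have annih_coeff : q⁻¹ * (x - 1) * (x - ξ) * (if e < b then (q - q⁻¹) * w else 0) -
      ξ * (q⁻¹ ^ 2 - 1) * (x - 1) * w =
        (x - 1) * ((1 - q⁻¹ ^ 2) * w * if e < b then x else ξ) := by
    split_ifs <;> field_simp <;> ring
  rw [if_neg hdiag, if_neg hdiag]
  by_cases he : a = e ∧ b = c <;> by_cases ha' : b = a.rev ∧ e = c.rev
  · rw [if_neg (hexch he), if_neg (hannih ha')]
    simp only [if_pos he, if_pos ha']
    linear_combination exch_coeff - annih_coeff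
  · rw [if_neg (hexch he)]
    simp only [if_pos he, if_neg ha']
    linear_combination exch_coeff
  · rw [if_neg (hannih ha')]
    simp only [if_neg he, if_pos ha']
    linear_combination -annih_coeff
  · simp only [if_neg he, if_neg ha']
    ring

theorem Rplus_eq (x : F) (t : Fˣ) : Rplus X n x t = (rMatrixData X n t).R x := by
  ext ⟨a, b⟩ ⟨c, e⟩
  by_cases hdiag : a = c ∧ b = e
  · obtain ⟨rfl, rfl⟩ := hdiag
    exact Rplus_apply_diag X n x t a b
  · exact Rplus_apply_offDiag X n x t hdiag

end Parameters

section Map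

variable {S S' : Type*} [CommRing S] [CommRing S'] (φ : S →+* S') (X : LieType) (n : ℕ) (t : Sˣ)

theorem coe_qOf_inv_map : (((qOf (Units.map (φ : S →* S') t))⁻¹ : S'ˣ) : S') =
    φ (((qOf t)⁻¹ : Sˣ) : S) := by
  simp only [qOf, ← map_pow, ← map_inv, Units.coe_map, MonoidHom.coe_coe]

theorem coe_xi_map : ((xi X n (Units.map (φ : S →* S') t) : S'ˣ) : S') = φ (xi X n t : Sˣ) := by
  simp only [xi, qOf, ← map_pow, ← map_zpow, Units.coe_map, MonoidHom.coe_coe]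

theorem wt_map (i j : Fin (dim X n)) :
    wt X n (Units.map (φ : S →* S') t) i j = φ (wt X n t i j) := by
  rw [wt, wt, ← map_zpow, map_mul, map_intCast, Units.coe_map, MonoidHom.coe_coe]

theorem Rplus_map (x : S) :
    (Rplus X n x t).map φ = Rplus X n (φ x) (Units.map (φ : S →* S') t) := by
  have hq : ((qOf (Units.map (φ : S →* S') t) : S'ˣ) : S') = φ (qOf t : Sˣ) := by
    simp only [qOf, ← map_pow, Units.coe_map, MonoidHom.coe_coe]
  ext ⟨a, b⟩ ⟨c, e⟩
  simp only [Matrix.map_apply, Rplus_apply, opR_apply, opP_apply, opQ_apply, hq, coe_qOf_inv_map,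
    coe_xi_map, wt_map, map_add, map_sub, map_mul, map_pow, map_one, apply_ite φ, map_zero]

variable {N : ℕ} (A B C : End2 N S) (a b c d e f : Fin N)

theorem ybLeft_map :
    φ (ybLeft A B C a b c d e f) = ybLeft (A.map φ) (B.map φ) (C.map φ) a b c d e f := by
  simp only [ybLeft, map_sum, map_mul, Matrix.map_apply]

theorem ybRight_map :
    φ (ybRight A B C a b c d e f) = ybRight (A.map φ) (B.map φ) (C.map φ) a b c d e f := by
  simp only [ybRight, map_sum, map_mul, Matrix.map_apply]

theorem unitarityScalar_map (q' ξ x x' : S) :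
    φ (unitarityScalar q' ξ x x') = unitarityScalar (φ q') (φ ξ) (φ x) (φ x') := by
  simp only [unitarityScalar, map_mul, map_sub, map_pow]

end Map

section Domain

variable {S : Type*} [CommRing S] [IsDomain S] (X : LieType) (n : ℕ)

theorem Rplus_mul_swap {x x' : S} (hx : x * x' = 1) (t : Sˣ) :
    Rplus X n x t * (Rplus X n x' t).submatrix Prod.swap Prod.swap =
      unitarityScalar (((qOf t)⁻¹ : Sˣ) : S) (xi X n t : Sˣ) x x' • 1 := by
  let φ := algebraMap S (FractionRing S)
  have hφ : φ x * φ x' = 1 := by rw [← map_mul, hx, map_one]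
  have hx' : φ x' = (φ x)⁻¹ := eq_inv_of_mul_eq_one_right hφ
  apply Matrix.map_injective (IsFractionRing.injective S (FractionRing S))
  change (_ * _ : End2 _ S).map φ = (_ • 1 : End2 _ S).map φ
  have h := (rMatrixData X n (Units.map (φ : S →* FractionRing S) t)).R_mul_R_swap
    (left_ne_zero_of_mul_eq_one hφ)
  rw [← hx', ← Rplus_eq, ← Rplus_eq] at h
  have hscalar (s : S) : (s • 1 : End2 (dim X n) S).map φ = φ s • 1 := by
    ext i j
    simp [Matrix.one_apply, apply_ite φ]
  rw [Matrix.map_mul, ← Matrix.submatrix_map, Rplus_map, Rplus_map, h, hscalar,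
    unitarityScalar_map, ← coe_qOf_inv_map, ← coe_xi_map, Units.val_inv_eq_inv_val]
  rfl

theorem wt_mul_Rplus {x x' : S} (hx : x * x' = 1) (t : Sˣ) (a b c e : Fin (dim X n)) :
    wt X n t a c * Rplus X n x t (c.rev, b) (a.rev, e) =
      x ^ 2 * ((xi X n t)⁻¹ : Sˣ) * Rplus X n ((xi X n t : Sˣ) * x') t (b, a) (e, c) := by
  let φ := algebraMap S (FractionRing S)
  have hφ : φ x * φ x' = 1 := by rw [← map_mul, hx, map_one]
  have hx' : φ x' = (φ x)⁻¹ := eq_inv_of_mul_eq_one_right hφ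
  have hξ : φ (((xi X n t)⁻¹ : Sˣ) : S) = (φ ((xi X n t : Sˣ) : S))⁻¹ :=
    eq_inv_of_mul_eq_one_left (by rw [← map_mul, Units.inv_mul, map_one])
  have h := (rMatrixData X n (Units.map (φ : S →* FractionRing S) t)).R_crossing
    (left_ne_zero_of_mul_eq_one hφ) a b c e
  have hξ' : (rMatrixData X n (Units.map (φ : S →* FractionRing S) t)).ξ =
      φ ((xi X n t : Sˣ) : S) := coe_xi_map φ X n t
  rw [← wt_eq_div, wt_map, hξ', div_eq_mul_inv, div_eq_mul_inv, ← hx', ← hξ, ← map_mul,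
    ← Rplus_eq, ← Rplus_eq, ← Rplus_map, ← Rplus_map, Matrix.map_apply, Matrix.map_apply] at h
  apply IsFractionRing.injective S (FractionRing S)
  simpa only [map_mul, map_pow] using h

theorem ybLeft_eq_ybRight_of_fractionRing (x y : S) (t : Sˣ) {a b c d e f : Fin (dim X n)}
    (h : ∀ x y : FractionRing S, ∀ t : (FractionRing S)ˣ,
      let r := rMatrixData X n t
      ybLeft (r.R x) (r.R (x * y)) (r.R y) a b c d e f =
        ybRight (r.R x) (r.R (x * y)) (r.R y) a b c d e f) :
    ybLeft (Rplus X n x t) (Rplus X n (x * y) t) (Rplus X n y t) a b c d e f =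
      ybRight (Rplus X n x t) (Rplus X n (x * y) t) (Rplus X n y t) a b c d e f := by
  apply IsFractionRing.injective S (FractionRing S)
  rw [ybLeft_map, ybRight_map, Rplus_map, Rplus_map, Rplus_map, Rplus_eq, Rplus_eq, Rplus_eq,
    map_mul]
  exact h _ _ _

end Domain

/-- A set of matrix entries of operators on three tensor factors, rows and columns being given by
three indices each, which is stable under permutations of the factors and under the transposition
`t` of the first factor, and contains the entries without mirror pairs in the column as well as
three special families. -/
structure EntrySet {N : ℕ} (P : Fin N → Fin N → Fin N → Fin N → Fin N → Fin N → Prop) : Prop where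
  swap12 : ∀ {a b c d e f}, P a b c d e f → P b a c e d f
  swap13 : ∀ {a b c d e f}, P a b c d e f → P c b a f e d
  flip : ∀ {a b c d e f}, P a b c d e f → P d.rev b c a.rev e f
  no_pair : ∀ {a b c d e f}, e ≠ d.rev → f ≠ d.rev → f ≠ e.rev → P a b c d e f
  flip_fix_flip : ∀ {a b}, b ≠ a → b ≠ a.rev → P a.rev b a a b a.rev
  flip_rotate : ∀ {a b}, b ≠ a → b ≠ a.rev → P a.rev a b a b a.rev
  flip_fix_flip_self : ∀ {b}, b ≠ b.rev → P b b b.rev b.rev b b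
  middle : ∀ {m}, m = m.rev → P m m m m m m

namespace EntrySet

variable {N : ℕ} {P : Fin N → Fin N → Fin N → Fin N → Fin N → Fin N → Prop} (h : EntrySet P)
include h

variable {a b c d e f : Fin N}

theorem swap23 (w : P a b c d e f) : P a c b d f e :=
  h.swap12 (h.swap13 (h.swap12 w))

theorem cycle (w : P a b c d e f) : P b c a e f d :=
  h.swap23 (h.swap12 w)

theorem of_flip_first (w : P d.rev b c a.rev e f) : P a b c d e f := by
  simpa only [Fin.rev_rev] using h.flip w

theorem of_flip_second (w : P a e.rev c d b.rev f) : P a b c d e f :=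
  h.swap12 (h.of_flip_first (h.swap12 w))

theorem of_flip_third (w : P a b f.rev d e c.rev) : P a b c d e f :=
  h.swap13 (h.of_flip_first (h.swap13 w))

theorem fix_mirror_mirror (a b : Fin N) : P b a.rev a b a a.rev := by
  by_cases hba : b = a
  · subst hba
    by_cases hmid : b = b.rev
    · rw [← hmid]
      exact h.middle hmid
    · exact h.swap12 (h.swap13 (h.flip_fix_flip_self hmid))
  · by_cases hba' : b = a.rev
    · subst hba'
      simpa only [Fin.rev_rev] using
        h.swap12 (h.flip_fix_flip_self (b := a.rev) (by rwa [Fin.rev_rev]))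
    · exact h.swap12 (h.flip_fix_flip hba hba')

theorem rotate_mirror (a c : Fin N) : P a.rev c a a a.rev c := by
  by_cases hca : c = a
  · subst hca
    exact h.swap13 (h.swap23 (h.fix_mirror_mirror c c))
  · by_cases hca' : c = a.rev
    · subst hca'
      exact h.swap12 (h.fix_mirror_mirror a a.rev)
    · exact h.swap23 (h.flip_rotate hca hca')

theorem rotate (a b c : Fin N) : P b c a a b c := by
  by_cases hba : b = a.rev
  · subst hba
    exact h.rotate_mirror a c
  by_cases hcb : c = b.rev
  · subst hcb
    exact h.cycle (h.cycle (h.rotate_mirror b a))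
  by_cases hca : c = a.rev
  · obtain rfl : a = c.rev := by rw [hca, Fin.rev_rev]
    exact h.cycle (h.rotate_mirror c b)
  · exact h.no_pair hba hca hcb

theorem fix_exchange (b c d : Fin N) : P b d c b c d := by
  by_cases hdc : d = c.rev
  · subst hdc
    exact h.fix_mirror_mirror c b
  by_cases hb : c = b.rev ∨ d = b.rev
  · by_cases hb' : c = b ∨ d = b
    · rcases hb' with rfl | rfl
      · exact h.rotate c c d
      · exact h.swap23 (h.rotate d d c)
    · rw [not_or] at hb'
      exact h.of_flip_first (h.no_pair (by rw [Fin.rev_rev]; exact hb'.1)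
        (by rw [Fin.rev_rev]; exact hb'.2) hdc)
  · rw [not_or] at hb
    exact h.no_pair hb.1 hb.2 hdc

theorem fix_of_ne (hb : b ≠ a.rev) (c : Fin N) : P a b c a b c := by
  by_cases hc : c = a.rev ∨ c = b.rev
  · by_cases hc' : c.rev = a.rev ∨ c.rev = b.rev
    · rw [Fin.rev_inj, Fin.rev_inj] at hc'
      rcases hc' with rfl | rfl
      · have hmid : c = c.rev := hc.resolve_right fun h' => hb (by rw [h', Fin.rev_rev])
        have := h.swap12 (h.fix_mirror_mirror c b)
        rwa [← hmid] at this
      · have hmid : c = c.rev := hc.resolve_left fun h' => hb h'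
        have := h.fix_mirror_mirror c a
        rwa [← hmid] at this
    · rw [not_or] at hc'
      exact h.of_flip_third (h.no_pair hb hc'.1 hc'.2)
  · rw [not_or] at hc
    exact h.no_pair hb hc.1 hc.2

theorem fix (a b c : Fin N) : P a b c a b c := by
  by_cases hb : b = a.rev
  · subst hb
    by_cases hmid : a = a.rev
    · have := h.cycle (h.fix_mirror_mirror a c)
      rwa [← hmid] at this ⊢
    · exact h.of_flip_second (h.fix_of_ne (by rwa [Fin.rev_rev]) c)
  · exact h.fix_of_ne hb c

end EntrySet

/-- The analogue of `IsPaired` on three tensor factors: the entry `((a, b, c), (d, e, f))` is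
described by a perfect matching of the six indices, in which equal indices are joined if one of them
is a row and the other a column index, and mirror images are joined within rows and columns. -/
def IsMatched {N : ℕ} (a b c d e f : Fin N) : Prop :=
  a = d ∧ IsPaired b c e f ∨ a = e ∧ IsPaired b c d f ∨ a = f ∧ IsPaired b c e d ∨
    b = a.rev ∧ (c = d ∧ f = e.rev ∨ c = e ∧ f = d.rev ∨ c = f ∧ e = d.rev) ∨
    c = a.rev ∧ (b = d ∧ f = e.rev ∨ b = e ∧ f = d.rev ∨ b = f ∧ e = d.rev)

theorem isMatched_of_isPaired_left {N : ℕ} {a b c d e f k l m : Fin N} (hab : IsPaired a b k l)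
    (hkc : IsPaired k c d m) (hlm : IsPaired l m e f) : IsMatched a b c d e f := by
  rcases hab with ⟨rfl, rfl⟩ | ⟨rfl, rfl⟩ | ⟨rfl, rfl⟩ <;>
  rcases hkc with ⟨rfl, rfl⟩ | ⟨rfl, rfl⟩ | ⟨hck, rfl⟩ <;>
  rcases hlm with ⟨hle, hmf⟩ | ⟨hlf, hme⟩ | ⟨hml, hfe⟩ <;>
  grind [IsMatched, IsPaired, Fin.rev_rev]

theorem isMatched_of_isPaired_right {N : ℕ} {a b c d e f k l m : Fin N} (hbc : IsPaired b c l m)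
    (ham : IsPaired a m k f) (hkl : IsPaired k l d e) : IsMatched a b c d e f := by
  rcases hbc with ⟨rfl, rfl⟩ | ⟨rfl, rfl⟩ | ⟨rfl, rfl⟩ <;>
  rcases ham with ⟨rfl, rfl⟩ | ⟨rfl, rfl⟩ | ⟨hma, rfl⟩ <;>
  rcases hkl with ⟨hkd, hle⟩ | ⟨hke, hld⟩ | ⟨hlk, hed⟩ <;>
  grind [IsMatched, IsPaired, Fin.rev_rev]

theorem EntrySet.of_isMatched {N : ℕ} {P : Fin N → Fin N → Fin N → Fin N → Fin N → Fin N → Prop}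
    (h : EntrySet P) {a b c d e f : Fin N} (w : IsMatched a b c d e f) : P a b c d e f := by
  have rotate_inv (a b c : Fin N) : P a b c b c a := h.swap23 (h.rotate b a c)
  have exchange_fix (a b c : Fin N) : P a b c b a c := h.swap13 (h.fix_exchange c a b)
  have exchange_outer (a b c : Fin N) : P a b c c b a := h.swap12 (h.fix_exchange b c a)
  rcases w with ⟨rfl, ⟨rfl, rfl⟩ | ⟨rfl, rfl⟩ | ⟨rfl, rfl⟩⟩ |
    ⟨rfl, ⟨rfl, rfl⟩ | ⟨rfl, rfl⟩ | ⟨rfl, rfl⟩⟩ | ⟨rfl, ⟨rfl, rfl⟩ | ⟨rfl, rfl⟩ | ⟨rfl, rfl⟩⟩ |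
    ⟨rfl, ⟨rfl, rfl⟩ | ⟨rfl, rfl⟩ | ⟨rfl, rfl⟩⟩ | ⟨rfl, ⟨rfl, rfl⟩ | ⟨rfl, rfl⟩ | ⟨rfl, rfl⟩⟩
  · exact h.fix _ _ _
  · exact h.fix_exchange _ _ _
  · exact h.of_flip_third (by simpa only [Fin.rev_rev] using h.fix_exchange _ _ _)
  · exact exchange_fix _ _ _
  · exact h.rotate _ _ _
  · exact h.of_flip_third (by simpa only [Fin.rev_rev] using h.rotate _ _ _)
  · exact exchange_outer _ _ _
  · exact rotate_inv _ _ _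
  · exact h.of_flip_second (rotate_inv _ _ _)
  · exact h.of_flip_second (by simpa only [Fin.rev_rev] using h.rotate _ _ _)
  · exact h.of_flip_first (rotate_inv _ _ _)
  · exact h.of_flip_second (by simpa only [Fin.rev_rev] using exchange_fix _ _ _)
  · exact h.of_flip_third (by simpa only [Fin.rev_rev] using rotate_inv _ _ _)
  · exact h.of_flip_third (by simpa only [Fin.rev_rev] using exchange_outer _ _ _)
  · exact h.of_flip_first (h.rotate _ _ _)

section Legs

variable {S : Type*} [CommRing S] {N m : ℕ} {r s : Fin m}

theorem legs_apply (r s : Fin m) (A : End2 N S) (a b : Fin m → Fin N) :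
    legs r s A a b = if ∀ p, p ≠ r → p ≠ s → a p = b p then A (a r, a s) (b r, b s) else 0 :=
  rfl

theorem legs_mul_apply (hrs : r ≠ s) (A : End2 N S) (M : Matrix (Fin m → Fin N) (Fin m → Fin N) S)
    (a b : Fin m → Fin N) :
    (legs r s A * M) a b = ∑ k : Fin N × Fin N,
      A (a r, a s) k * M (Function.update (Function.update a r k.1) s k.2) b := by
  let insertAt (k : Fin N × Fin N) := Function.update (Function.update a r k.1) s k.2
  have insertAt_left (k) : insertAt k r = k.1 := by simp [insertAt, Function.update_of_ne hrs]
  have insertAt_right (k) : insertAt k s = k.2 := by simp [insertAt]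
  have insertAt_of_ne (k) (p) (hr : p ≠ r) (hs : p ≠ s) : insertAt k p = a p := by
    simp [insertAt, hr, hs]
  rw [Matrix.mul_apply]
  symm
  apply Fintype.sum_of_injective insertAt
  · intro k l h
    exact Prod.ext (by rw [← insertAt_left k, h, insertAt_left])
      (by rw [← insertAt_right k, h, insertAt_right])
  · intro γ hγ
    rw [legs_apply, if_neg, zero_mul]
    refine fun h => hγ ⟨(γ r, γ s), funext fun p => ?_⟩
    rcases eq_or_ne p s with rfl | hs
    · exact insertAt_right _
    rcases eq_or_ne p r with rfl | hr
    · exact insertAt_left _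
    · rw [insertAt_of_ne _ p hr hs, h p hr hs]
  · intro k
    rw [legs_apply, if_pos fun p hr hs => (insertAt_of_ne k p hr hs).symm, insertAt_left,
      insertAt_right]

theorem legs_mul (hrs : r ≠ s) (A B : End2 N S) :
    legs r s A * legs r s B = legs r s (A * B) := by
  ext a b
  have hcond (k : Fin N × Fin N) :
      (∀ p, p ≠ r → p ≠ s → Function.update (Function.update a r k.1) s k.2 p = b p) ↔
        ∀ p, p ≠ r → p ≠ s → a p = b p := by
    refine forall_congr' fun p => forall₂_congr fun hr hs => ?_
    rw [Function.update_of_ne hs, Function.update_of_ne hr]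
  simp only [legs_mul_apply hrs, legs_apply, hcond, Function.update_self,
    Function.update_of_ne hrs, Matrix.mul_apply]
  split_ifs
  · rfl
  · exact Finset.sum_eq_zero fun _ _ => mul_zero _

theorem legs_one (r s : Fin m) : legs r s (1 : End2 N S) = 1 := by
  ext a b
  have hcond : (∀ p, p ≠ r → p ≠ s → a p = b p) ∧ (a r, a s) = (b r, b s) ↔ a = b := by
    grind
  simp only [legs_apply, Matrix.one_apply, ← ite_and, hcond]

theorem legs_smul (r s : Fin m) (c : S) (A : End2 N S) : legs r s (c • A) = c • legs r s A := by
  ext a b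
  simp only [legs_apply, Matrix.smul_apply, smul_eq_mul, mul_ite, mul_zero]

theorem legs_swap (r s : Fin m) (A : End2 N S) :
    legs r s (A.submatrix Prod.swap Prod.swap) = legs s r A := by
  ext a b
  simp only [legs_apply, Matrix.submatrix_apply, Prod.swap_prod_mk]
  congr 1
  exact propext (forall_congr' fun p => forall_comm)

theorem legs_map {S' : Type*} [CommRing S'] (φ : S →+* S') (r s : Fin m) (A : End2 N S) :
    (legs r s A).map φ = legs r s (A.map φ) := by
  ext a b
  simp only [Matrix.map_apply, legs_apply, apply_ite φ, map_zero]

/-- The operator on `m` tensor factors obtained from `M` by moving the factor `p` to `σ p`. -/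
def permute (σ : Equiv.Perm (Fin m)) (M : Matrix (Fin m → Fin N) (Fin m → Fin N) S) :
    Matrix (Fin m → Fin N) (Fin m → Fin N) S :=
  M.submatrix (fun a => a ∘ σ) (fun a => a ∘ σ)

theorem permute_sub (σ : Equiv.Perm (Fin m)) (M M' : Matrix (Fin m → Fin N) (Fin m → Fin N) S) :
    permute σ (M - M') = permute σ M - permute σ M' := rfl

theorem permute_mul (σ : Equiv.Perm (Fin m)) (M M' : Matrix (Fin m → Fin N) (Fin m → Fin N) S) :
    permute σ (M * M') = permute σ M * permute σ M' :=
  Matrix.submatrix_mul M M' _ _ _ (σ.arrowCongr (Equiv.refl (Fin N))).symm.bijective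

theorem permute_legs (σ : Equiv.Perm (Fin m)) (r s : Fin m) (A : End2 N S) :
    permute σ (legs r s A) = legs (σ r) (σ s) A := by
  ext a b
  rw [permute, Matrix.submatrix_apply, legs_apply, legs_apply]
  congr 1
  refine propext (σ.forall_congr fun p => ?_)
  simp only [Function.comp_apply, ne_eq, EmbeddingLike.apply_eq_iff_eq]

theorem legs_mul_eq_ybLeft (A B C : End2 N S) (a b : Fin 3 → Fin N) :
    (legs 0 1 A * legs 0 2 B * legs 1 2 C : Matrix (Fin 3 → Fin N) (Fin 3 → Fin N) S) a b =
      ybLeft A B C (a 0) (a 1) (a 2) (b 0) (b 1) (b 2) := by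
  rw [Matrix.mul_assoc, legs_mul_apply (by decide), ybLeft, Fintype.sum_prod_type]
  refine Finset.sum_congr rfl fun k _ => Finset.sum_congr rfl fun l _ => ?_
  simp [legs_mul_apply (show (0 : Fin 3) ≠ 2 by decide), Fintype.sum_prod_type, legs_apply,
    Fin.forall_fin_succ, Finset.mul_sum, mul_assoc]

theorem legs_mul_eq_ybRight (A B C : End2 N S) (a b : Fin 3 → Fin N) :
    (legs 1 2 C * legs 0 2 B * legs 0 1 A : Matrix (Fin 3 → Fin N) (Fin 3 → Fin N) S) a b =
      ybRight A B C (a 0) (a 1) (a 2) (b 0) (b 1) (b 2) := by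
  rw [Matrix.mul_assoc, legs_mul_apply (by decide), ybRight, Fintype.sum_prod_type]
  conv_rhs => rw [Finset.sum_comm]
  refine Finset.sum_congr rfl fun l _ => ?_
  conv_rhs => rw [Finset.sum_comm]
  refine Finset.sum_congr rfl fun m _ => ?_
  simp [legs_mul_apply (show (0 : Fin 3) ≠ 2 by decide), Fintype.sum_prod_type, legs_apply,
    Fin.forall_fin_succ, Finset.mul_sum, mul_assoc]

end Legs

theorem Rplus_one (X : LieType) (n : ℕ) {S : Type*} [CommRing S] (x : S) :
    Rplus X n x 1 = (x - 1) ^ 2 • 1 := by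
  ext ⟨a, b⟩ ⟨c, e⟩
  rw [Rplus_apply, opR_apply, Matrix.smul_apply, Matrix.one_apply]
  simp only [qOf, xi, one_pow, inv_one, Units.val_one, one_zpow, sub_self, zero_mul, ite_self,
    mul_zero, add_zero, sub_zero, one_mul, Prod.mk.injEq, smul_eq_mul]
  split_ifs <;> ring

section ThreeFactors

variable {S : Type*} [CommRing S] {N : ℕ}

/-- The difference of the two sides of the Yang–Baxter equation. -/
def ybDefect (A B C : End2 N S) : Matrix (Fin 3 → Fin N) (Fin 3 → Fin N) S :=
  legs 0 1 A * legs 0 2 B * legs 1 2 C - legs 1 2 C * legs 0 2 B * legs 0 1 A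

theorem ybDefect_apply (A B C : End2 N S) (a b c d e f : Fin N) :
    ybDefect A B C ![a, b, c] ![d, e, f] =
      ybLeft A B C a b c d e f - ybRight A B C a b c d e f := by
  rw [ybDefect, Matrix.sub_apply, legs_mul_eq_ybLeft, legs_mul_eq_ybRight]
  rfl

theorem permute_swap_ybDefect (A B C : End2 N S) :
    permute (Equiv.swap 0 2) (ybDefect A B C) = -ybDefect (C.submatrix Prod.swap Prod.swap)
      (B.submatrix Prod.swap Prod.swap) (A.submatrix Prod.swap Prod.swap) := by
  have hswap : Equiv.swap (0 : Fin 3) 2 1 = 1 := by decide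
  simp only [ybDefect, permute_sub, permute_mul, permute_legs, legs_swap, Equiv.swap_apply_left,
    Equiv.swap_apply_right, hswap, neg_sub]

/-- `A₁₂ A'₂₁` and `A'₁₂ A₂₁` are the scalar `α`. -/
structure IsUnitaryPair (α : S) (A A' : End2 N S) : Prop where
  mul_swap : A * A'.submatrix Prod.swap Prod.swap = α • 1
  mul_swap' : A' * A.submatrix Prod.swap Prod.swap = α • 1

namespace IsUnitaryPair

variable {α β γ : S} {A A' B B' C C' : End2 N S}

theorem legs_mul_legs (hA : IsUnitaryPair α A A') {m : ℕ} {r s : Fin m} (hrs : r ≠ s) :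
    legs r s A * legs s r A' = α • 1 := by
  rw [← legs_swap r s, legs_mul hrs, hA.mul_swap, legs_smul, legs_one]

theorem symm (hA : IsUnitaryPair α A A') : IsUnitaryPair α A' A := ⟨hA.mul_swap', hA.mul_swap⟩

theorem smul (hA : IsUnitaryPair α A A') (c d : S) :
    IsUnitaryPair (c * d * α) (c • A) (d • A') where
  mul_swap := by
    rw [Matrix.submatrix_smul, Pi.smul_apply, Pi.smul_apply, Matrix.smul_mul, Matrix.mul_smul,
      hA.mul_swap, smul_smul, smul_smul, mul_assoc]
  mul_swap' := by
    rw [Matrix.submatrix_smul, Pi.smul_apply, Pi.smul_apply, Matrix.smul_mul, Matrix.mul_smul,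
      hA.mul_swap', smul_smul, smul_smul, mul_comm c d, mul_assoc]

theorem mul_permute_ybDefect_mul (hA : IsUnitaryPair α A A') (B C : End2 N S) :
    legs 0 1 A' * permute (Equiv.swap 0 1) (ybDefect A B C) * legs 0 1 A' =
      -α • ybDefect A' C B := by
  have hleft := hA.symm.legs_mul_legs (r := (0 : Fin 3)) (s := 1) (by decide)
  have hright := hA.legs_mul_legs (r := (1 : Fin 3)) (s := 0) (by decide)
  have hswap : Equiv.swap (0 : Fin 3) 1 2 = 2 := by decide
  simp only [ybDefect, permute_sub, permute_mul, permute_legs, Equiv.swap_apply_left,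
    Equiv.swap_apply_right, hswap]
  rw [mul_sub, sub_mul, neg_smul, ← smul_neg, neg_sub, smul_sub]
  congr 1
  · rw [mul_assoc (legs 1 0 _), ← mul_assoc (legs 0 1 _), hleft, smul_mul_assoc, one_mul,
      smul_mul_assoc]
  · rw [mul_assoc, mul_assoc, hright, mul_smul_comm, mul_one, mul_smul_comm, mul_assoc]

end IsUnitaryPair

theorem mul_reversal_defect_mul {M : Type*} [Ring M] [Algebra S M] {A B C A' B' C' : M}
    {α β γ : S} (hA : A' * A = α • (1 : M)) (hB : B' * B = β • (1 : M))
    (hC : C' * C = γ • (1 : M)) (hA' : A * A' = α • (1 : M)) (hB' : B * B' = β • (1 : M))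
    (hC' : C * C' = γ • (1 : M)) :
    A' * B' * C' * (C * B * A - A * B * C) * (C' * B' * A') =
      (α * β * γ) • (C' * B' * A' - A' * B' * C') := by
  have cancel_left : A' * B' * C' * (C * B * A) = (α * β * γ) • (1 : M) := by
    calc A' * B' * C' * (C * B * A) = A' * (B' * (C' * C) * B) * A := by noncomm_ring
      _ = (α * β * γ) • (1 : M) := by
        simp only [hC, hB, hA, mul_smul_comm, smul_mul_assoc, mul_one, smul_smul]
        congr 1; ring
  have cancel_right : A * B * C * (C' * B' * A') = (α * β * γ) • (1 : M) := by
    calc A * B * C * (C' * B' * A') = A * (B * (C * C') * B') * A' := by noncomm_ring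
      _ = (α * β * γ) • (1 : M) := by
        simp only [hC', hB', hA', mul_smul_comm, smul_mul_assoc, mul_one, smul_smul]
        congr 1; ring
  rw [mul_sub, sub_mul, cancel_left, mul_assoc _ (A * B * C), cancel_right, smul_mul_assoc,
    one_mul, mul_smul_comm, mul_one, smul_sub]

theorem mul_permute_swap_ybDefect_mul {α β γ : S} {A A' B B' C C' : End2 N S}
    (hA : IsUnitaryPair α A A') (hB : IsUnitaryPair β B B') (hC : IsUnitaryPair γ C C') :
    legs 0 1 C' * legs 0 2 B' * legs 1 2 A' * permute (Equiv.swap 0 2) (ybDefect A B C) *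
      (legs 1 2 A' * legs 0 2 B' * legs 0 1 C') = -(γ * β * α) • ybDefect C' B' A' := by
  rw [permute_swap_ybDefect, ybDefect, ybDefect, neg_sub, legs_swap, legs_swap, legs_swap,
    mul_reversal_defect_mul (hC.symm.legs_mul_legs (by decide)) (hB.symm.legs_mul_legs (by decide))
      (hA.symm.legs_mul_legs (by decide)) (hC.legs_mul_legs (by decide))
      (hB.legs_mul_legs (by decide)) (hA.legs_mul_legs (by decide)),
    neg_smul, ← smul_neg, neg_sub]

/-- The transpose of `A` in its first factor, conjugated by the weights `w`, is `α A'₂₁`. -/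
def IsCrossingPair (w : Fin N → Fin N → S) (α : S) (A A' : End2 N S) : Prop :=
  ∀ a b c e, w a c * A (c.rev, b) (a.rev, e) = α * A' (b, a) (e, c)

section Crossing

variable {w : Fin N → Fin N → S} (hw : ∀ a b c, w a b * w b c = w a c) {α β : S}
  {A A' B B' : End2 N S} (hA : IsCrossingPair w α A A') (hB : IsCrossingPair w β B B')
  (C : End2 N S) (a b c d e f : Fin N)

include hw hA hB

theorem mul_ybLeft_of_isCrossingPair :
    w d.rev a.rev * ybLeft A B C a b c d e f =
      α * β * ybLeft (B'.submatrix Prod.swap Prod.swap) (A'.submatrix Prod.swap Prod.swap)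
        (C.submatrix Prod.swap Prod.swap) d.rev c b a.rev f e := by
  rw [ybLeft, ybLeft, ← Equiv.sum_comp Fin.revPerm]
  conv_rhs => enter [2, 2, k]; rw [Finset.sum_comm]
  simp only [Finset.mul_sum]
  refine Finset.sum_congr rfl fun k _ => Finset.sum_congr rfl fun l _ =>
    Finset.sum_congr rfl fun m _ => ?_
  simp only [Matrix.submatrix_apply, Prod.swap_prod_mk, Fin.revPerm_apply]
  have hA' := hA k b a.rev l
  have hB' := hB d.rev c k m
  rw [Fin.rev_rev] at hA' hB'
  rw [← hw d.rev k a.rev]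
  linear_combination (w d.rev k * B (k.rev, c) (d, m) * C (l, m) (e, f)) * hA' +
    (α * A' (b, k) (l, a.rev) * C (l, m) (e, f)) * hB'

theorem mul_ybRight_of_isCrossingPair :
    w d.rev a.rev * ybRight A B C a b c d e f =
      α * β * ybRight (B'.submatrix Prod.swap Prod.swap) (A'.submatrix Prod.swap Prod.swap)
        (C.submatrix Prod.swap Prod.swap) d.rev c b a.rev f e := by
  rw [ybRight, ybRight, ← Equiv.sum_comp Fin.revPerm]
  conv_rhs => enter [2, 2, k]; rw [Finset.sum_comm]
  simp only [Finset.mul_sum]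
  refine Finset.sum_congr rfl fun k _ => Finset.sum_congr rfl fun l _ =>
    Finset.sum_congr rfl fun m _ => ?_
  simp only [Matrix.submatrix_apply, Prod.swap_prod_mk, Fin.revPerm_apply]
  have hA' := hA d.rev l k e
  have hB' := hB k m a.rev f
  rw [Fin.rev_rev] at hA' hB'
  rw [← hw d.rev k a.rev]
  linear_combination (w k a.rev * B (a, m) (k.rev, f) * C (b, c) (l, m)) * hA' +
    (α * A' (l, d.rev) (e, k) * C (b, c) (l, m)) * hB'

theorem mul_ybDefect_of_isCrossingPair :
    w d.rev a.rev * ybDefect A B C ![a, b, c] ![d, e, f] =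
      -(α * β) * permute (Equiv.swap 0 2) (ybDefect C A' B') ![d.rev, c, b] ![a.rev, f, e] := by
  rw [permute_swap_ybDefect, Matrix.neg_apply, neg_mul_neg, ybDefect_apply, ybDefect_apply, mul_sub,
    mul_sub, mul_ybLeft_of_isCrossingPair hw hA hB, mul_ybRight_of_isCrossingPair hw hA hB]

end Crossing

end ThreeFactors

theorem wt_mul_wt (X : LieType) (n : ℕ) {S : Type*} [CommRing S] (t : Sˣ)
    (a b c : Fin (dim X n)) : wt X n t a b * wt X n t b c = wt X n t a c := by
  have hb := cast_eps_mul_self X n S b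
  have hpow : t ^ (twoBar X n a - twoBar X n c) =
      t ^ (twoBar X n a - twoBar X n b) * t ^ (twoBar X n b - twoBar X n c) := by
    rw [← zpow_add, sub_add_sub_cancel]
  simp only [wt, hpow]
  push_cast
  linear_combination ((t ^ (twoBar X n a - twoBar X n b) : Sˣ) : S) *
    ((t ^ (twoBar X n b - twoBar X n c) : Sˣ) : S) * (eps X n a : S) * (eps X n c : S) * hb

theorem isUnit_wt (X : LieType) (n : ℕ) {S : Type*} [CommRing S] (t : Sˣ)
    (a b : Fin (dim X n)) : IsUnit (wt X n t a b) :=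
  .of_mul_eq_one (wt X n t b a) <| by
    rw [wt_mul_wt, wt, sub_self, zpow_zero, Units.val_one, one_mul, Int.cast_mul,
      cast_eps_mul_self]

section Rplus

variable {S : Type*} [CommRing S] [IsDomain S] (X : LieType) (n : ℕ) (t : Sˣ) {x x' : S}

theorem isUnitaryPair_Rplus (hx : x * x' = 1) :
    IsUnitaryPair (unitarityScalar (((qOf t)⁻¹ : Sˣ) : S) (xi X n t : Sˣ) x x')
      (Rplus X n x t) (Rplus X n x' t) where
  mul_swap := Rplus_mul_swap X n hx t
  mul_swap' := by
    rw [Rplus_mul_swap X n ((mul_comm x' x).trans hx), unitarityScalar, unitarityScalar]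
    congr 1
    ring

theorem isCrossingPair_Rplus (hx : x * x' = 1) :
    IsCrossingPair (wt X n t) (x ^ 2 * ((xi X n t)⁻¹ : Sˣ)) (Rplus X n x t)
      (Rplus X n ((xi X n t : Sˣ) * x') t) :=
  fun a b c e => wt_mul_Rplus X n hx t a b c e

end Rplus

section ScalarMod

variable {S ι : Type*} [CommRing S] [Fintype ι] [DecidableEq ι]

/-- A matrix that is congruent to the scalar matrix `u` modulo `p`. -/
def IsScalarMod (p : S) (A : Matrix ι ι S) (u : S) : Prop :=
  ∀ i j, p ∣ (A - u • 1) i j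

namespace IsScalarMod

variable {p u v : S} {A B Y : Matrix ι ι S} {m : ℕ}

theorem mul (hA : IsScalarMod p A u) (hB : IsScalarMod p B v) :
    IsScalarMod p (A * B) (u * v) := by
  intro i j
  have hsplit : A * B - (u * v) • 1 = (A - u • 1) * B + u • (B - v • 1) := by
    rw [sub_mul, smul_mul_assoc, one_mul, smul_sub, smul_smul]
    abel
  rw [hsplit, Matrix.add_apply, Matrix.mul_apply, Matrix.smul_apply]
  exact dvd_add (Finset.dvd_sum fun l _ => (hA i l).mul_right _) ((hB i j).mul_left _)

theorem pow_dvd_mul_sub (hA : IsScalarMod p A u) (hY : ∀ i j, p ^ m ∣ Y i j) (i j : ι) :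
    p ^ (m + 1) ∣ (A * Y) i j - u * Y i j := by
  have hsub : (A * Y) i j - u * Y i j = ((A - u • 1) * Y) i j := by
    rw [sub_mul, smul_mul_assoc, one_mul]
    rfl
  rw [hsub, Matrix.mul_apply, pow_succ']
  exact Finset.dvd_sum fun l _ => mul_dvd_mul (hA i l) (hY l j)

theorem pow_dvd_sub_mul (hA : IsScalarMod p A u) (hY : ∀ i j, p ^ m ∣ Y i j) (i j : ι) :
    p ^ (m + 1) ∣ (Y * A) i j - u * Y i j := by
  have hsub : (Y * A) i j - u * Y i j = (Y * (A - u • 1)) i j := by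
    rw [mul_sub, mul_smul_comm, mul_one]
    rfl
  rw [hsub, Matrix.mul_apply, pow_succ]
  exact Finset.dvd_sum fun l _ => mul_dvd_mul (hY i l) (hA l j)

theorem pow_dvd_of_pow_dvd_mul_mul (hA : IsScalarMod p A u) (hB : IsScalarMod p B v)
    (hu : IsUnit u) (hv : IsUnit v) (hY : ∀ i j, p ^ m ∣ Y i j) {i j : ι}
    (h : p ^ (m + 1) ∣ (A * Y * B) i j) : p ^ (m + 1) ∣ Y i j := by
  have hAY (i j : ι) : p ^ m ∣ (A * Y) i j :=
    Matrix.mul_apply (M := A) ▸ Finset.dvd_sum fun l _ => (hY l j).mul_left _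
  have hright := (dvd_sub_right h).mp (hB.pow_dvd_sub_mul hAY i j)
  have hleft := (dvd_sub_right (hv.dvd_mul_left.mp hright)).mp (hA.pow_dvd_mul_sub hY i j)
  exact hu.dvd_mul_left.mp hleft

end IsScalarMod

end ScalarMod

theorem triple_comp_swap_zero_one {α : Type*} (a b c : α) :
    ![a, b, c] ∘ Equiv.swap (0 : Fin 3) 1 = ![b, a, c] := by
  funext i
  fin_cases i <;> rfl

theorem triple_comp_swap_zero_two {α : Type*} (a b c : α) :
    ![a, b, c] ∘ Equiv.swap (0 : Fin 3) 2 = ![c, b, a] := by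
  funext i
  fin_cases i <;> rfl

section SpectralDefect

open PowerSeries (constantCoeff)

/-- The defect of the Yang–Baxter equation for `R⁺` at the multiplicative spectral parameters
`x` and `y`. -/
def spectralDefect (X : LieType) (n : ℕ) {S : Type*} [CommRing S] (t : Sˣ) (x y : S) :
    Matrix (Fin 3 → Fin (dim X n)) (Fin 3 → Fin (dim X n)) S :=
  ybDefect (Rplus X n x t) (Rplus X n (x * y) t) (Rplus X n y t)

variable {k : Type*} [Field k]

/-- Spectral parameters at which `R⁺(x)`, `R⁺(x y)` and `R⁺(y)` are invertible modulo the
variable. -/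
structure IsGeneric (x y : PowerSeries k) : Prop where
  left_ne_zero : constantCoeff x ≠ 0
  right_ne_zero : constantCoeff y ≠ 0
  left_ne_one : constantCoeff x ≠ 1
  right_ne_one : constantCoeff y ≠ 1
  mul_ne_one : constantCoeff x * constantCoeff y ≠ 1

namespace IsGeneric

variable {x y z : PowerSeries k}

theorem inv_mul (hxy : IsGeneric x y) : IsGeneric x⁻¹ (x * y) := by
  obtain ⟨hx, hy, hx₁, hy₁, hxy₁⟩ := hxy
  constructor <;> simp only [map_mul, PowerSeries.constantCoeff_inv, ne_eq, inv_eq_zero, inv_eq_one,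
    mul_eq_zero, not_or, inv_mul_cancel_left₀ hx]
  exacts [hx, ⟨hx, hy⟩, hx₁, hxy₁, hy₁]

theorem inv_inv (hxy : IsGeneric x y) : IsGeneric y⁻¹ x⁻¹ := by
  obtain ⟨hx, hy, hx₁, hy₁, hxy₁⟩ := hxy
  constructor <;> simp only [PowerSeries.constantCoeff_inv, ne_eq, inv_eq_zero, inv_eq_one,
    ← mul_inv_rev]
  exacts [hy, hx, hy₁, hx₁, hxy₁]

theorem mirror (hxy : IsGeneric x y) (hz : constantCoeff z = 1) :
    IsGeneric y (z * (x⁻¹ * y⁻¹)) := by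
  obtain ⟨hx, hy, hx₁, hy₁, hxy₁⟩ := hxy
  constructor <;> simp only [map_mul, hz, one_mul, PowerSeries.constantCoeff_inv, ne_eq,
    inv_eq_zero, mul_eq_zero, not_or]
  · exact hy
  · exact ⟨hx, hy⟩
  · exact hy₁
  · rwa [mul_comm, ← mul_inv_rev, inv_eq_one]
  · rwa [mul_comm, mul_assoc, inv_mul_cancel₀ hy, mul_one, inv_eq_one]

end IsGeneric

/-- Divisibility of an entry of the defect by `h ^ m` at all generic spectral parameters; `h` is
the variable of the power series. -/
def DefectDvd (X : LieType) (n : ℕ) (t : (PowerSeries k)ˣ) (m : ℕ)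
    (a b : Fin 3 → Fin (dim X n)) : Prop :=
  ∀ x y, IsGeneric x y → PowerSeries.X ^ m ∣ spectralDefect X n t x y a b

theorem isUnit_sub_one_sq {x : PowerSeries k} (hx : constantCoeff x ≠ 1) :
    IsUnit ((x - 1) ^ 2) := by
  rw [PowerSeries.isUnit_iff_constantCoeff]
  simpa [sub_eq_zero] using hx

variable (X : LieType) (n : ℕ)

theorem defectDvd_of_fractionRing {t : (PowerSeries k)ˣ} {m : ℕ} {a b c d e f : Fin (dim X n)}
    (h : ∀ x y : FractionRing (PowerSeries k), ∀ t : (FractionRing (PowerSeries k))ˣ,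
      let r := rMatrixData X n t
      ybLeft (r.R x) (r.R (x * y)) (r.R y) a b c d e f =
        ybRight (r.R x) (r.R (x * y)) (r.R y) a b c d e f) :
    DefectDvd X n t m ![a, b, c] ![d, e, f] := by
  intro x y _
  rw [spectralDefect, ybDefect_apply, ybLeft_eq_ybRight_of_fractionRing X n x y t h, sub_self]
  exact dvd_zero _

theorem isMatched_of_spectralDefect_ne_zero {S : Type*} [CommRing S] {t : Sˣ} {x y : S}
    {a b c d e f : Fin (dim X n)} (h : spectralDefect X n t x y ![a, b, c] ![d, e, f] ≠ 0) :
    IsMatched a b c d e f := by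
  have paired {z : S} {a b c e : Fin (dim X n)} (h : Rplus X n z t (a, b) (c, e) ≠ 0) :
      IsPaired a b c e := not_imp_comm.mp (Rplus_apply_eq_zero X n z t) h
  contrapose! h
  rw [spectralDefect, ybDefect_apply, ybLeft, ybRight, sub_eq_zero]
  trans 0
  · refine Finset.sum_eq_zero fun k _ => Finset.sum_eq_zero fun l _ =>
      Finset.sum_eq_zero fun m _ => not_imp_comm.mp (fun hne => ?_) h
    exact isMatched_of_isPaired_left (paired (left_ne_zero_of_mul (left_ne_zero_of_mul hne)))
      (paired (right_ne_zero_of_mul (left_ne_zero_of_mul hne))) (paired (right_ne_zero_of_mul hne))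
  · refine (Finset.sum_eq_zero fun k _ => Finset.sum_eq_zero fun l _ =>
      Finset.sum_eq_zero fun m _ => not_imp_comm.mp (fun hne => ?_) h).symm
    exact isMatched_of_isPaired_right (paired (left_ne_zero_of_mul (left_ne_zero_of_mul hne)))
      (paired (right_ne_zero_of_mul (left_ne_zero_of_mul hne))) (paired (right_ne_zero_of_mul hne))

variable {t : (PowerSeries k)ˣ} (ht : constantCoeff (t : PowerSeries k) = 1)

include ht

theorem map_constantCoeff_eq_one :
    Units.map ((constantCoeff : PowerSeries k →+* k) : PowerSeries k →* k) t = 1 :=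
  Units.ext ht

theorem constantCoeff_xi :
    constantCoeff ((xi X n t : (PowerSeries k)ˣ) : PowerSeries k) = 1 := by
  rw [← coe_xi_map, map_constantCoeff_eq_one ht, xi, qOf, one_pow, one_zpow, Units.val_one]

theorem isScalarMod_legs {m : ℕ} (r s : Fin m) (x : PowerSeries k) :
    IsScalarMod PowerSeries.X (legs r s (Rplus X n x t)) ((x - 1) ^ 2) := by
  intro a b
  have hmap : (legs r s (Rplus X n x t)).map (constantCoeff : PowerSeries k →+* k) =
      (constantCoeff x - 1) ^ 2 • 1 := by
    rw [legs_map, Rplus_map, map_constantCoeff_eq_one ht, Rplus_one, legs_smul, legs_one]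
  have hentry := congrFun (congrFun hmap a) b
  rw [Matrix.map_apply] at hentry
  rw [PowerSeries.X_dvd_iff, Matrix.sub_apply, map_sub, hentry, Matrix.smul_apply,
    Matrix.smul_apply, Matrix.one_apply, Matrix.one_apply]
  split_ifs <;> simp

theorem defectDvd_of_mirror {m : ℕ} {a b c d e f : Fin (dim X n)}
    (h : DefectDvd X n t m ![b, c, d.rev] ![e, f, a.rev]) :
    DefectDvd X n t m ![a, b, c] ![d, e, f] := by
  intro x y hxy
  have hx := PowerSeries.mul_inv_cancel x hxy.left_ne_zero
  have hy := PowerSeries.mul_inv_cancel y hxy.right_ne_zero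
  have hmul : x * y * (x⁻¹ * y⁻¹) = 1 := by rw [mul_mul_mul_comm, hx, hy, one_mul]
  have hparam : y * ((xi X n t : (PowerSeries k)ˣ) * (x⁻¹ * y⁻¹)) =
      (xi X n t : (PowerSeries k)ˣ) * x⁻¹ := by linear_combination (xi X n t * x⁻¹) * hy
  have hmirror := h _ _ (hxy.mirror (constantCoeff_xi X n ht))
  rw [spectralDefect, hparam] at hmirror
  rw [← (isUnit_wt X n t d.rev a.rev).dvd_mul_left, spectralDefect,
    mul_ybDefect_of_isCrossingPair (wt_mul_wt X n t) (isCrossingPair_Rplus X n t hx)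
      (isCrossingPair_Rplus X n t hmul), permute, Matrix.submatrix_apply, triple_comp_swap_zero_two,
    triple_comp_swap_zero_two]
  exact hmirror.mul_left _

variable {m : ℕ} (hm : ∀ a b, DefectDvd X n t m a b) {a b : Fin 3 → Fin (dim X n)}

include hm

theorem defectDvd_comp_swap_zero_one (h : DefectDvd X n t (m + 1) a b) :
    DefectDvd X n t (m + 1) (a ∘ Equiv.swap 0 1) (b ∘ Equiv.swap 0 1) := by
  intro x y hxy
  have hscalar := isScalarMod_legs X n ht (m := 3) 0 1 x⁻¹
  have hunit := isUnit_sub_one_sq hxy.inv_mul.left_ne_one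
  have hx := PowerSeries.mul_inv_cancel x hxy.left_ne_zero
  have hy : x⁻¹ * (x * y) = y := by rw [← mul_assoc, mul_comm x⁻¹, hx, one_mul]
  refine hscalar.pow_dvd_of_pow_dvd_mul_mul hscalar hunit hunit
    (Y := permute (Equiv.swap 0 1) (spectralDefect X n t x y)) (fun _ _ => hm _ _ x y hxy)
    (i := a) (j := b) ?_
  rw [spectralDefect, (isUnitaryPair_Rplus X n t hx).mul_permute_ybDefect_mul]
  have h' := h _ _ hxy.inv_mul
  rw [spectralDefect, hy] at h'
  exact h'.mul_left _

theorem defectDvd_comp_swap_zero_two (h : DefectDvd X n t (m + 1) a b) :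
    DefectDvd X n t (m + 1) (a ∘ Equiv.swap 0 2) (b ∘ Equiv.swap 0 2) := by
  intro x y hxy
  have hx := PowerSeries.mul_inv_cancel x hxy.left_ne_zero
  have hy := PowerSeries.mul_inv_cancel y hxy.right_ne_zero
  have hmul : x * y * (y⁻¹ * x⁻¹) = 1 := by rw [mul_assoc, ← mul_assoc y, hy, one_mul, hx]
  have hux := isUnit_sub_one_sq hxy.inv_inv.right_ne_one
  have huy := isUnit_sub_one_sq hxy.inv_inv.left_ne_one
  have huxy := isUnit_sub_one_sq (x := y⁻¹ * x⁻¹) (by rw [map_mul]; exact hxy.inv_inv.mul_ne_one)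
  have hscalar (r s : Fin 3) (z : PowerSeries k) := isScalarMod_legs X n ht r s z
  refine IsScalarMod.pow_dvd_of_pow_dvd_mul_mul
    (((hscalar 0 1 y⁻¹).mul (hscalar 0 2 (y⁻¹ * x⁻¹))).mul (hscalar 1 2 x⁻¹))
    (((hscalar 1 2 x⁻¹).mul (hscalar 0 2 (y⁻¹ * x⁻¹))).mul (hscalar 0 1 y⁻¹))
    ((huy.mul huxy).mul hux) ((hux.mul huxy).mul huy)
    (Y := permute (Equiv.swap 0 2) (spectralDefect X n t x y)) (fun _ _ => hm _ _ x y hxy)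
    (i := a) (j := b) ?_
  rw [spectralDefect, mul_permute_swap_ybDefect_mul (isUnitaryPair_Rplus X n t hx)
    (isUnitaryPair_Rplus X n t hmul) (isUnitaryPair_Rplus X n t hy)]
  exact (h _ _ hxy.inv_inv).mul_left _

theorem entrySet_defectDvd : EntrySet fun a b c d e f : Fin (dim X n) =>
    DefectDvd X n t (m + 1) ![a, b, c] ![d, e, f] where
  swap12 h := by
    simpa only [triple_comp_swap_zero_one] using defectDvd_comp_swap_zero_one X n ht hm h
  swap13 h := by
    simpa only [triple_comp_swap_zero_two] using defectDvd_comp_swap_zero_two X n ht hm h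
  flip h := defectDvd_of_mirror X n ht <| by
    simpa only [Fin.rev_rev, triple_comp_swap_zero_one, triple_comp_swap_zero_two] using
      defectDvd_comp_swap_zero_one X n ht hm (defectDvd_comp_swap_zero_two X n ht hm h)
  no_pair hde hdf hef := defectDvd_of_fractionRing X n fun x y t =>
    (rMatrixData X n t).ybLeft_eq_ybRight_of_no_pair x y hde hdf hef _ _ _
  flip_fix_flip hba hba' := defectDvd_of_fractionRing X n fun x y t =>
    (rMatrixData X n t).ybLeft_eq_ybRight_flip_fix_flip x y hba hba'
  flip_rotate hba hba' := defectDvd_of_fractionRing X n fun x y t =>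
    (rMatrixData X n t).ybLeft_eq_ybRight_flip_rotate x y hba hba'
  flip_fix_flip_self hb := defectDvd_of_fractionRing X n fun x y t =>
    (rMatrixData X n t).ybLeft_eq_ybRight_flip_fix_flip_self x y hb
  middle hi := defectDvd_of_fractionRing X n fun x y t => by
    intro r
    rw [RMatrixData.ybRight_eq_ybLeft_rev, ← hi]

theorem defectDvd_succ (a b : Fin 3 → Fin (dim X n)) : DefectDvd X n t (m + 1) a b := by
  have triple (a : Fin 3 → Fin (dim X n)) : a = ![a 0, a 1, a 2] := by
    funext i
    fin_cases i <;> rfl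
  rw [triple a, triple b]
  intro x y hxy
  by_cases h : spectralDefect X n t x y ![a 0, a 1, a 2] ![b 0, b 1, b 2] = 0
  · rw [h]
    exact dvd_zero _
  · exact (entrySet_defectDvd X n ht hm).of_isMatched
      (isMatched_of_spectralDefect_ne_zero X n h) x y hxy

omit hm

theorem defectDvd (m : ℕ) (a b : Fin 3 → Fin (dim X n)) : DefectDvd X n t m a b := by
  induction m generalizing a b with
  | zero => exact fun x y _ => by rw [pow_zero]; exact one_dvd _
  | succ m ih => exact defectDvd_succ X n ht ih a b

theorem spectralDefect_eq_zero {x y : PowerSeries k} (hxy : IsGeneric x y) :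
    spectralDefect X n t x y = 0 := by
  ext a b m
  exact PowerSeries.X_pow_dvd_iff.mp (defectDvd X n ht (m + 1) a b x y hxy) m m.lt_succ_self

end SpectralDefect

open Finset.HasAntidiagonal (antidiagonal mem_antidiagonal)

section Antidiagonal

variable {M : Type*} [AddCommMonoid M]

theorem sum_antidiagonal_comm_middle (k : ℕ) (F : ℕ → ℕ → ℕ → ℕ → M) :
    ∑ p ∈ antidiagonal k, ∑ r ∈ antidiagonal p.1, ∑ i ∈ antidiagonal p.2, F r.1 r.2 i.1 i.2 =
      ∑ p ∈ antidiagonal k, ∑ r ∈ antidiagonal p.1, ∑ i ∈ antidiagonal p.2,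
        F r.1 i.1 r.2 i.2 := by
  let exchange : ((_ : ℕ × ℕ) × (ℕ × ℕ) × (ℕ × ℕ)) → ((_ : ℕ × ℕ) × (ℕ × ℕ) × (ℕ × ℕ)) :=
    fun ⟨_, (r, s), (i, j)⟩ => ⟨(r + i, s + j), (r, i), (s, j)⟩
  simp only [← Finset.sum_product', Finset.sum_sigma']
  refine Finset.sum_nbij' exchange exchange ?_ ?_ ?_ ?_ fun _ _ => rfl <;>
  · rintro ⟨⟨p, q⟩, ⟨r, s⟩, ⟨i, j⟩⟩ h
    simp only [exchange, Finset.mem_sigma, Finset.mem_product, mem_antidiagonal] at h ⊢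
    grind

theorem sum_antidiagonal_assoc (k : ℕ) (F : ℕ → ℕ → ℕ → M) :
    ∑ p ∈ antidiagonal k, ∑ r ∈ antidiagonal p.2, F p.1 r.1 r.2 =
      ∑ p ∈ antidiagonal k, ∑ r ∈ antidiagonal p.1, F r.1 r.2 p.2 := by
  simp only [Finset.sum_sigma']
  refine Finset.sum_nbij' (fun ⟨(p, _), (r, s)⟩ => ⟨(p + r, s), (p, r)⟩)
    (fun ⟨(_, q), (r, s)⟩ => ⟨(r, s + q), (s, q)⟩) ?_ ?_ ?_ ?_ fun _ _ => rfl <;>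
  · rintro ⟨⟨p, q⟩, ⟨r, s⟩⟩ h
    simp only [Finset.mem_sigma, mem_antidiagonal] at h ⊢
    grind

theorem sum_antidiagonal_eq_of_fst_eq_zero {k : ℕ} {F : ℕ × ℕ → M}
    (hF : ∀ p, p.1 ≠ 0 → F p = 0) : ∑ p ∈ antidiagonal k, F p = F (0, k) :=
  Finset.sum_eq_single (0, k) (fun p hp h => hF p fun h0 => h <| Prod.ext h0 <| by
      simpa only [h0, zero_add] using mem_antidiagonal.mp hp)
    fun h => absurd (mem_antidiagonal.mpr (zero_add k)) h

end Antidiagonal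

section LaurentSeries

variable {A : Type*} [CommRing A]

theorem exists_coeff_eq_zero_of_lt (f : LaurentSeries A) : ∃ a : ℤ, ∀ p < a, f.coeff p = 0 :=
  ⟨f.order, fun _ hp => HahnSeries.coeff_eq_zero_of_lt_order hp⟩

theorem coeff_mul_eq_sum {f g : LaurentSeries A} {a b : ℤ} (hf : ∀ p < a, f.coeff p = 0)
    (hg : ∀ p < b, g.coeff p = 0) (m : ℤ) :
    (f * g).coeff m = ∑ p ∈ Finset.Icc a (m - b), f.coeff p * g.coeff (m - p) := by
  rw [HahnSeries.coeff_mul]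
  apply Finset.sum_of_injOn Prod.fst
  · rintro ⟨i, j⟩ hij ⟨i', j'⟩ hij' h
    simp only [Finset.mem_coe, Finset.mem_antidiagonal] at hij hij' h
    rw [Prod.mk.injEq]
    omega
  · rintro ⟨i, j⟩ hij
    simp only [Finset.mem_coe, Finset.mem_antidiagonal, HahnSeries.mem_support] at hij
    have hi : a ≤ i := not_lt.mp fun h => hij.1 (hf i h)
    have hj : b ≤ j := not_lt.mp fun h => hij.2.1 (hg j h)
    simp only [Finset.coe_Icc, Set.mem_Icc]
    omega
  · intro i _ hi
    by_contra h
    refine hi ⟨(i, m - i), ?_, rfl⟩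
    simp only [Finset.mem_coe, Finset.mem_antidiagonal, HahnSeries.mem_support]
    exact ⟨left_ne_zero_of_mul h, right_ne_zero_of_mul h, by ring⟩
  · rintro ⟨i, j⟩ hij
    simp only [Finset.mem_antidiagonal] at hij
    rw [← hij.2.2, add_sub_cancel_left]

theorem coeff_hasseDeriv_mul_hasseDeriv {f g : LaurentSeries A} {a b : ℤ}
    (hf : ∀ p < a, f.coeff p = 0) (hg : ∀ p < b, g.coeff p = 0) (i j : ℕ) (m : ℤ) :
    (LaurentSeries.hasseDeriv A i f * LaurentSeries.hasseDeriv A j g).coeff m =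
      ∑ p ∈ Finset.Icc a (m + (i + j : ℕ) - b),
        (Ring.choose p i * Ring.choose (m + (i + j : ℕ) - p) j) •
          (f.coeff p * g.coeff (m + (i + j : ℕ) - p)) := by
  rw [coeff_mul_eq_sum (a := a - i) (b := b - j)]
  · refine Finset.sum_nbij' (fun p => p + i) (fun p => p - i) ?_ ?_ ?_ ?_ ?_
    · intro p hp
      rw [Finset.mem_Icc] at hp ⊢
      omega
    · intro p hp
      rw [Finset.mem_Icc] at hp ⊢
      omega
    · exact fun p _ => add_sub_cancel_right p (i : ℤ)
    · exact fun p _ => sub_add_cancel p (i : ℤ)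
    · intro p _
      have hp : m - p + j = m + (i + j : ℕ) - (p + i) := by
        push_cast
        ring
      rw [LaurentSeries.hasseDeriv_coeff, LaurentSeries.hasseDeriv_coeff, smul_mul_smul_comm, hp]
  · intro p hp
    rw [LaurentSeries.hasseDeriv_coeff, hf _ (by omega), smul_zero]
  · intro p hp
    rw [LaurentSeries.hasseDeriv_coeff, hg _ (by omega), smul_zero]

theorem hasseDeriv_mul (k : ℕ) (f g : LaurentSeries A) :
    LaurentSeries.hasseDeriv A k (f * g) = ∑ p ∈ antidiagonal k,
      LaurentSeries.hasseDeriv A p.1 f * LaurentSeries.hasseDeriv A p.2 g := by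
  obtain ⟨a, hf⟩ := exists_coeff_eq_zero_of_lt f
  obtain ⟨b, hg⟩ := exists_coeff_eq_zero_of_lt g
  ext m
  have hsummand : ∀ p ∈ antidiagonal k,
      (LaurentSeries.hasseDeriv A p.1 f * LaurentSeries.hasseDeriv A p.2 g).coeff m =
        ∑ i ∈ Finset.Icc a (m + k - b), (Ring.choose i p.1 * Ring.choose (m + k - i) p.2) •
          (f.coeff i * g.coeff (m + k - i)) := by
    rintro ⟨i, j⟩ hij
    rw [← mem_antidiagonal.mp hij]
    exact coeff_hasseDeriv_mul_hasseDeriv hf hg i j m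
  rw [HahnSeries.coeff_sum, Finset.sum_congr rfl hsummand, Finset.sum_comm,
    LaurentSeries.hasseDeriv_coeff, coeff_mul_eq_sum hf hg, Finset.smul_sum]
  refine Finset.sum_congr rfl fun i _ => ?_
  rw [← Finset.sum_smul, ← Ring.add_choose_eq k (Commute.all _ _), add_sub_cancel]

theorem hasseDeriv_C (k : ℕ) (z : A) :
    LaurentSeries.hasseDeriv A k (HahnSeries.C z : LaurentSeries A) =
      if k = 0 then HahnSeries.C z else 0 := by
  rw [HahnSeries.C_apply, LaurentSeries.hasseDeriv_single]
  rcases k with _ | k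
  · simp
  · rw [Ring.choose_zero_succ, zero_smul, HahnSeries.single_eq_zero, if_neg k.succ_ne_zero]

end LaurentSeries

section Shift

theorem coeff_shiftH (c : ℂ) (a : Luh) (k : ℕ) : PowerSeries.coeff k (shiftH c a) =
    ∑ p ∈ antidiagonal k, c ^ p.1 • LaurentSeries.hasseDeriv ℂ p.1 (PowerSeries.coeff p.2 a) := by
  rw [shiftH, PowerSeries.coeff_mk]

theorem shiftH_map_C (c : ℂ) (s : PowerSeries ℂ) :
    shiftH c (PowerSeries.map (HahnSeries.C : ℂ →+* Lu) s) =
      PowerSeries.map (HahnSeries.C : ℂ →+* Lu) s := by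
  ext1 k
  rw [coeff_shiftH, sum_antidiagonal_eq_of_fst_eq_zero fun p hp => by
    rw [PowerSeries.coeff_map, hasseDeriv_C, if_neg hp, smul_zero]]
  rw [pow_zero, one_smul, LaurentSeries.hasseDeriv_zero, LinearMap.id_apply]

theorem shiftH_mul (c : ℂ) (a b : Luh) : shiftH c (a * b) = shiftH c a * shiftH c b := by
  ext1 k
  rw [coeff_shiftH, PowerSeries.coeff_mul]
  simp only [coeff_shiftH, Finset.sum_mul_sum]
  rw [← sum_antidiagonal_comm_middle k fun r s i j =>
    (c ^ r • LaurentSeries.hasseDeriv ℂ r (PowerSeries.coeff i a)) *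
      (c ^ s • LaurentSeries.hasseDeriv ℂ s (PowerSeries.coeff j b))]
  refine Finset.sum_congr rfl fun p _ => ?_
  rw [PowerSeries.coeff_mul, map_sum, Finset.smul_sum, Finset.sum_comm]
  refine Finset.sum_congr rfl fun i _ => ?_
  rw [hasseDeriv_mul, Finset.smul_sum]
  refine Finset.sum_congr rfl fun r hr => ?_
  simp only [← HahnSeries.C_mul_eq_smul]
  rw [mul_mul_mul_comm, ← map_mul, ← pow_add, mem_antidiagonal.mp hr]

/-- The substitution `u ↦ u + c h` as a ring endomorphism of `ℂ((u))[[h]]`. -/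
def shiftHom (c : ℂ) : Luh →+* Luh where
  toFun := shiftH c
  map_one' := by simpa only [map_one] using shiftH_map_C c 1
  map_mul' := shiftH_mul c
  map_zero' := by simpa only [map_zero] using shiftH_map_C c 0
  map_add' a b := by
    ext1 k
    simp only [coeff_shiftH, map_add, smul_add, Finset.sum_add_distrib]

theorem shiftHom_apply (c : ℂ) (a : Luh) : shiftHom c a = shiftH c a := rfl

theorem shiftH_shiftH (c d : ℂ) (a : Luh) : shiftH c (shiftH d a) = shiftH (c + d) a := by
  ext1 k
  simp only [coeff_shiftH, map_sum, Finset.smul_sum]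
  rw [sum_antidiagonal_assoc k fun p r l => c ^ p • LaurentSeries.hasseDeriv ℂ p
    (d ^ r • LaurentSeries.hasseDeriv ℂ r (PowerSeries.coeff l a))]
  refine Finset.sum_congr rfl fun p _ => ?_
  rw [(Commute.all c d).add_pow', Finset.sum_smul]
  refine Finset.sum_congr rfl fun r hr => ?_
  rw [LinearMap.map_smul, LaurentSeries.hasseDeriv_comp, mem_antidiagonal.mp hr, smul_smul,
    smul_comm, smul_assoc]

theorem shiftH_zero (a : Luh) : shiftH 0 a = a := by
  ext1 k
  rw [coeff_shiftH, sum_antidiagonal_eq_of_fst_eq_zero fun p hp => by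
    rw [zero_pow hp, zero_smul]]
  rw [pow_zero, one_smul, LaurentSeries.hasseDeriv_zero, LinearMap.id_apply]

theorem constantCoeff_shiftH (c : ℂ) (a : Luh) :
    PowerSeries.constantCoeff (shiftH c a) = PowerSeries.constantCoeff a := by
  rw [← PowerSeries.coeff_zero_eq_constantCoeff_apply, coeff_shiftH]
  simp

theorem shiftHom_X (c : ℂ) : shiftHom c PowerSeries.X = PowerSeries.X := by
  simpa only [PowerSeries.map_X, ← shiftHom_apply] using shiftH_map_C c PowerSeries.X

end Shift

section Substitution

/-- `f(u) ↦ f(u + v)` as a ring homomorphism `ℂ((u)) → ℂ((u))((v))`. -/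
def atUVHom : Lu →+* Luv :=
  (HahnSeries.ofPowerSeries ℤ Lu).comp
    { toFun := fun f => PowerSeries.mk fun m => LaurentSeries.hasseDeriv ℂ m f
      map_one' := by
        ext1 k
        rw [PowerSeries.coeff_mk, PowerSeries.coeff_one]
        exact hasseDeriv_C k 1
      map_mul' f g := by
        ext1 k
        simp only [PowerSeries.coeff_mul, PowerSeries.coeff_mk, hasseDeriv_mul]
      map_zero' := by
        ext1 k
        simp only [PowerSeries.coeff_mk, map_zero]
      map_add' f g := by
        ext1 k
        simp only [PowerSeries.coeff_mk, map_add] }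

theorem coe_atUVHom : ⇑atUVHom = atUV := rfl

/-- `f(u) ↦ f(v)` as a ring homomorphism `ℂ((u)) → ℂ((u))((v))`. -/
def atVHom : Lu →+* Luv where
  toFun := atV
  map_one' := by
    ext m : 2
    rw [atV, HahnSeries.map_coeff, HahnSeries.coeff_one, HahnSeries.coeff_one]
    split_ifs
    exacts [map_one _, map_zero _]
  map_mul' f g :=
    HahnSeries.map_mul ((HahnSeries.C : ℂ →+* Lu) : ℂ →ₙ+* Lu) (x := f) (y := g)
  map_zero' := by
    ext m
    simp only [atV, HahnSeries.map_coeff, HahnSeries.coeff_zero, map_zero]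
  map_add' f g := by
    ext m
    simp only [atV, HahnSeries.map_coeff, HahnSeries.coeff_add, map_add]

/-- `u ↦ -u` as a ring endomorphism of `ℂ((u))`. -/
def negUHom : Lu →+* Lu where
  toFun := negU
  map_one' := by
    ext m
    simp only [negU, HahnSeries.coeff_one]
    split_ifs with h <;> simp [h]
  map_mul' f g := by
    obtain ⟨a, hf⟩ := exists_coeff_eq_zero_of_lt f
    obtain ⟨b, hg⟩ := exists_coeff_eq_zero_of_lt g
    ext m
    rw [coeff_mul_eq_sum (f := negU f) (g := negU g)
      (fun p hp => mul_eq_zero_of_right _ (hf p hp)) (fun p hp => mul_eq_zero_of_right _ (hg p hp))]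
    simp only [negU, coeff_mul_eq_sum hf hg, Finset.mul_sum]
    refine Finset.sum_congr rfl fun i _ => ?_
    rw [mul_mul_mul_comm, ← zpow_add₀ (neg_ne_zero.mpr one_ne_zero), add_sub_cancel]
  map_zero' := by
    ext m
    exact mul_zero _
  map_add' f g := by
    ext m
    exact mul_add _ _ _

theorem coe_negUHom : ⇑negUHom = negU := rfl

theorem mapCoeff_eq_map {A B : Type*} [Semiring A] [Semiring B] (φ : A →+* B)
    (a : PowerSeries A) : mapCoeff φ a = PowerSeries.map φ a := by
  ext1 k
  rw [mapCoeff, PowerSeries.coeff_mk, PowerSeries.coeff_map]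

theorem negUHom_smul (z : ℂ) (f : Lu) : negUHom (z • f) = z • negUHom f := by
  ext m
  exact mul_left_comm _ _ _

theorem negUHom_hasseDeriv (k : ℕ) (f : Lu) :
    negUHom (LaurentSeries.hasseDeriv ℂ k f) =
      (-1 : ℂ) ^ k • LaurentSeries.hasseDeriv ℂ k (negUHom f) := by
  ext m
  have hsign : (-1 : ℂ) ^ k * (-1) ^ (m + k) = (-1) ^ m := by
    rw [zpow_add₀ (neg_ne_zero.mpr one_ne_zero), zpow_natCast, mul_left_comm, ← mul_pow,
      neg_one_mul, neg_neg, one_pow, mul_one]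
  simp only [coe_negUHom, negU, LaurentSeries.hasseDeriv_coeff, HahnSeries.coeff_smul, smul_eq_mul,
    zsmul_eq_mul, ← hsign]
  ring

theorem map_negUHom_shiftH (c : ℂ) (a : Luh) :
    PowerSeries.map negUHom (shiftH c a) = shiftH (-c) (PowerSeries.map negUHom a) := by
  ext1 k
  simp only [PowerSeries.coeff_map, coeff_shiftH, map_sum]
  refine Finset.sum_congr rfl fun p _ => ?_
  rw [negUHom_smul, negUHom_hasseDeriv, smul_smul, neg_pow c, mul_comm]

end Substitution

section Exponential

theorem expH_add (a b : ℂ) : expH (a + b) = expH a * expH b := by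
  rw [expH, expH, expH, ← map_mul, PowerSeries.exp_mul_exp_eq_exp_add]

theorem expH_zero : expH 0 = 1 := by
  rw [expH, PowerSeries.rescale_zero]
  simp

theorem coeff_expH (c : ℂ) (k : ℕ) :
    PowerSeries.coeff k (expH c) = HahnSeries.C (c ^ k * (k.factorial : ℂ)⁻¹) := by
  rw [expH, PowerSeries.coeff_map, PowerSeries.coeff_rescale, PowerSeries.coeff_exp]
  simp

theorem constantCoeff_expH (c : ℂ) : PowerSeries.constantCoeff (expH c) = 1 := by
  rw [← PowerSeries.coeff_zero_eq_constantCoeff_apply, coeff_expH]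
  simp

theorem shiftH_expH (c d : ℂ) : shiftH c (expH d) = expH d :=
  shiftH_map_C c _

theorem coeff_expNegU (m : ℤ) : expNegU.coeff m =
    if m < 0 then 0 else (-1) ^ m.natAbs * (m.natAbs.factorial : ℂ)⁻¹ := by
  rw [expNegU, PowerSeries.coeff_coe, PowerSeries.coeff_rescale, PowerSeries.coeff_exp]
  simp

theorem hasseDeriv_one_expNegU : LaurentSeries.hasseDeriv ℂ 1 expNegU = -expNegU := by
  ext m
  rw [LaurentSeries.hasseDeriv_coeff, HahnSeries.coeff_neg, coeff_expNegU, coeff_expNegU,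
    Ring.choose_one_right]
  rcases lt_trichotomy m (-1) with hm | rfl | hm
  · rw [if_pos (by omega), if_pos (by omega), smul_zero, neg_zero]
  · simp
  · obtain ⟨k, rfl⟩ := Int.eq_ofNat_of_zero_le (show 0 ≤ m by omega)
    have hnatAbs : ((k : ℤ) + (1 : ℕ)).natAbs = k + 1 := by omega
    rw [if_neg (by omega), if_neg (by omega), hnatAbs, Int.natAbs_natCast, Nat.factorial_succ,
      zsmul_eq_mul]
    have hfactorial : (k.factorial : ℂ) ≠ 0 := Nat.cast_ne_zero.mpr k.factorial_ne_zero
    have hsucc : (k : ℂ) + 1 ≠ 0 := Nat.cast_add_one_ne_zero k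
    push_cast
    field_simp
    ring

theorem hasseDeriv_expNegU (k : ℕ) : LaurentSeries.hasseDeriv ℂ k expNegU =
    ((-1) ^ k * (k.factorial : ℂ)⁻¹) • expNegU := by
  induction k with
  | zero => simp
  | succ k ih =>
    have hsucc : ((k + 1 : ℕ) : ℂ) ≠ 0 := Nat.cast_ne_zero.mpr k.succ_ne_zero
    have hcomp := LaurentSeries.hasseDeriv_comp (R := ℂ) 1 k expNegU
    rw [ih, LinearMap.map_smul, hasseDeriv_one_expNegU, Nat.choose_one_right, add_comm 1 k,
      ← Nat.cast_smul_eq_nsmul ℂ, eq_comm, ← eq_inv_smul_iff₀ hsucc] at hcomp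
    rw [hcomp, smul_neg, ← neg_smul, smul_smul, Nat.factorial_succ, pow_succ, Nat.cast_mul, mul_inv]
    congr 1
    ring

theorem shiftH_expNegU (c : ℂ) : shiftH c expNegU' = expNegU' * expH (-c) := by
  ext1 k
  have hvanish : ∀ p : ℕ × ℕ, p.1 ≠ 0 →
      c ^ p.2 • LaurentSeries.hasseDeriv ℂ p.2 (PowerSeries.coeff p.1 expNegU') = 0 :=
    fun p hp => by rw [expNegU', PowerSeries.coeff_C, if_neg hp, map_zero, smul_zero]
  rw [coeff_shiftH, ← Finset.Nat.sum_antidiagonal_swap]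
  simp only [Prod.fst_swap, Prod.snd_swap]
  rw [sum_antidiagonal_eq_of_fst_eq_zero hvanish, expNegU', PowerSeries.coeff_C_mul, coeff_expH,
    PowerSeries.coeff_zero_C, hasseDeriv_expNegU, mul_comm expNegU, HahnSeries.C_mul_eq_smul,
    smul_smul, neg_pow]
  congr 1
  ring

theorem expNegU_ne_zero : expNegU ≠ 0 := by
  intro h
  have hcoeff := coeff_expNegU 0
  simp [h] at hcoeff

theorem expNegU_ne_one : expNegU ≠ 1 := by
  intro h
  have hcoeff := coeff_expNegU 1
  simp [h, HahnSeries.coeff_one] at hcoeff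

theorem one_sub_expNegU_ne_zero : 1 - expNegU ≠ 0 :=
  sub_ne_zero.mpr expNegU_ne_one.symm

theorem negUHom_expNegU : negUHom expNegU =
    HahnSeries.ofPowerSeries ℤ ℂ (PowerSeries.rescale 1 (PowerSeries.exp ℂ)) := by
  ext m
  rw [PowerSeries.coeff_coe, PowerSeries.coeff_rescale, PowerSeries.coeff_exp]
  simp only [coe_negUHom, negU, coeff_expNegU]
  split_ifs with hm
  · exact mul_zero _
  · obtain ⟨k, rfl⟩ := Int.eq_ofNat_of_zero_le (not_lt.mp hm)
    rw [Int.natAbs_natCast, zpow_natCast, ← mul_assoc, ← mul_pow]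
    simp

theorem negUHom_expNegU_mul : negUHom expNegU * expNegU = 1 := by
  rw [negUHom_expNegU, expNegU, ← map_mul, PowerSeries.exp_mul_exp_eq_exp_add, add_neg_cancel,
    PowerSeries.rescale_zero]
  simp

theorem map_expH {A : Type*} [CommRing A] (φ : Lu →+* A) (c : ℂ) :
    PowerSeries.map φ (expH c) =
      PowerSeries.map (φ.comp HahnSeries.C) (PowerSeries.rescale c (PowerSeries.exp ℂ)) := by
  rw [expH, PowerSeries.map_comp, RingHom.comp_apply]

theorem negUHom_comp_C : negUHom.comp HahnSeries.C = (HahnSeries.C : ℂ →+* Lu) := by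
  ext z m
  simp only [RingHom.comp_apply, coe_negUHom, negU, HahnSeries.C_apply, HahnSeries.coeff_single]
  split_ifs with h <;> simp [h]

theorem map_negUHom_expH (c : ℂ) : PowerSeries.map negUHom (expH c) = expH c := by
  rw [map_expH, negUHom_comp_C, expH]

theorem expNegU_mul_map_negUHom :
    expNegU' * PowerSeries.map negUHom expNegU' = 1 := by
  rw [expNegU', PowerSeries.map_C, ← map_mul, mul_comm, negUHom_expNegU_mul, map_one]

theorem atVHom_comp_C :
    atVHom.comp HahnSeries.C = (HahnSeries.C : Lu →+* Luv).comp (HahnSeries.C : ℂ →+* Lu) :=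
  RingHom.ext fun z => HahnSeries.map_C z (HahnSeries.C : ℂ →+* Lu)

theorem atUVHom_comp_C :
    atUVHom.comp HahnSeries.C = (HahnSeries.C : Lu →+* Luv).comp (HahnSeries.C : ℂ →+* Lu) := by
  ext1 z
  rw [RingHom.comp_apply, RingHom.comp_apply, coe_atUVHom, atUV,
    ← HahnSeries.ofPowerSeries_C (HahnSeries.C z : Lu)]
  refine congrArg (HahnSeries.ofPowerSeries ℤ Lu) (PowerSeries.ext fun k => ?_)
  rw [PowerSeries.coeff_mk, hasseDeriv_C, PowerSeries.coeff_C]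

theorem atUV_expNegU : atUV expNegU = atU expNegU * atV expNegU := by
  ext m : 2
  rw [atU, HahnSeries.C_mul_eq_smul, HahnSeries.coeff_smul, atV, HahnSeries.map_coeff, atUV,
    PowerSeries.coeff_coe, coeff_expNegU]
  split_ifs
  · rw [map_zero, smul_zero]
  · rw [PowerSeries.coeff_mk, hasseDeriv_expNegU, smul_eq_mul, mul_comm expNegU,
      HahnSeries.C_mul_eq_smul]

theorem expQuarter_zpow (m : ℤ) : ((expQuarter ^ m : Luhˣ) : Luh) = expH (m / 4) := by
  have hval : (expQuarter : Luh) = expH (1 / 4) := rfl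
  have hinv : ((expQuarter⁻¹ : Luhˣ) : Luh) = expH (-(1 / 4)) := rfl
  induction m using Int.induction_on with
  | zero => rw [zpow_zero, Units.val_one, Int.cast_zero, zero_div, expH_zero]
  | succ k ih =>
    rw [zpow_add_one, Units.val_mul, ih, hval, ← expH_add]
    congr 1
    push_cast
    ring
  | pred k ih =>
    rw [zpow_sub_one, Units.val_mul, ih, hinv, ← expH_add]
    congr 1
    push_cast
    ring

theorem qOf_expQuarter_inv_sq : (((qOf expQuarter)⁻¹ : Luhˣ) : Luh) ^ 2 = expH (-1) := by
  have hpow : ((qOf expQuarter)⁻¹ : Luhˣ) ^ 2 = expQuarter ^ (-4 : ℤ) := by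
    rw [qOf, ← zpow_natCast, ← zpow_natCast, ← zpow_neg, ← zpow_mul]
    norm_num
  rw [← Units.val_pow_eq_pow_val, hpow, expQuarter_zpow]
  norm_num

theorem xi_expQuarter (X : LieType) (n : ℕ) :
    ((xi X n expQuarter : Luhˣ) : Luh) = expH (-kappa X n) := by
  rw [xi, qOf, ← zpow_natCast, ← zpow_mul, expQuarter_zpow]
  congr 1
  cases X <;> simp only [xiExp, kappa] <;> push_cast <;> ring

end Exponential

section ShiftedSquare

variable {k : Type*} [Field k]

theorem eq_of_forall_X_pow_dvd_sub {a b : PowerSeries k}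
    (h : ∀ m, (PowerSeries.X : PowerSeries k) ^ m ∣ a - b) : a = b := by
  rw [← sub_eq_zero]
  ext m
  exact PowerSeries.X_pow_dvd_iff.mp (h (m + 1)) m m.lt_succ_self

theorem exists_forall_X_pow_dvd_sub {s : ℕ → PowerSeries k}
    (hs : ∀ m, (PowerSeries.X : PowerSeries k) ^ (m + 1) ∣ s (m + 1) - s m) :
    ∃ a, ∀ m, (PowerSeries.X : PowerSeries k) ^ (m + 1) ∣ a - s m := by
  have hstable (i j : ℕ) : PowerSeries.coeff i (s (i + j)) = PowerSeries.coeff i (s i) := by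
    induction j with
    | zero => rfl
    | succ j ih =>
      have hcoeff := PowerSeries.X_pow_dvd_iff.mp (hs (i + j)) i (by omega)
      rw [← ih, ← add_assoc, ← sub_eq_zero, ← map_sub, hcoeff]
  refine ⟨PowerSeries.mk fun i => PowerSeries.coeff i (s i), fun m => ?_⟩
  rw [PowerSeries.X_pow_dvd_iff]
  intro i hi
  obtain ⟨j, rfl⟩ := Nat.exists_eq_add_of_le (Nat.lt_succ_iff.mp hi)
  rw [map_sub, PowerSeries.coeff_mk, hstable, sub_self]

/-- An endomorphism of `k[[X]]`, such as the substitution `u ↦ u + c h` of `ℂ((u))[[h]]`, that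
fixes `X` and is the identity modulo `X`. It need not be `k`-linear. -/
structure IsInfinitesimal (σ : PowerSeries k →+* PowerSeries k) : Prop where
  map_X : σ PowerSeries.X = PowerSeries.X
  constantCoeff_apply (a : PowerSeries k) :
    PowerSeries.constantCoeff (σ a) = PowerSeries.constantCoeff a

/-- Successive approximations to a solution `g` of `g * σ g = F` with constant coefficient `z`,
by Newton's method with the constant derivative `2 z`. -/
def approx (σ : PowerSeries k →+* PowerSeries k) (F : PowerSeries k) (z : k) : ℕ → PowerSeries k
  | 0 => PowerSeries.C z
  | m + 1 => approx σ F z m +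
      PowerSeries.C (2 * z)⁻¹ * (F - approx σ F z m * σ (approx σ F z m))

namespace IsInfinitesimal

variable {σ : PowerSeries k →+* PowerSeries k} (hσ : IsInfinitesimal σ)

include hσ

theorem X_pow_dvd_apply {a : PowerSeries k} {m : ℕ} (h : (PowerSeries.X : PowerSeries k) ^ m ∣ a) :
    (PowerSeries.X : PowerSeries k) ^ m ∣ σ a := by
  simpa only [map_pow, hσ.map_X] using map_dvd σ h

theorem X_pow_succ_dvd_apply_sub {a : PowerSeries k} {m : ℕ}
    (h : (PowerSeries.X : PowerSeries k) ^ m ∣ a) :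
    (PowerSeries.X : PowerSeries k) ^ (m + 1) ∣ σ a - a := by
  obtain ⟨b, rfl⟩ := h
  rw [map_mul, map_pow, hσ.map_X, ← mul_sub, pow_succ]
  refine mul_dvd_mul_left _ ?_
  rw [PowerSeries.X_dvd_iff, map_sub, hσ.constantCoeff_apply, sub_self]

theorem eq_of_mul_apply_eq {g g' : PowerSeries k}
    (h0 : PowerSeries.constantCoeff g = PowerSeries.constantCoeff g')
    (hne : 2 * PowerSeries.constantCoeff g ≠ 0) (h : g * σ g = g' * σ g') : g = g' := by
  refine eq_of_forall_X_pow_dvd_sub fun m => ?_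
  induction m with
  | zero => exact (pow_zero (PowerSeries.X : PowerSeries k)).symm ▸ one_dvd _
  | succ m ih =>
    have hfactor : (g - g') * (σ g + g') = -(g' * (σ (g - g') - (g - g'))) := by
      rw [map_sub]
      linear_combination h
    have hunit : IsUnit (σ g + g') := by
      rw [PowerSeries.isUnit_iff_constantCoeff, map_add, hσ.constantCoeff_apply, ← h0, ← two_mul]
      exact hne.isUnit
    rw [← hunit.dvd_mul_right, hfactor]
    exact ((hσ.X_pow_succ_dvd_apply_sub ih).mul_left _).neg_right

variable {F : PowerSeries k} {z : k} (hF : PowerSeries.constantCoeff F = z ^ 2)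

include hF

theorem constantCoeff_approx (m : ℕ) : PowerSeries.constantCoeff (approx σ F z m) = z := by
  induction m with
  | zero => rw [approx, PowerSeries.constantCoeff_C]
  | succ m ih =>
    rw [approx, map_add, map_mul, map_sub, map_mul, hσ.constantCoeff_apply, ih, hF]
    ring

variable (hz : 2 * z ≠ 0)

include hz

theorem X_pow_dvd_sub_approx (m : ℕ) :
    (PowerSeries.X : PowerSeries k) ^ (m + 1) ∣ F - approx σ F z m * σ (approx σ F z m) := by
  induction m with
  | zero =>
    rw [zero_add, pow_one, PowerSeries.X_dvd_iff, map_sub, map_mul, hσ.constantCoeff_apply, hF,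
      hσ.constantCoeff_approx hF]
    ring
  | succ m ih =>
    have hconst := hσ.constantCoeff_approx hF m
    rw [approx]
    set G := approx σ F z m
    set r := F - G * σ G with hr
    set w : PowerSeries k := PowerSeries.C (2 * z)⁻¹
    have hw : w * PowerSeries.C (2 * z) = 1 := by
      rw [← map_mul, inv_mul_cancel₀ hz, map_one]
    have hdvd : (PowerSeries.X : PowerSeries k) ^ (m + 1) ∣ w * r := ih.mul_left w
    have herror : F - (G + w * r) * σ (G + w * r) =
        w * r * (PowerSeries.C (2 * z) - (σ G + G)) -
          G * (σ (w * r) - w * r) - w * r * σ (w * r) := by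
      rw [map_add]
      linear_combination (-r) * hw - hr
    rw [herror]
    refine dvd_sub (dvd_sub ?_ ((hσ.X_pow_succ_dvd_apply_sub hdvd).mul_left _)) ?_
    · rw [pow_succ]
      refine mul_dvd_mul hdvd ?_
      rw [PowerSeries.X_dvd_iff, map_sub, map_add, hσ.constantCoeff_apply, hconst,
        PowerSeries.constantCoeff_C]
      ring
    · rw [pow_succ]
      exact mul_dvd_mul hdvd ((dvd_pow_self _ m.succ_ne_zero).trans (hσ.X_pow_dvd_apply hdvd))

theorem exists_mul_apply_eq :
    ∃ g : PowerSeries k, PowerSeries.constantCoeff g = z ∧ g * σ g = F := by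
  obtain ⟨g, hg⟩ := exists_forall_X_pow_dvd_sub (s := approx σ F z) fun m => by
    rw [approx, add_sub_cancel_left]
    exact (hσ.X_pow_dvd_sub_approx hF hz m).mul_left _
  refine ⟨g, ?_, eq_of_forall_X_pow_dvd_sub fun m => (pow_dvd_pow _ m.le_succ).trans ?_⟩
  · have hconst := PowerSeries.X_dvd_iff.mp (pow_one (PowerSeries.X : PowerSeries k) ▸ hg 0)
    rwa [map_sub, hσ.constantCoeff_approx hF, sub_eq_zero] at hconst
  · have hsplit : g * σ g - F = (g - approx σ F z m) * σ g +
        approx σ F z m * σ (g - approx σ F z m) - (F - approx σ F z m * σ (approx σ F z m)) := by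
      rw [map_sub]
      ring
    rw [hsplit]
    exact dvd_sub (dvd_add ((hg m).mul_right _) ((hσ.X_pow_dvd_apply (hg m)).mul_left _))
      (hσ.X_pow_dvd_sub_approx hF hz m)

end IsInfinitesimal

end ShiftedSquare

section Normalization

theorem isInfinitesimal_shiftHom (c : ℂ) : IsInfinitesimal (shiftHom c) where
  map_X := shiftHom_X c
  constantCoeff_apply := constantCoeff_shiftH c

/-- The product whose inverse is the right-hand side of the normalization condition. -/
def normProd (κ : ℂ) : Luh :=
  (1 - expNegU' * expH (-1)) * (1 - expNegU' * expH 1) *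
    (1 - expNegU' * expH (-κ)) * (1 - expNegU' * expH κ)

theorem constantCoeff_normProd (κ : ℂ) :
    PowerSeries.constantCoeff (normProd κ) = (1 - expNegU) ^ 4 := by
  simp only [normProd, map_mul, map_sub, map_one, constantCoeff_expH, expNegU',
    PowerSeries.constantCoeff_C]
  ring

theorem constantCoeff_normProd_ne_zero (κ : ℂ) : PowerSeries.constantCoeff (normProd κ) ≠ 0 := by
  rw [constantCoeff_normProd]
  exact pow_ne_zero 4 one_sub_expNegU_ne_zero

theorem two_mul_ne_zero {z : Lu} (hz : z ≠ 0) : 2 * z ≠ 0 := by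
  rw [← map_ofNat (HahnSeries.C : ℂ →+* Lu) 2, HahnSeries.C_mul_eq_smul]
  exact smul_ne_zero two_ne_zero hz

theorem existsUnique_isNormalizing (κ : ℂ) : ∃! g : Luh, IsNormalizing κ g := by
  have hz : 2 * ((1 - expNegU) ^ 2)⁻¹ ≠ 0 :=
    two_mul_ne_zero (inv_ne_zero (pow_ne_zero 2 one_sub_expNegU_ne_zero))
  have hF : PowerSeries.constantCoeff (normProd κ)⁻¹ = ((1 - expNegU) ^ 2)⁻¹ ^ 2 := by
    rw [PowerSeries.constantCoeff_inv, constantCoeff_normProd, inv_pow, ← pow_mul]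
  obtain ⟨g, hg0, hg⟩ := (isInfinitesimal_shiftHom κ).exists_mul_apply_eq hF hz
  refine ⟨g, ⟨hg0, hg⟩, fun g' hg' => ?_⟩
  exact (isInfinitesimal_shiftHom κ).eq_of_mul_apply_eq (hg'.1.trans hg0.symm)
    (hg'.1.symm ▸ hz) (hg'.2.trans hg.symm)

end Normalization

section Unitarity

theorem map_negUHom_normProd_inv (κ : ℂ) :
    PowerSeries.map negUHom (normProd κ)⁻¹ = expNegU' ^ 4 * (normProd κ)⁻¹ := by
  have hinv := PowerSeries.mul_inv_cancel _ (constantCoeff_normProd_ne_zero κ)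
  have hmap : expNegU' ^ 4 * PowerSeries.map negUHom (normProd κ) = normProd κ := by
    have hx := expNegU_mul_map_negUHom
    have hpair (p p' : Luh) (h : p * p' = 1) :
        expNegU' ^ 2 * ((1 - PowerSeries.map negUHom expNegU' * p') *
          (1 - PowerSeries.map negUHom expNegU' * p)) =
        (1 - expNegU' * p') * (1 - expNegU' * p) := by
      linear_combination (expNegU' * PowerSeries.map negUHom expNegU' + 1 - expNegU' * (p + p')) *
        hx + ((expNegU' * PowerSeries.map negUHom expNegU') ^ 2 - expNegU' ^ 2) * h
    simp only [normProd, map_mul, map_sub, map_one, map_negUHom_expH]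
    rw [mul_assoc (_ * _) (1 - expNegU' * _), ← hpair _ _ (expH_mul_expH_neg 1),
      ← hpair _ _ (expH_mul_expH_neg κ)]
    ring
  have hinv' : PowerSeries.map negUHom (normProd κ) *
      PowerSeries.map negUHom (normProd κ)⁻¹ = 1 := by
    rw [← map_mul, hinv, map_one]
  linear_combination (-PowerSeries.map negUHom (normProd κ)⁻¹) * hinv -
    PowerSeries.map negUHom (normProd κ)⁻¹ * (normProd κ)⁻¹ * hmap +
    expNegU' ^ 4 * (normProd κ)⁻¹ * hinv'

theorem constantCoeff_mul_map_negUHom {κ : ℂ} {g : Luh} (hg : IsNormalizing κ g) :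
    PowerSeries.constantCoeff (g * PowerSeries.map negUHom g) =
      expNegU ^ 2 * ((1 - expNegU) ^ 4)⁻¹ := by
  have hne := one_sub_expNegU_ne_zero
  have hne' := expNegU_ne_zero
  have hneg : negUHom expNegU = expNegU⁻¹ := eq_inv_of_mul_eq_one_left negUHom_expNegU_mul
  have hmap : PowerSeries.constantCoeff (PowerSeries.map negUHom g) =
      negUHom (PowerSeries.constantCoeff g) := by
    rw [← PowerSeries.coeff_zero_eq_constantCoeff_apply, PowerSeries.coeff_map,
      PowerSeries.coeff_zero_eq_constantCoeff_apply]
  have hsub : (1 - expNegU⁻¹ : Lu) = -((1 - expNegU) * expNegU⁻¹) := by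
    rw [sub_mul, mul_inv_cancel₀ hne', one_mul, neg_sub]
  rw [map_mul, hmap, hg.1, map_inv₀, map_pow, map_sub, map_one, hneg, hsub]
  field_simp

theorem mul_map_negUHom {κ : ℂ} {g : Luh} (hg : IsNormalizing κ g) :
    g * PowerSeries.map negUHom g = expH (-κ) * expNegU' ^ 2 * (normProd κ)⁻¹ := by
  have hconst := constantCoeff_mul_map_negUHom hg
  have hK : g * shiftHom κ g = (normProd κ)⁻¹ := hg.2
  have hreflect : PowerSeries.map negUHom g * shiftHom κ (PowerSeries.map negUHom g) =
      shiftHom κ (PowerSeries.map negUHom (normProd κ)⁻¹) := by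
    rw [← hK, map_mul, map_mul, shiftHom_apply κ g, map_negUHom_shiftH,
      shiftHom_apply κ (shiftH _ _), shiftH_shiftH, add_neg_cancel, shiftH_zero, mul_comm]
  have hx : shiftHom κ expNegU' = expNegU' * expH (-κ) := shiftH_expNegU κ
  have hξ : shiftHom κ (expH (-κ)) = expH (-κ) := shiftH_expH κ (-κ)
  refine (isInfinitesimal_shiftHom κ).eq_of_mul_apply_eq ?_ ?_ ?_
  · simp only [hconst, map_mul, map_pow, constantCoeff_expH, PowerSeries.constantCoeff_inv,
      constantCoeff_normProd, expNegU', PowerSeries.constantCoeff_C, one_mul]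
  · rw [hconst]
    exact two_mul_ne_zero (mul_ne_zero (pow_ne_zero 2 expNegU_ne_zero)
      (inv_ne_zero (pow_ne_zero 4 one_sub_expNegU_ne_zero)))
  · calc g * PowerSeries.map negUHom g * shiftHom κ (g * PowerSeries.map negUHom g)
        = (g * shiftHom κ g) *
            (PowerSeries.map negUHom g * shiftHom κ (PowerSeries.map negUHom g)) := by
          rw [map_mul]
          ring
      _ = (normProd κ)⁻¹ * ((expNegU' * expH (-κ)) ^ 4 * shiftHom κ (normProd κ)⁻¹) := by
          rw [hK, hreflect, map_negUHom_normProd_inv, map_mul, map_pow, hx]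
      _ = expH (-κ) * expNegU' ^ 2 * (normProd κ)⁻¹ *
            shiftHom κ (expH (-κ) * expNegU' ^ 2 * (normProd κ)⁻¹) := by
          rw [map_mul, map_mul, map_pow, hξ, hx]
          ring

theorem expNegU_sq_mul_unitarityScalar (X : LieType) (n : ℕ) :
    expNegU' ^ 2 * unitarityScalar (((qOf expQuarter)⁻¹ : Luhˣ) : Luh) (xi X n expQuarter : Luhˣ)
        expNegU' (PowerSeries.map negUHom expNegU') =
      expH (-1) * expH (-kappa X n) * normProd (kappa X n) := by
  have hpair (p p' : Luh) (h : p * p' = 1) :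
      expNegU' * ((expNegU' - p') * (PowerSeries.map negUHom expNegU' - p')) =
        -p' * ((1 - expNegU' * p') * (1 - expNegU' * p)) := by
    linear_combination (expNegU' - p') * expNegU_mul_map_negUHom +
      expNegU' * (expNegU' * p' - 1) * h
  rw [unitarityScalar, qOf_expQuarter_inv_sq, xi_expQuarter, normProd]
  linear_combination (expNegU' * ((expNegU' - expH (-kappa X n)) *
    (PowerSeries.map negUHom expNegU' - expH (-kappa X n)))) * hpair _ _ (expH_mul_expH_neg 1) -
    expH (-1) * ((1 - expNegU' * expH (-1)) * (1 - expNegU' * expH 1)) *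
      hpair _ _ (expH_mul_expH_neg (kappa X n))

theorem expH_sq_mul_unitarityScalar (X : LieType) (n : ℕ) :
    expH ((1 + 2 * kappa X n) / 2) ^ 2 *
        (expH (-kappa X n) * expNegU' ^ 2 * (normProd (kappa X n))⁻¹) *
        unitarityScalar (((qOf expQuarter)⁻¹ : Luhˣ) : Luh) (xi X n expQuarter : Luhˣ)
          expNegU' (PowerSeries.map negUHom expNegU') = 1 := by
  have hexp : expH ((1 + 2 * kappa X n) / 2) ^ 2 *
      (expH (-kappa X n) * (expH (-1) * expH (-kappa X n))) = 1 := by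
    rw [sq, ← expH_add, ← expH_add, ← expH_add, ← expH_add, ← expH_zero]
    congr 1
    ring
  linear_combination (expH ((1 + 2 * kappa X n) / 2) ^ 2 * expH (-kappa X n) *
    (normProd (kappa X n))⁻¹) * expNegU_sq_mul_unitarityScalar X n +
    (expH ((1 + 2 * kappa X n) / 2) ^ 2 * (expH (-kappa X n) * (expH (-1) *
      expH (-kappa X n)))) *
      PowerSeries.mul_inv_cancel _ (constantCoeff_normProd_ne_zero (kappa X n)) + hexp

theorem Rhat_map {S : Type*} [CommRing S] (X : LieType) (n : ℕ) (φ : Luh →+* S) (g : Luh) :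
    (Rhat X n g).map φ = φ (expH ((1 + 2 * kappa X n) / 2) * g) •
      Rplus X n (φ expNegU') (Units.map (φ : Luh →* S) expQuarter) := by
  rw [← Rplus_map]
  ext i j
  simp only [Rhat, Matrix.map_apply, Matrix.smul_apply, smul_eq_mul, map_mul]

theorem isUnitaryPair_Rhat (X : LieType) (n : ℕ) {g : Luh} (hg : IsNormalizing (kappa X n) g) :
    IsUnitaryPair 1 (Rhat X n g) ((Rhat X n g).map (PowerSeries.map negUHom)) := by
  have ht : Units.map ((PowerSeries.map negUHom : Luh →+* Luh) : Luh →* Luh) expQuarter =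
      expQuarter := Units.ext (map_negUHom_expH _)
  rw [Rhat_map, ht, Rhat]
  convert (isUnitaryPair_Rplus X n expQuarter expNegU_mul_map_negUHom).smul _ _ using 1
  rw [map_mul, map_negUHom_expH, ← expH_sq_mul_unitarityScalar, ← mul_map_negUHom hg]
  ring

theorem legs_Rhat_mul (X : LieType) (n : ℕ) {g : Luh} (hg : IsNormalizing (kappa X n) g) :
    legs (m := 2) 0 1 (Rhat X n g) * legs 1 0 ((Rhat X n g).map (mapCoeff negU)) = 1 := by
  have hmap : mapCoeff negU = PowerSeries.map negUHom := funext (mapCoeff_eq_map negUHom)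
  rw [hmap, (isUnitaryPair_Rhat X n hg).legs_mul_legs (by decide), one_smul]

end Unitarity

section Crossing

section Ring

variable {S : Type*} [CommRing S] (X : LieType) (n : ℕ) (t : Sˣ)

theorem diagD1_eq : diagD1 X n t =
    Matrix.diagonal fun a : Fin (dim X n) × Fin (dim X n) => ((t ^ twoBar X n a.1 : Sˣ) : S) := by
  rw [diagD1, ← Matrix.diagonal_one, Matrix.diagonal_kronecker_diagonal]
  simp only [mul_one]

theorem diagD1_inv : (diagD1 X n t)⁻¹ =
    Matrix.diagonal fun a : Fin (dim X n) × Fin (dim X n) =>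
      ((t ^ (-twoBar X n a.1) : Sˣ) : S) := by
  apply Matrix.inv_eq_right_inv
  rw [diagD1_eq, Matrix.diagonal_mul_diagonal, ← Matrix.diagonal_one]
  congr 1
  funext a
  rw [← Units.val_mul, ← zpow_add, add_neg_cancel, zpow_zero, Units.val_one]

theorem diagD1_mul_transpose1 (A : End2 (dim X n) S) (a b c e : Fin (dim X n)) :
    (diagD1 X n t * transpose1 X n A * (diagD1 X n t)⁻¹) (a, b) (c, e) =
      wt X n t a c * A (c.rev, b) (a.rev, e) := by
  have hsq : revSign X * revSign X = 1 := by cases X <;> rfl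
  have heps : eps X n a.rev * eps X n c.rev = eps X n a * eps X n c := by
    rw [eps_rev, eps_rev]
    linear_combination eps X n a * eps X n c * hsq
  rw [diagD1_inv, diagD1_eq, Matrix.mul_diagonal, Matrix.diagonal_mul, transpose1, Matrix.of_apply,
    wt, sub_eq_add_neg, zpow_add, Units.val_mul]
  dsimp only
  rw [heps]
  ring

end Ring

theorem Rhat_map_shiftH (X : LieType) (n : ℕ) (c : ℂ) (g : Luh) :
    (Rhat X n g).map (shiftH c) = (expH ((1 + 2 * kappa X n) / 2) * shiftH c g) •
      Rplus X n (expNegU' * expH (-c)) expQuarter := by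
  have ht : Units.map (shiftHom c : Luh →* Luh) expQuarter = expQuarter :=
    Units.ext (shiftH_expH _ _)
  refine (Rhat_map X n (shiftHom c) g).trans ?_
  rw [ht, map_mul, shiftHom_apply, shiftHom_apply, shiftHom_apply, shiftH_expH, shiftH_expNegU]

theorem diagD1_mul_transpose1_Rhat (X : LieType) (n : ℕ) (g : Luh) :
    diagD1 X n expQuarter * transpose1 X n ((Rhat X n g).map (shiftH (kappa X n))) *
        (diagD1 X n expQuarter)⁻¹ =
      (expH ((1 + 2 * kappa X n) / 2) * shiftH (kappa X n) g *
        (expNegU' ^ 2 * expH (-kappa X n))) •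
        (Rplus X n (PowerSeries.map negUHom expNegU') expQuarter).submatrix
          Prod.swap Prod.swap := by
  set y := PowerSeries.map negUHom expNegU'
  have hκ := expH_mul_expH_neg (kappa X n)
  have hξ := xi_expQuarter X n
  have hξ' : (((xi X n expQuarter)⁻¹ : Luhˣ) : Luh) = expH (kappa X n) :=
    Units.inv_eq_of_mul_eq_one_left (hξ ▸ hκ)
  have hx : expNegU' * expH (-kappa X n) * (y * expH (kappa X n)) = 1 := by
    linear_combination expH (kappa X n) * expH (-kappa X n) * expNegU_mul_map_negUHom + hκ
  have hy : ((xi X n expQuarter : Luhˣ) : Luh) * (y * expH (kappa X n)) = y := by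
    rw [hξ]
    linear_combination y * hκ
  ext1 ⟨a, b⟩ ⟨c, e⟩
  have hcross := wt_mul_Rplus X n hx expQuarter a b c e
  rw [hy, hξ'] at hcross
  rw [diagD1_mul_transpose1, Rhat_map_shiftH, Matrix.smul_apply, Matrix.smul_apply,
    Matrix.submatrix_apply, smul_eq_mul, smul_eq_mul, Prod.swap_prod_mk, Prod.swap_prod_mk]
  linear_combination (expH ((1 + 2 * kappa X n) / 2) * shiftH (kappa X n) g) * hcross +
    (expH ((1 + 2 * kappa X n) / 2) * shiftH (kappa X n) g * expNegU' ^ 2 * expH (-kappa X n) *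
      Rplus X n y expQuarter (b, a) (e, c)) * hκ

theorem Rhat_crossing (X : LieType) (n : ℕ) {g : Luh} (hg : IsNormalizing (kappa X n) g) :
    Rhat X n g * diagD1 X n expQuarter *
      transpose1 X n ((Rhat X n g).map (shiftH (kappa X n))) * (diagD1 X n expQuarter)⁻¹ = 1 := by
  have hg' : (normProd (kappa X n))⁻¹ = g * shiftH (kappa X n) g := hg.2.symm
  have hunitary := (isUnitaryPair_Rplus X n expQuarter expNegU_mul_map_negUHom).smul
    (expH ((1 + 2 * kappa X n) / 2) * g) (expH ((1 + 2 * kappa X n) / 2) *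
      shiftH (kappa X n) g * (expNegU' ^ 2 * expH (-kappa X n)))
  rw [mul_assoc (Rhat X n g), mul_assoc (Rhat X n g), diagD1_mul_transpose1_Rhat, Rhat]
  refine (hunitary.mul_swap.trans (congrArg (· • (1 : End2 _ Luh)) ?_)).trans (one_smul Luh _)
  rw [← expH_sq_mul_unitarityScalar, hg']
  ring

end Crossing

section YangBaxter

theorem ybDefect_smul {S : Type*} [CommRing S] {N : ℕ} (α β γ : S) (A B C : End2 N S) :
    ybDefect (α • A) (β • B) (γ • C) = (α * β * γ) • ybDefect A B C := by
  simp only [ybDefect, legs_smul, Matrix.smul_mul, Matrix.mul_smul, smul_smul, smul_sub]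
  congr 2 <;> ring

section Field

variable {k : Type*} [Field k] {φ ψ χ : Lu →+* k}

theorem isGeneric_map_expNegU (hχ : χ expNegU = φ expNegU * ψ expNegU) :
    IsGeneric (PowerSeries.C (φ expNegU)) (PowerSeries.C (ψ expNegU)) where
  left_ne_zero := (map_ne_zero φ).mpr expNegU_ne_zero
  right_ne_zero := (map_ne_zero ψ).mpr expNegU_ne_zero
  left_ne_one := (map_eq_one_iff φ φ.injective).not.mpr expNegU_ne_one
  right_ne_one := (map_eq_one_iff ψ ψ.injective).not.mpr expNegU_ne_one
  mul_ne_one := hχ ▸ (map_eq_one_iff χ χ.injective).not.mpr expNegU_ne_one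

theorem map_expQuarter_congr (h : φ.comp (HahnSeries.C : ℂ →+* Lu) = ψ.comp HahnSeries.C) :
    Units.map (PowerSeries.map φ : Luh →* PowerSeries k) expQuarter =
      Units.map (PowerSeries.map ψ : Luh →* PowerSeries k) expQuarter :=
  Units.ext ((map_expH φ _).trans (h ▸ (map_expH ψ _).symm))

theorem ybDefect_map_Rhat (X : LieType) (n : ℕ) (g : Luh)
    (hψ : ψ.comp (HahnSeries.C : ℂ →+* Lu) = φ.comp HahnSeries.C)
    (hχ : χ.comp (HahnSeries.C : ℂ →+* Lu) = φ.comp HahnSeries.C)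
    (hmul : χ expNegU = φ expNegU * ψ expNegU) :
    ybDefect ((Rhat X n g).map (PowerSeries.map φ)) ((Rhat X n g).map (PowerSeries.map χ))
      ((Rhat X n g).map (PowerSeries.map ψ)) = 0 := by
  have ht : PowerSeries.constantCoeff
      (Units.map (PowerSeries.map φ : Luh →* PowerSeries k) expQuarter : PowerSeries k) = 1 := by
    change PowerSeries.constantCoeff (PowerSeries.map φ (expH _)) = 1
    rw [← PowerSeries.coeff_zero_eq_constantCoeff_apply, PowerSeries.coeff_map,
      PowerSeries.coeff_zero_eq_constantCoeff_apply, constantCoeff_expH, map_one]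
  have hzero := spectralDefect_eq_zero X n ht (isGeneric_map_expNegU hmul)
  rw [spectralDefect, ← map_mul] at hzero
  rw [Rhat_map, Rhat_map, Rhat_map, map_expQuarter_congr hψ, map_expQuarter_congr hχ,
    ybDefect_smul, expNegU', PowerSeries.map_C, PowerSeries.map_C, PowerSeries.map_C, hmul,
    hzero, smul_zero]

end Field

/-- `f(u) ↦ f(u)` as a ring homomorphism `ℂ((u)) → ℂ((u))((v))`. -/
def atUHom : Lu →+* Luv := HahnSeries.C

theorem Rhat_yang_baxter (X : LieType) (n : ℕ) (g : Luh) :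
    legs (m := 3) 0 1 ((Rhat X n g).map (mapCoeff atU)) *
        legs 0 2 ((Rhat X n g).map (mapCoeff atUV)) * legs 1 2 ((Rhat X n g).map (mapCoeff atV)) =
      legs 1 2 ((Rhat X n g).map (mapCoeff atV)) * legs 0 2 ((Rhat X n g).map (mapCoeff atUV)) *
        legs 0 1 ((Rhat X n g).map (mapCoeff atU)) := by
  have hu : mapCoeff atU = PowerSeries.map atUHom :=
    funext (mapCoeff_eq_map (A := Lu) (B := Luv) atUHom)
  have hv : mapCoeff atV = PowerSeries.map atVHom :=
    funext (mapCoeff_eq_map (A := Lu) (B := Luv) atVHom)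
  have huv : mapCoeff atUV = PowerSeries.map atUVHom :=
    funext (mapCoeff_eq_map (A := Lu) (B := Luv) atUVHom)
  have hdefect := ybDefect_map_Rhat (k := Luv) (φ := atUHom) (ψ := atVHom) (χ := atUVHom) X n g
    atVHom_comp_C atUVHom_comp_C atUV_expNegU
  rw [hu, hv, huv]
  exact sub_eq_zero.mp hdefect

end YangBaxter

end TrigR

end

open TrigR in
theorem mainTheorem3 (X : LieType) (n : ℕ) :
    (∃! g : Luh, IsNormalizing (kappa X n) g) ∧
    ∀ g : Luh, IsNormalizing (kappa X n) g →
      -- Yang–Baxter equation, in `End(ℂ^N)^{⊗ 3}((u))((v))[[h]]`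
      (let Ru : End2 (dim X n) Luvh := (Rhat X n g).map (mapCoeff atU)
       let Rv : End2 (dim X n) Luvh := (Rhat X n g).map (mapCoeff atV)
       let Ruv : End2 (dim X n) Luvh := (Rhat X n g).map (mapCoeff atUV)
       legs (m := 3) 0 1 Ru * legs 0 2 Ruv * legs 1 2 Rv =
         legs 1 2 Rv * legs 0 2 Ruv * legs 0 1 Ru) ∧
      -- crossing symmetry
      Rhat X n g * diagD1 X n expQuarter *
        transpose1 X n ((Rhat X n g).map (shiftH (kappa X n))) * (diagD1 X n expQuarter)⁻¹ = 1 ∧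
      -- unitarity
      legs (m := 2) 0 1 (Rhat X n g) * legs 1 0 ((Rhat X n g).map (mapCoeff negU)) = 1 :=
  ⟨existsUnique_isNormalizing _, fun g hg =>
    ⟨Rhat_yang_baxter X n g, Rhat_crossing X n hg, legs_Rhat_mul X n hg⟩⟩
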